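/- Let $M$ be a compact smooth two-dimensional manifold, possibly with boundary, and let $X_t : M\to\mathbb{R}^3$, $t\in\mathcal{T}$ ($\mathcal{T}\subseteq\mathbb{R}$ open, e.g. an open interval), be a smooth family of immersions parameterizing a moving surface $\mathcal{S}=\mathcal{S}_t$, with smooth unit normal field $\nu$, surface measure $d\mathcal{S}$, componentwise surface derivative $\nabla_C$ (the ambient derivative composed with the projection $\mathrm{Id}-\nu\otimes\nu$), trace-divergence $\mathrm{Div}_C W=\operatorname{tr}\nabla_C W$, surface gradient $\nabla$, Laplace--Beltrami operator $\Delta=\operatorname{div}\nabla$, and mean curvature $\mathcal{H}=-\mathrm{Div}_C\,\nu$. Let $V_{\mathfrak o}=\partial_tX=v_{\mathfrak o}+v_\perp\nu$ be the observer velocity, $v_\perp$ its normal part and $v_{\mathfrak o}$ its arbitrary tangential part, where $v_{\mathfrak o}$ has no co-normal component on $\partial\mathcal{S}$. Let $\psi$ be a smooth time-dependent scalar field on the surface; $\partial_t\psi$ denotes its time derivative at fixed parameter in $M$. Let $\mathfrak{U}=\mathfrak{U}[X,\psi]$ be a surface energy, i.e. a real functional, defined on an open set of pairs of a smooth immersion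 and a smooth scalar field, that is $C^1$ along smooth finite-parameter families of such pairs and does not change if $X$ and $\psi$ are composed with the same reparameterization of $M$ (a diffeomorphism smoothly isotopic to the identity). The functional derivatives at $(X,\psi)$ are the continuous fields $D_\psi\mathfrak{U}$ and $D_X\mathfrak{U}$ with $$\frac{d}{d\epsilon}\Big|_{\epsilon=0}\mathfrak{U}[X,\psi+\epsilon\phi]=\int_{\mathcal{S}}\phi\,D_\psi\mathfrak{U}\,d\mathcal{S},\qquad \frac{d}{d\epsilon}\Big|_{\epsilon=0}\mathfrak{U}[X+\epsilon w_\perp\nu,\ \psi+\epsilon\,\eth_{w_\perp}\psi]=\int_{\mathcal{S}}w_\perp\,\nu\cdot D_X\mathfrak{U}\,d\mathcal{S}$$ for all smooth scalar fields $\phi$, $w_\perp$, where $\eth_{w_\perp}\psi=\psi\,w_\perp\mathcal{H}$ is the normal Truesdell gauge of surface independence (only the normal part $\nu\cdot D_X\mathfrak{U}$ matters, and only it is determined). Let $M_X,M_\psi>0$ be constants and suppose that, for all $t\in\mathcal{T}$, the functional derivatives exist, $D_\psi\mathfrak{U}$ is of class $C^2$ on the surface, $\nabla D_\psi\mathfrak{U}$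 has no co-normal component on $\partial\mathcal{S}$, and the gradient flow restricted to purely normal surface motion holds: $$M_X v_\perp=-\,\nu\cdot D_X\mathfrak{U},\qquad M_\psi\,\mathring{\psi}|_{v=0}=\Delta D_\psi\mathfrak{U},\qquad\text{where}\quad \mathring{\psi}|_{v=0}=\partial_t\psi-\left(\nabla_{v_{\mathfrak o}}\psi+\psi\,v_\perp\mathcal{H}\right).$$ Then, at every $t\in\mathcal{T}$, the functions $t\mapsto\int_{\mathcal{S}}\psi\,d\mathcal{S}$ and $t\mapsto\mathfrak{U}[X_t,\psi_t]$ are differentiable, with $$\frac{d}{dt}\int_{\mathcal{S}}\psi\,d\mathcal{S}=0,\qquad \frac{d}{dt}\mathfrak{U}=-\left(M_X^{-1}\,\|\nu\cdot D_X\mathfrak{U}\|_{L^2(\mathcal{S})}^2+M_\psi^{-1}\,\|\nabla D_\psi\mathfrak{U}\|_{L^2(\mathcal{S})}^2\right)\le 0 .$$ -/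

import Mathlib

open MeasureTheory Set Function
open scoped Manifold ContDiff Topology

noncomputable section

/-- Euclidean three-space, the ambient space of all surfaces. -/
abbrev E3 : Type := EuclideanSpace ℝ (Fin 3)

/-- The coordinate plane of two-dimensional surfaces. -/
abbrev E2 : Type := EuclideanSpace ℝ (Fin 2)

/-- The model of smooth surfaces with (possibly empty) boundary: the closed half-plane
`{x | 0 ≤ x 0}`. -/
abbrev I2 : ModelWithCorners ℝ E2 (EuclideanHalfSpace 2) := 𝓡∂ 2

section Calculus

variable {M : Type*} [TopologicalSpace M] [ChartedSpace (EuclideanHalfSpace 2) M]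
variable {F : Type*} [NormedAddCommGroup F] [NormedSpace ℝ F]

/-- The differential `dR_p : T_p M → F` of a field `R : M → F`, where `T_p M` is written in the
coordinates of the preferred chart at `p`. -/
def differential (R : M → F) (p : M) : E2 →L[ℝ] F := mfderiv I2 𝓘(ℝ, F) R p

/-- A smooth immersed surface `X : M → ℝ³`. -/
def IsSmoothImmersion (X : M → E3) : Prop :=
  ContMDiff I2 𝓘(ℝ, E3) ∞ X ∧ ∀ p, Injective (differential X p)

/-- The metric tensor `dXᵀ dX` of the surface at `p`. -/
def metricTensor (X : M → E3) (p : M) : E2 →L[ℝ] E2 :=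
  (ContinuousLinearMap.adjoint (differential X p)).comp (differential X p)

/-- The componentwise surface derivative `∇_C R = dR ∘ (dXᵀ dX)⁻¹ dXᵀ` of a field `R` on the
surface `X`.  It is the linear map on `ℝ³` that sends `dX v` to `dR v` and vanishes on normal
vectors, i.e. the restriction of the ambient derivative of any extension of `R`, composed with the
orthogonal projection onto the tangent plane. -/
def surfaceDeriv (X : M → E3) (R : M → F) (p : M) : E3 →L[ℝ] F :=
  ((differential R p).comp (Ring.inverse (metricTensor X p))).comp
    (ContinuousLinearMap.adjoint (differential X p))

/-- The surface gradient `∇ f`, as a tangential vector field in `ℝ³`. -/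
def surfaceGrad (X : M → E3) (f : M → ℝ) (p : M) : E3 :=
  (InnerProductSpace.toDual ℝ E3).symm (surfaceDeriv X f p)

/-- The trace-divergence `Div_C W` of an `ℝ³`-valued field on the surface.  On tangential fields it
is the covariant divergence. -/
def surfaceDiv (X : M → E3) (W : M → E3) (p : M) : ℝ :=
  LinearMap.trace ℝ E3 (surfaceDeriv X W p : E3 →ₗ[ℝ] E3)

/-- The Laplace-Beltrami operator `Δ = div ∘ ∇`. -/
def laplaceBeltrami (X : M → E3) (f : M → ℝ) (p : M) : ℝ :=
  surfaceDiv X (surfaceGrad X f) p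

/-- `ν` is a unit normal field of the surface `X`. -/
def IsUnitNormal (X : M → E3) (ν : M → E3) : Prop :=
  ∀ p, ‖ν p‖ = 1 ∧ ∀ v : E2, inner ℝ (ν p) (differential X p v) = 0

/-- The mean curvature `H = - Div_C ν`. -/
def meanCurvature (X : M → E3) (ν : M → E3) (p : M) : ℝ := - surfaceDiv X ν p

/-- `n` is the outward unit co-normal of the surface at the boundary point `p`: a tangential unit
vector that is orthogonal to the boundary curve and points out of the surface.  In the half-plane
model, the tangent vectors of the boundary are those with vanishing zeroth coordinate, and the
outward ones are those whose zeroth coordinate is negative. -/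
def IsConormal (X : M → E3) (p : M) (n : E3) : Prop :=
  ‖n‖ = 1 ∧ (∃ η : E2, η 0 < 0 ∧ differential X p η = n) ∧
    ∀ ζ : E2, ζ 0 = 0 → inner ℝ n (differential X p ζ) = 0

/-- The vector field `q` has no flux through the boundary: `⟨q, n⟩ = 0` on `∂S`. -/
def NoBoundaryFlux (X : M → E3) (q : M → E3) : Prop :=
  ∀ p ∈ I2.boundary M, ∀ n : E3, IsConormal X p n → inner ℝ (q p) n = 0

end Calculus

section Area

variable {M : Type*} [TopologicalSpace M] [ChartedSpace (EuclideanHalfSpace 2) M]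

/-- The area density `√ det g` of the surface `X` in the chart around `c`, as a function of the
coordinates. -/
def areaDensity (X : M → E3) (c : M) (y : E2) : ℝ :=
  let A : E2 →L[ℝ] E3 := fderivWithin ℝ (X ∘ (extChartAt I2 c).symm) (range I2) y
  Real.sqrt ((ContinuousLinearMap.adjoint A).comp A).det

variable (M) in
theorem exists_chart_cover [CompactSpace M] :
    ∃ l : List M, ∀ p : M, ∃ c ∈ l, p ∈ (extChartAt I2 c).source := by
  obtain ⟨s, hs⟩ := isCompact_univ.elim_finite_subcover
    (fun c : M => (extChartAt I2 c).source) (fun c => isOpen_extChartAt_source c)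
    (fun p _ => mem_iUnion.2 ⟨p, mem_extChartAt_source p⟩)
  refine ⟨s.toList, fun p => ?_⟩
  obtain ⟨c, hc, hp⟩ := mem_iUnion₂.1 (hs (mem_univ p))
  exact ⟨c, Finset.mem_toList.2 hc, hp⟩

variable (M) in
/-- The centers of finitely many charts that cover the compact surface. -/
def chartCenters [CompactSpace M] : List M := (exists_chart_cover M).choose

/-- The `i`-th cell: the part of the `i`-th chart domain that earlier ones do not cover.  The cells
are pairwise disjoint and cover the surface. -/
def chartCell [CompactSpace M] (i : Fin (chartCenters M).length) : Set M :=
  (extChartAt I2 ((chartCenters M).get i)).source \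
    ⋃ j : Fin (chartCenters M).length, ⋃ _ : j < i,
      (extChartAt I2 ((chartCenters M).get j)).source

/-- The surface area measure `dS` of `X`, as a measure on the parameter surface: on each cell it is
`√ det g` times Lebesgue measure in the coordinates of a chart.  (By the change of variables
formula this does not depend on the cells or the charts.) -/
def areaMeasure [CompactSpace M] [MeasurableSpace M] (X : M → E3) : Measure M :=
  ∑ i : Fin (chartCenters M).length,
    let e := extChartAt I2 ((chartCenters M).get i)
    Measure.map e.symm
      ((volume.restrict (e '' chartCell i)).withDensity
        fun y => ENNReal.ofReal (areaDensity X ((chartCenters M).get i) y))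

end Area

section Energy

variable (M : Type*) [TopologicalSpace M] [ChartedSpace (EuclideanHalfSpace 2) M]

/-- A finite-parameter family of fields `R s : M → F` that is jointly smooth for `s` in the
open set `O`. -/
def IsSmoothFamily {M : Type*} [TopologicalSpace M] [ChartedSpace (EuclideanHalfSpace 2) M]
    {P F : Type*} [NormedAddCommGroup P] [NormedSpace ℝ P] [NormedAddCommGroup F] [NormedSpace ℝ F]
    (O : Set P) (R : P → M → F) : Prop :=
  ContMDiffOn (𝓘(ℝ, P).prod I2) 𝓘(ℝ, F) ∞ (fun q : P × M => R q.1 q.2) (O ×ˢ univ)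

/-- A change of parameters of `M` that is smoothly isotopic to the identity. -/
def IsIsotopicToId {M : Type*} [TopologicalSpace M] [ChartedSpace (EuclideanHalfSpace 2) M]
    (Φ : M ≃ₘ^∞⟮I2, I2⟯ M) : Prop :=
  ∃ Ψ : ℝ → (M ≃ₘ^∞⟮I2, I2⟯ M),
    ContMDiff (𝓘(ℝ, ℝ).prod I2) I2 ∞ (fun q : ℝ × M => Ψ q.1 q.2) ∧
      (∀ p, Ψ 0 p = p) ∧ ∀ p, Ψ 1 p = Φ p

/-- A surface energy `𝔘 = 𝔘[X, ψ]`: a real functional of a parameterized surface `X` and a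
scalar field `ψ` on it, which is continuously differentiable along smooth finite-parameter families,
and which depends on the parameterization only as a realization of the surface, i.e. it does not
change when `X` and `ψ` are composed with the same change of parameters.  (Only changes of
parameters isotopic to the identity are considered, so that energies which depend on the
orientation are included.)  The energy may be defined on an open set of pairs only, e.g. for
positive `ψ` or embedded surfaces. -/
structure SurfaceEnergy where
  /-- the pairs `(X, ψ)` at which the energy is defined -/
  dom : Set ((M → E3) × (M → ℝ))
  /-- the value of the energy -/
  toFun : (M → E3) → (M → ℝ) → ℝ
  smooth_of_mem : ∀ X ψ, (X, ψ) ∈ dom → IsSmoothImmersion X ∧ ContMDiff I2 𝓘(ℝ, ℝ) ∞ ψ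
  isOpen_dom : ∀ (n : ℕ) (O : Set (EuclideanSpace ℝ (Fin n)))
    (X : EuclideanSpace ℝ (Fin n) → M → E3) (ψ : EuclideanSpace ℝ (Fin n) → M → ℝ),
    IsOpen O → IsSmoothFamily O X → IsSmoothFamily O ψ → IsOpen {s ∈ O | (X s, ψ s) ∈ dom}
  contDiffOn_family : ∀ (n : ℕ) (O : Set (EuclideanSpace ℝ (Fin n)))
    (X : EuclideanSpace ℝ (Fin n) → M → E3) (ψ : EuclideanSpace ℝ (Fin n) → M → ℝ),
    IsOpen O → IsSmoothFamily O X → IsSmoothFamily O ψ → (∀ s ∈ O, (X s, ψ s) ∈ dom) →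
      ContDiffOn ℝ 1 (fun s => toFun (X s) (ψ s)) O
  reparam : ∀ Φ : M ≃ₘ^∞⟮I2, I2⟯ M, IsIsotopicToId Φ → ∀ X ψ, (X, ψ) ∈ dom →
    (X ∘ Φ, ψ ∘ Φ) ∈ dom ∧ toFun (X ∘ Φ) (ψ ∘ Φ) = toFun X ψ

end Energy

section Variations

variable {M : Type*} [TopologicalSpace M] [ChartedSpace (EuclideanHalfSpace 2) M]

/-- The normal Truesdell gauge of surface independence `ð_{w⊥} ψ = ψ w⊥ H`: the variation of `ψ`
that accompanies the normal variation `w⊥ ν` of the surface. -/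
def normalTruesdellGauge (X ν : M → E3) (ψ w : M → ℝ) (p : M) : ℝ :=
  ψ p * w p * meanCurvature X ν p

variable [CompactSpace M] [MeasurableSpace M]

/-- `G` is the functional derivative `D_ψ 𝔘` at `(X, ψ)`:
`d/dε 𝔘[X, ψ + ε φ] = ∫ G φ dS` at `ε = 0` for all smooth `φ`. -/
def IsScalarFunctionalDeriv (U : SurfaceEnergy M) (X : M → E3) (ψ : M → ℝ) (G : M → ℝ) : Prop :=
  Continuous G ∧ ∀ φ : M → ℝ, ContMDiff I2 𝓘(ℝ, ℝ) ∞ φ →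
    HasDerivAt (fun ε : ℝ => U.toFun X (fun p => ψ p + ε * φ p))
      (∫ p, G p * φ p ∂(areaMeasure X)) 0

/-- `D` is a spatial functional derivative `D_X 𝔘` at `(X, ψ)` with respect to the normal
Truesdell gauge: `d/dε 𝔘[X + ε w⊥ ν, ψ + ε ð_{w⊥} ψ] = ∫ (ν · D) w⊥ dS` at `ε = 0` for all smooth
normal displacements `w⊥`.  This determines the normal part `ν · D`, the only part that enters the
normal flow. -/
def IsSpatialFunctionalDeriv (U : SurfaceEnergy M) (X ν : M → E3) (ψ : M → ℝ) (D : M → E3) :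
    Prop :=
  Continuous D ∧ ∀ w : M → ℝ, ContMDiff I2 𝓘(ℝ, ℝ) ∞ w →
    HasDerivAt
      (fun ε : ℝ => U.toFun (fun p => X p + (ε * w p) • ν p)
        (fun p => ψ p + ε * normalTruesdellGauge X ν ψ w p))
      (∫ p, inner ℝ (ν p) (D p) * w p ∂(areaMeasure X)) 0

end Variations

section Flow

variable {M : Type*} [TopologicalSpace M] [ChartedSpace (EuclideanHalfSpace 2) M]

/-- The observer velocity `V_o = ∂_t X`. -/
def observerVelocity (X : ℝ → M → E3) (t : ℝ) (p : M) : E3 := deriv (fun s => X s p) t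

/-- The normal velocity `v⊥ = V_o · ν`. -/
def normalVelocity (X ν : ℝ → M → E3) (t : ℝ) (p : M) : ℝ :=
  inner ℝ (observerVelocity X t p) (ν t p)

/-- The tangential observer velocity `v_o = V_o - v⊥ ν`. -/
def tangentialObserverVelocity (X ν : ℝ → M → E3) (t : ℝ) (p : M) : E3 :=
  observerVelocity X t p - normalVelocity X ν t p • ν t p

/-- The scalar Truesdell time derivative for purely normal material motion,
`∂_t ψ - (∇_{v_o} ψ + ψ v⊥ H)`. -/
def normalTruesdellRate (X ν : ℝ → M → E3) (ψ : ℝ → M → ℝ) (t : ℝ) (p : M) : ℝ :=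
  deriv (fun s => ψ s p) t -
    (inner ℝ (tangentialObserverVelocity X ν t p) (surfaceGrad (X t) (ψ t) p) +
      ψ t p * normalVelocity X ν t p * meanCurvature (X t) (ν t) p)

/-- A smooth moving surface during the time set `T`, given by an arbitrary observer
parameterization `X` over a fixed parameter surface, and oriented by the unit normal `ν`.  The
material moves in normal direction only; that the parameterization keeps track of all of the
surface, so that no material crosses the boundary of the parameter surface, means that the
tangential observer velocity has no co-normal component at the boundary. -/
structure IsMovingSurface (T : Set ℝ) (X ν : ℝ → M → E3) : Prop where
  smooth : IsSmoothFamily T X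
  smooth_normal : IsSmoothFamily T ν
  immersion : ∀ t ∈ T, IsSmoothImmersion (X t)
  normal : ∀ t ∈ T, IsUnitNormal (X t) (ν t)
  boundary : ∀ t ∈ T, NoBoundaryFlux (X t) (tangentialObserverVelocity X ν t)

/-- The gradient flow restricted to purely normal surface motion,
`M_X v⊥ = - ν · D_X 𝔘` and `M_ψ ψ° = Δ D_ψ 𝔘`, with respect to the normal Truesdell gauge and with
no flux of `∇ D_ψ 𝔘` through the boundary (if there is one).  `DX t` and `Dψ t` are the functional
derivatives at time `t`. -/
structure IsNormalGradientFlow [CompactSpace M] [MeasurableSpace M] (U : SurfaceEnergy M)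
    (MX Mψ : ℝ) (T : Set ℝ) (X ν : ℝ → M → E3) (ψ : ℝ → M → ℝ)
    (DX : ℝ → M → E3) (Dψ : ℝ → M → ℝ) : Prop where
  surface : IsMovingSurface T X ν
  smooth_scalar : IsSmoothFamily T ψ
  mem_dom : ∀ t ∈ T, (X t, ψ t) ∈ U.dom
  spatial_deriv : ∀ t ∈ T, IsSpatialFunctionalDeriv U (X t) (ν t) (ψ t) (DX t)
  scalar_deriv : ∀ t ∈ T, IsScalarFunctionalDeriv U (X t) (ψ t) (Dψ t)
  scalar_deriv_regular : ∀ t ∈ T, ContMDiff I2 𝓘(ℝ, ℝ) 2 (Dψ t)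
  spatial_eq : ∀ t ∈ T, ∀ p, MX * normalVelocity X ν t p = - inner ℝ (ν t p) (DX t p)
  scalar_eq : ∀ t ∈ T, ∀ p,
    Mψ * normalTruesdellRate X ν ψ t p = laplaceBeltrami (X t) (Dψ t) p
  no_flux : ∀ t ∈ T, NoBoundaryFlux (X t) (surfaceGrad (X t) (Dψ t))

end Flow

end

/-!
Mass is conserved because of the transport theorem `hasDerivAt_integral_areaMeasure`: the rate of
`∫ ψ dS` is `∫ (∂ₜψ + ψ Div V) dS`, where `V` is the observer velocity.  The integrand is the normal
Truesdell rate of `ψ` plus the divergence of `ψ` times the tangential observer velocity, and the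
latter integrates to zero, since that field is tangent to the boundary (`integral_surfaceDiv`).
Along the flow the Truesdell rate is a multiple of `Δ D_ψ𝔘`, which integrates to zero as well.

For the energy, only three kinds of variations are accessible: tangential ones, through the
invariance under reparameterizations, normal ones and those of the scalar, through the functional
derivatives.  An observer moves in all three directions at once, so the point is that the rate of
`𝔘` along a smooth curve of pairs `(X, ψ)` depends only on the velocity of the curve, and
additively.  Differentiability of `𝔘` along smooth finite-parameter families suffices for this.
By Hadamard's lemma (`IsSmoothFamily.exists_hadamard`) a smooth curve of fields is
`R a = R 0 + a • Q a` with `Q` smooth, hence the diagonal of the two-parameter family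
`(a, b) ↦ R 0 + b • Q a`, which is constant for `b = 0` and the straight line in the direction of
the velocity for `a = 0`; the chain rule at the origin gives `SurfaceEnergy.hasDerivAt_curve`.
Additivity (`SurfaceEnergy.variation_add`) is the chain rule for a two-parameter family of lines.

A tangential variation without flux through the boundary contributes nothing
(`SurfaceEnergy.variation_tangential`).  By additivity and a partition of unity it may be supposed
to be supported in a chart, where it is the velocity of the maps `y ↦ y + κ τ • ζ y` with a
compactly supported field `ζ`, tangent to the boundary of the half plane.  For small `κ τ` these
are diffeomorphisms of the half plane, and they extend to diffeomorphisms of the surface isotopic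
to the identity (`exists_diffeomorph_curve`); no flow of a vector field is needed.

What remains of the rate of the energy is `∫ (ν · D_X𝔘) v⊥ + ∫ D_ψ𝔘 ψ°`
(`IsMovingSurface.hasDerivAt_energy`).  The flow equations and an integration by parts
(`integral_mul_laplaceBeltrami`) turn it into minus the two squared norms.
-/

noncomputable section

/-! ### The Moore-Penrose inverse of an injective linear map of the plane into space -/

section PseudoInverse

open ContinuousLinearMap (adjoint)

variable {F : Type*} [NormedAddCommGroup F] [NormedSpace ℝ F]

/-- The Gram operator `Aᵀ A`. -/
def gram (A : E2 →L[ℝ] E3) : E2 →L[ℝ] E2 := (adjoint A).comp A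

/-- The Moore-Penrose inverse `(Aᵀ A)⁻¹ Aᵀ` of an injective `A`. -/
def pinv (A : E2 →L[ℝ] E3) : E3 →L[ℝ] E2 := (Ring.inverse (gram A)).comp (adjoint A)

theorem inner_gram (A : E2 →L[ℝ] E3) (u v : E2) :
    inner ℝ u (gram A v) = inner ℝ (A u) (A v) := by
  simp [gram, ContinuousLinearMap.adjoint_inner_right]

theorem isUnit_of_injective {L : E2 →L[ℝ] E2} (h : Injective L) : IsUnit L :=
  ContinuousLinearMap.isUnit_iff_bijective.2
    ⟨h, (LinearMap.injective_iff_surjective (f := (L : E2 →ₗ[ℝ] E2))).1 h⟩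

theorem isUnit_gram {A : E2 →L[ℝ] E3} (hA : Injective A) : IsUnit (gram A) := by
  refine isUnit_of_injective ((injective_iff_map_eq_zero _).2 fun v hv => ?_)
  have h := inner_gram A v v
  rw [hv, inner_zero_right, eq_comm, inner_self_eq_zero] at h
  exact (injective_iff_map_eq_zero A).1 hA v h

theorem gram_comp_pinv {A : E2 →L[ℝ] E3} (hA : Injective A) :
    (gram A).comp (pinv A) = adjoint A := by
  rw [pinv, ← ContinuousLinearMap.comp_assoc]
  change (gram A * Ring.inverse (gram A)).comp _ = _
  rw [Ring.mul_inverse_cancel _ (isUnit_gram hA)]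
  ext1 v; rfl

theorem gram_pinv_apply {A : E2 →L[ℝ] E3} (hA : Injective A) (w : E3) :
    gram A (pinv A w) = adjoint A w :=
  congrArg (fun T : E3 →L[ℝ] E2 => T w) (gram_comp_pinv hA)

theorem inner_apply_pinv {A : E2 →L[ℝ] E3} (hA : Injective A) (u : E2) (w : E3) :
    inner ℝ (A u) (A (pinv A w)) = inner ℝ (A u) w := by
  rw [← inner_gram, gram_pinv_apply hA, ContinuousLinearMap.adjoint_inner_right]

theorem pinv_apply_apply {A : E2 →L[ℝ] E3} (hA : Injective A) (v : E2) : pinv A (A v) = v := by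
  change Ring.inverse (gram A) (gram A v) = v
  change (Ring.inverse (gram A) * gram A) v = v
  rw [Ring.inverse_mul_cancel _ (isUnit_gram hA)]
  rfl

theorem pinv_comp_self {A : E2 →L[ℝ] E3} (hA : Injective A) :
    (pinv A).comp A = ContinuousLinearMap.id ℝ E2 := by
  ext1 v; exact pinv_apply_apply hA v

theorem adjoint_apply_eq_zero {A : E2 →L[ℝ] E3} {n : E3} (hn : ∀ v, inner ℝ n (A v) = 0) :
    adjoint A n = 0 := by
  refine ext_inner_right ℝ fun v => ?_
  rw [ContinuousLinearMap.adjoint_inner_left, hn v, inner_zero_left]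

theorem pinv_apply_normal {A : E2 →L[ℝ] E3} {n : E3} (hn : ∀ v, inner ℝ n (A v) = 0) :
    pinv A n = 0 := by
  rw [pinv, ContinuousLinearMap.comp_apply, adjoint_apply_eq_zero hn, map_zero]

/-- A change of coordinates `L` cancels in `B (Aᵀ A)⁻¹ Aᵀ`; this makes the surface derivative
independent of the chart. -/
theorem comp_pinv_comp {A : E2 →L[ℝ] E3} (hA : Injective A) {L : E2 →L[ℝ] E2} (hL : Injective L)
    (B : E2 →L[ℝ] F) : (B.comp L).comp (pinv (A.comp L)) = B.comp (pinv A) := by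
  have hAL : Injective (A.comp L) := hA.comp hL
  have key : L.comp (pinv (A.comp L)) = pinv A := by
    ext1 w
    -- Both sides have the same image under `A`, namely the orthogonal projection of `w`.
    obtain ⟨u, hu⟩ := (LinearMap.injective_iff_surjective (f := (L : E2 →ₗ[ℝ] E2))).1 hL
      (L (pinv (A.comp L) w) - pinv A w)
    have h1 := inner_apply_pinv hAL u w
    have h2 := inner_apply_pinv hA (L u) w
    have h3 : inner ℝ (A (L u)) (A (L (pinv (A.comp L) w) - pinv A w)) = (0 : ℝ) := by
      rw [map_sub, inner_sub_right, h2, sub_eq_zero]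
      exact h1
    have hu' : L u = L (pinv (A.comp L) w) - pinv A w := hu
    rw [← hu', inner_self_eq_zero] at h3
    have h4 := (injective_iff_map_eq_zero A).1 hA _ h3
    rw [hu', sub_eq_zero] at h4
    exact h4
  rw [ContinuousLinearMap.comp_assoc, key]

theorem contDiffAt_pinv {A : E2 →L[ℝ] E3} (hA : Injective A) {n : ℕ∞} :
    ContDiffAt ℝ n pinv A := by
  have hadj : ContDiff ℝ n (fun A : E2 →L[ℝ] E3 => adjoint A) :=
    ((adjoint (𝕜 := ℝ) (E := E2) (F := E3)).toContinuousLinearEquiv.toContinuousLinearMap :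
      (E2 →L[ℝ] E3) →L[ℝ] (E3 →L[ℝ] E2)).contDiff
  have hgram : ContDiff ℝ n gram := hadj.clm_comp contDiff_id
  obtain ⟨u, hu⟩ := isUnit_gram hA
  have hinv : ContDiffAt ℝ n (Ring.inverse : (E2 →L[ℝ] E2) → _) (gram A) := by
    rw [← hu]; exact contDiffAt_ringInverse ℝ u
  exact (hinv.comp A hgram.contDiffAt).clm_comp hadj.contDiffAt

/-- A vector that is orthogonal to a normal vector of the tangent plane is tangential. -/
theorem exists_apply_eq_of_inner_normal {A : E2 →L[ℝ] E3} (hA : Injective A) {n q : E3}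
    (hn : ‖n‖ = 1) (hAn : ∀ v, inner ℝ n (A v) = 0) (hq : inner ℝ n q = 0) : ∃ v, A v = q := by
  have hn0 : n ≠ 0 := by rintro rfl; simp at hn
  have hle : LinearMap.range (A : E2 →ₗ[ℝ] E3) ≤ (ℝ ∙ n)ᗮ := by
    rintro _ ⟨v, rfl⟩
    exact Submodule.mem_orthogonal_singleton_iff_inner_right.2 (hAn v)
  have h1 : Module.finrank ℝ (LinearMap.range (A : E2 →ₗ[ℝ] E3)) = 2 := by
    rw [LinearMap.finrank_range_of_inj hA]; simp
  have : Fact (Module.finrank ℝ E3 = 2 + 1) := ⟨by simp⟩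
  have h2 : Module.finrank ℝ ((ℝ ∙ n)ᗮ : Submodule ℝ E3) = 2 :=
    Submodule.finrank_orthogonal_span_singleton hn0
  have h3 := Submodule.eq_of_le_of_finrank_eq hle (h1.trans h2.symm)
  have h4 : q ∈ (ℝ ∙ n)ᗮ := Submodule.mem_orthogonal_singleton_iff_inner_right.2 hq
  rw [← h3] at h4
  exact h4

end PseudoInverse

/-! ### Derivatives of fields in charts -/

section Charts

variable {M : Type*} [TopologicalSpace M] [ChartedSpace (EuclideanHalfSpace 2) M]
variable {F : Type*} [NormedAddCommGroup F] [NormedSpace ℝ F]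

/-- The differential of a field in the coordinates of the chart around `c`. -/
def chartDeriv (c : M) (R : M → F) (y : E2) : E2 →L[ℝ] F :=
  fderivWithin ℝ (R ∘ (extChartAt I2 c).symm) (range I2) y

/-- The derivative at `p` of the coordinate change from the preferred chart at `p` to the chart
around `c`. -/
def chartJac (c p : M) : E2 →L[ℝ] E2 := mfderiv I2 𝓘(ℝ, E2) (extChartAt I2 c) p

theorem range_I2 : range I2 = {y : E2 | 0 ≤ y 0} :=
  range_modelWithCornersEuclideanHalfSpace 2

theorem measurableSet_target (c : M) : MeasurableSet (extChartAt I2 c).target := by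
  rw [extChartAt_target]
  exact (((chartAt _ c).open_target).preimage I2.continuous_symm).measurableSet.inter
    I2.isClosed_range.measurableSet

theorem chartDeriv_eq_target {c : M} (R : M → F) {y : E2} (hy : y ∈ (extChartAt I2 c).target) :
    chartDeriv c R y = fderivWithin ℝ (R ∘ (extChartAt I2 c).symm) (extChartAt I2 c).target y :=
  (fderivWithin_congr_set (extChartAt_target_eventuallyEq_of_mem hy)).symm

variable [IsManifold I2 ∞ M]

theorem injective_chartJac {c p : M} (hp : p ∈ (extChartAt I2 c).source) :
    Injective (chartJac c p) :=
  (isInvertible_mfderiv_extChartAt hp).injective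

theorem mdifferentiableWithinAt_chart {c p : M} (hp : p ∈ (extChartAt I2 c).source) {R : M → F}
    (hR : MDifferentiableAt I2 𝓘(ℝ, F) R p) :
    DifferentiableWithinAt ℝ (R ∘ (extChartAt I2 c).symm) (range I2) (extChartAt I2 c p) := by
  have hy := (extChartAt I2 c).map_source hp
  have hs := (mdifferentiableWithinAt_extChartAt_symm (I := I2) hy)
  have hR' : MDifferentiableAt I2 𝓘(ℝ, F) R ((extChartAt I2 c).symm (extChartAt I2 c p)) := by
    rwa [(extChartAt I2 c).left_inv hp]
  exact mdifferentiableWithinAt_iff_differentiableWithinAt.1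
    (hR'.comp_mdifferentiableWithinAt _ hs)

/-- The chain rule for the change from the preferred chart at `p` to the chart around `c`. -/
theorem differential_eq {c p : M} (hp : p ∈ (extChartAt I2 c).source) {R : M → F}
    (hR : MDifferentiableAt I2 𝓘(ℝ, F) R p) :
    differential R p = (chartDeriv c R (extChartAt I2 c p)).comp (chartJac c p) := by
  have hd := mdifferentiableWithinAt_chart hp hR
  have h1 : HasMFDerivWithinAt 𝓘(ℝ, E2) 𝓘(ℝ, F) (R ∘ (extChartAt I2 c).symm) (range I2)
      (extChartAt I2 c p) (show E2 →L[ℝ] F from chartDeriv c R (extChartAt I2 c p)) :=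
    hasMFDerivWithinAt_iff_hasFDerivWithinAt.2 hd.hasFDerivWithinAt
  have h2 : HasMFDerivAt I2 𝓘(ℝ, E2) (extChartAt I2 c) p (chartJac c p) :=
    (mdifferentiableAt_extChartAt ((extChartAt_source (I := I2) c) ▸ hp)).hasMFDerivAt
  have h3 := HasMFDerivWithinAt.comp p h1 (hasMFDerivWithinAt_univ.2 h2)
    (fun q _ => by simp [extChartAt])
  rw [hasMFDerivWithinAt_univ] at h3
  have h4 : (R ∘ (extChartAt I2 c).symm) ∘ (extChartAt I2 c) =ᶠ[𝓝 p] R := by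
    filter_upwards [extChartAt_source_mem_nhds' (I := I2) hp] with q hq
    simp only [comp_apply, (extChartAt I2 c).left_inv hq]
  exact (h3.congr_of_eventuallyEq h4.symm).mfderiv

theorem injective_chartDeriv {X : M → E3} (hX : IsSmoothImmersion X) {c p : M}
    (hp : p ∈ (extChartAt I2 c).source) : Injective (chartDeriv c X (extChartAt I2 c p)) := by
  have h := hX.2 p
  rw [differential_eq hp (hX.1.mdifferentiable (by simp) p)] at h
  intro u v huv
  obtain ⟨u', rfl⟩ := (LinearMap.injective_iff_surjective
    (f := (chartJac c p : E2 →ₗ[ℝ] E2))).1 (injective_chartJac hp) u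
  obtain ⟨v', rfl⟩ := (LinearMap.injective_iff_surjective
    (f := (chartJac c p : E2 →ₗ[ℝ] E2))).1 (injective_chartJac hp) v
  exact congrArg _ (h huv)

theorem injective_chartDeriv' {X : M → E3} (hX : IsSmoothImmersion X) {c : M} {y : E2}
    (hy : y ∈ (extChartAt I2 c).target) : Injective (chartDeriv c X y) := by
  have := injective_chartDeriv hX ((extChartAt I2 c).map_target hy)
  rwa [(extChartAt I2 c).right_inv hy] at this

/-- The surface derivative can be computed in every chart around the point. -/
theorem surfaceDeriv_eq {X : M → E3} (hX : IsSmoothImmersion X) {c p : M}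
    (hp : p ∈ (extChartAt I2 c).source) {R : M → F} (hR : MDifferentiableAt I2 𝓘(ℝ, F) R p) :
    surfaceDeriv X R p = (chartDeriv c R (extChartAt I2 c p)).comp
      (pinv (chartDeriv c X (extChartAt I2 c p))) := by
  change (differential R p).comp (pinv (differential X p)) = _
  rw [differential_eq hp hR, differential_eq hp (hX.1.mdifferentiable (by simp) p)]
  exact comp_pinv_comp (injective_chartDeriv hX hp) (injective_chartJac hp) _

theorem contDiffOn_chart {n : ℕ∞} {R : M → F} (hR : ContMDiff I2 𝓘(ℝ, F) n R) (c : M) :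
    ContDiffOn ℝ n (R ∘ (extChartAt I2 c).symm) (extChartAt I2 c).target := by
  have : IsManifold I2 n M := IsManifold.of_le (n := ∞) (by exact_mod_cast le_top)
  exact contMDiffOn_iff_contDiffOn.1 (hR.comp_contMDiffOn (contMDiffOn_extChartAt_symm c))

theorem contMDiff_of_chart {n : ℕ∞} {R : M → F}
    (h : ∀ c, ContDiffOn ℝ n (R ∘ (extChartAt I2 c).symm) (extChartAt I2 c).target) :
    ContMDiff I2 𝓘(ℝ, F) n R := by
  have : IsManifold I2 n M := IsManifold.of_le (n := ∞) (by exact_mod_cast le_top)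
  intro p
  have h1 := (contMDiffOn_iff_contDiffOn.2 (h p)).comp (contMDiffOn_extChartAt (I := I2))
    (fun q hq => (extChartAt I2 p).map_source ((extChartAt_source (I := I2) p).symm ▸ hq))
  refine ((h1 p (mem_chart_source _ p)).contMDiffAt
    ((chartAt _ p).open_source.mem_nhds (mem_chart_source _ p))).congr_of_eventuallyEq ?_
  filter_upwards [extChartAt_source_mem_nhds (I := I2) p] with q hq
  simp only [comp_apply, (extChartAt I2 p).left_inv hq]

theorem contDiffOn_chartDeriv {m n : ℕ∞} (hmn : m + 1 ≤ n) {R : M → F}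
    (hR : ContMDiff I2 𝓘(ℝ, F) n R) (c : M) :
    ContDiffOn ℝ m (chartDeriv c R) (extChartAt I2 c).target :=
  ((contDiffOn_chart hR c).fderivWithin (uniqueDiffOn_extChartAt_target c)
    (by exact_mod_cast hmn)).congr fun _ hy => chartDeriv_eq_target R hy

theorem contDiffOn_pinv_chartDeriv {m : ℕ∞} {X : M → E3} (hX : IsSmoothImmersion X) (c : M) :
    ContDiffOn ℝ m (fun y => pinv (chartDeriv c X y)) (extChartAt I2 c).target := by
  intro y hy
  exact (contDiffAt_pinv (injective_chartDeriv' hX hy)).comp_contDiffWithinAt y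
    ((contDiffOn_chartDeriv (m := m) (n := ⊤) le_top hX.1 c) y hy)

theorem contMDiff_surfaceDeriv {m n : ℕ∞} (hmn : m + 1 ≤ n) {X : M → E3}
    (hX : IsSmoothImmersion X) {R : M → F} (hR : ContMDiff I2 𝓘(ℝ, F) n R) :
    ContMDiff I2 𝓘(ℝ, E3 →L[ℝ] F) m (surfaceDeriv X R) := by
  have hn : (n : ℕ∞ω) ≠ 0 := by
    rintro h
    have h' : n = 0 := by exact_mod_cast h
    subst h'
    simp at hmn
  refine contMDiff_of_chart fun c => ((contDiffOn_chartDeriv hmn hR c).clm_comp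
    (contDiffOn_pinv_chartDeriv hX c)).congr fun y hy => ?_
  have h := surfaceDeriv_eq hX ((extChartAt I2 c).map_target hy) (hR.mdifferentiable hn _)
  rw [(extChartAt I2 c).right_inv hy] at h
  exact h

theorem contMDiff_surfaceGrad {m n : ℕ∞} (hmn : m + 1 ≤ n) {X : M → E3}
    (hX : IsSmoothImmersion X) {f : M → ℝ} (hf : ContMDiff I2 𝓘(ℝ, ℝ) n f) :
    ContMDiff I2 𝓘(ℝ, E3) m (surfaceGrad X f) :=
  ((InnerProductSpace.toDual ℝ E3).symm.toContinuousLinearEquiv.toContinuousLinearMap :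
    (E3 →L[ℝ] ℝ) →L[ℝ] E3).contDiff.contMDiff.comp (contMDiff_surfaceDeriv hmn hX hf)

theorem contMDiff_surfaceDiv {m n : ℕ∞} (hmn : m + 1 ≤ n) {X : M → E3}
    (hX : IsSmoothImmersion X) {W : M → E3} (hW : ContMDiff I2 𝓘(ℝ, E3) n W) :
    ContMDiff I2 𝓘(ℝ, ℝ) m (surfaceDiv X W) :=
  (LinearMap.toContinuousLinearMap ((LinearMap.trace ℝ E3).comp
    (ContinuousLinearMap.coeLM ℝ : (E3 →L[ℝ] E3) →ₗ[ℝ] (E3 →ₗ[ℝ] E3)))).contDiff.contMDiff.comp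
      (contMDiff_surfaceDeriv hmn hX hW)

end Charts

/-! ### Smooth families of fields -/

section Families

variable {M : Type*} [TopologicalSpace M] [ChartedSpace (EuclideanHalfSpace 2) M]
variable {P : Type*} [NormedAddCommGroup P] [NormedSpace ℝ P]
variable {F : Type*} [NormedAddCommGroup F] [NormedSpace ℝ F]

theorem IsSmoothFamily.mono {O O' : Set P} {R : P → M → F} (hR : IsSmoothFamily O R)
    (h : O' ⊆ O) : IsSmoothFamily O' R :=
  ContMDiffOn.mono hR (prod_mono h Subset.rfl)

theorem IsSmoothFamily.contMDiff {O : Set P} {R : P → M → F} (hR : IsSmoothFamily O R) {s : P}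
    (hs : s ∈ O) : ContMDiff I2 𝓘(ℝ, F) ∞ (R s) := by
  rw [← contMDiffOn_univ]
  exact ContMDiffOn.comp hR (f := fun p : M => (s, p)) (s := univ)
    (contMDiff_const.prodMk contMDiff_id).contMDiffOn (fun p _ => ⟨hs, mem_univ _⟩)

/-- Reparameterizing the parameter space of a smooth family. -/
theorem IsSmoothFamily.comp {Q : Type*} [NormedAddCommGroup Q] [NormedSpace ℝ Q]
    {O : Set P} {R : P → M → F} (hR : IsSmoothFamily O R) {O' : Set Q} {g : Q → P}
    (hg : ContDiff ℝ ∞ g) (hO : MapsTo g O' O) : IsSmoothFamily O' (fun s => R (g s)) :=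
  ContMDiffOn.comp hR (f := fun q : Q × M => (g q.1, q.2))
    ((hg.contMDiff.comp contMDiff_fst).prodMk contMDiff_snd).contMDiffOn
    (fun _ hq => ⟨hO hq.1, mem_univ _⟩)

theorem isSmoothFamily_const {O : Set P} {f : M → F} (hf : ContMDiff I2 𝓘(ℝ, F) ∞ f) :
    IsSmoothFamily O (fun _ : P => f) :=
  (hf.comp contMDiff_snd).contMDiffOn

theorem IsSmoothFamily.add {O : Set P} {R S : P → M → F} (hR : IsSmoothFamily O R)
    (hS : IsSmoothFamily O S) : IsSmoothFamily O (fun s p => R s p + S s p) :=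
  ContMDiffOn.add hR hS

theorem IsSmoothFamily.smul {O : Set P} {R : P → M → F} (hR : IsSmoothFamily O R) {a : P → ℝ}
    (ha : ContDiff ℝ ∞ a) : IsSmoothFamily O (fun s p => a s • R s p) :=
  ContMDiffOn.smul (ha.contMDiff.comp contMDiff_fst).contMDiffOn hR

theorem contMDiffOn_prod_self_iff {G : P × E2 → F} {S : Set (P × E2)} :
    ContMDiffOn (𝓘(ℝ, P).prod 𝓘(ℝ, E2)) 𝓘(ℝ, F) ∞ G S ↔ ContDiffOn ℝ ∞ G S := by
  rw [← contMDiffOn_iff_contDiffOn, modelWithCornersSelf_prod, ← chartedSpaceSelf_prod]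

theorem uniqueDiffOn_prod_target {O : Set P} (hO : IsOpen O) (c : M) :
    UniqueDiffOn ℝ (O ×ˢ (extChartAt I2 c).target) :=
  hO.uniqueDiffOn.prod (uniqueDiffOn_extChartAt_target c)

variable [IsManifold I2 ∞ M]

theorem IsSmoothFamily.contDiffOn_chart {O : Set P} {R : P → M → F} (hR : IsSmoothFamily O R)
    (c : M) : ContDiffOn ℝ ∞ (fun z : P × E2 => R z.1 ((extChartAt I2 c).symm z.2))
      (O ×ˢ (extChartAt I2 c).target) := by
  rw [← contMDiffOn_prod_self_iff]
  refine ContMDiffOn.comp hR (f := fun z : P × E2 => (z.1, (extChartAt I2 c).symm z.2))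
    (contMDiffOn_fst.prodMk ?_) (fun z hz => ⟨hz.1, mem_univ _⟩)
  exact (contMDiffOn_extChartAt_symm c).comp contMDiffOn_snd fun z hz => hz.2

theorem isSmoothFamily_of_chart {O : Set P} {R : P → M → F}
    (h : ∀ c : M, ContDiffOn ℝ ∞ (fun z : P × E2 => R z.1 ((extChartAt I2 c).symm z.2))
      (O ×ˢ (extChartAt I2 c).target)) : IsSmoothFamily O R := by
  rintro ⟨s, p⟩ ⟨hs, -⟩
  have h0 := h p
  rw [← contMDiffOn_prod_self_iff] at h0
  have h1 : ContMDiffOn (𝓘(ℝ, P).prod I2) 𝓘(ℝ, F) ∞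
      (fun q : P × M => R q.1 ((extChartAt I2 p).symm (extChartAt I2 p q.2)))
      (O ×ˢ (chartAt (EuclideanHalfSpace 2) p).source) :=
    h0.comp (f := fun q : P × M => (q.1, extChartAt I2 p q.2))
      (contMDiffOn_fst.prodMk ((contMDiffOn_extChartAt (I := I2)).comp contMDiffOn_snd
        fun z hz => hz.2))
      (fun q hq => ⟨hq.1, (extChartAt I2 p).map_source
        ((extChartAt_source (I := I2) p).symm ▸ hq.2)⟩)
  have h2 := h1 (s, p) ⟨hs, mem_chart_source _ p⟩
  have hev : ∀ q ∈ O ×ˢ (chartAt (EuclideanHalfSpace 2) p).source,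
      R q.1 q.2 = R q.1 ((extChartAt I2 p).symm (extChartAt I2 p q.2)) := fun q hq => by
    rw [(extChartAt I2 p).left_inv ((extChartAt_source (I := I2) p).symm ▸ hq.2)]
  refine (h2.congr hev (hev _ ⟨hs, mem_chart_source _ p⟩)).mono_of_mem_nhdsWithin ?_
  have hopen : IsOpen ((univ : Set P) ×ˢ (chartAt (EuclideanHalfSpace 2) p).source) :=
    isOpen_univ.prod (chartAt _ p).open_source
  refine mem_nhdsWithin.2 ⟨_, hopen, ⟨mem_univ _, mem_chart_source _ p⟩, ?_⟩
  rintro q ⟨⟨-, hq⟩, hq', -⟩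
  exact ⟨hq', hq⟩

/-- The time derivative of the coordinate representation of a smooth family. -/
theorem IsSmoothFamily.hasDerivAt_chart {O : Set ℝ} (hO : IsOpen O) {R : ℝ → M → F}
    (hR : IsSmoothFamily O R) {c : M} {s : ℝ} (hs : s ∈ O) {y : E2}
    (hy : y ∈ (extChartAt I2 c).target) :
    HasDerivAt (fun a => R a ((extChartAt I2 c).symm y))
      (fderivWithin ℝ (fun z : ℝ × E2 => R z.1 ((extChartAt I2 c).symm z.2))
        (O ×ˢ (extChartAt I2 c).target) (s, y) (1, 0)) s := by
  have h := ((hR.contDiffOn_chart c).differentiableOn (by simp) (s, y) ⟨hs, hy⟩).hasFDerivWithinAt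
  have h2 : HasFDerivWithinAt (fun a : ℝ => (a, y)) (ContinuousLinearMap.inl ℝ ℝ E2) O s :=
    ((hasFDerivAt_id s).prodMk (hasFDerivAt_const y s)).hasFDerivWithinAt
  have h3 := h.comp s h2 (fun a ha => mk_mem_prod ha hy)
  have h4 := (h3.hasFDerivAt (hO.mem_nhds hs)).hasDerivAt
  simpa only [ContinuousLinearMap.comp_apply, ContinuousLinearMap.inl_apply] using! h4

theorem IsSmoothFamily.hasDerivAt {O : Set ℝ} (hO : IsOpen O) {R : ℝ → M → F}
    (hR : IsSmoothFamily O R) {s : ℝ} (hs : s ∈ O) (p : M) :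
    HasDerivAt (fun a => R a p) (deriv (fun a => R a p) s) s := by
  have h := hR.hasDerivAt_chart hO hs (mem_extChartAt_target (I := I2) p)
  simp only [extChartAt_to_inv] at h
  exact h.differentiableAt.hasDerivAt

theorem IsSmoothFamily.deriv {O : Set ℝ} (hO : IsOpen O) {R : ℝ → M → F}
    (hR : IsSmoothFamily O R) : IsSmoothFamily O (fun s p => deriv (fun a => R a p) s) := by
  refine isSmoothFamily_of_chart fun c => ?_
  have h := ((hR.contDiffOn_chart c).fderivWithin (uniqueDiffOn_prod_target hO c)
    (m := ∞) (by simp)).clm_apply (contDiffOn_const (c := ((1, 0) : ℝ × E2)))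
  exact h.congr fun z hz => (hR.hasDerivAt_chart hO hz.1 hz.2).deriv

/-- The spatial derivative of the coordinate representation of a smooth family is a partial
derivative in the product of the parameter space and the chart. -/
theorem IsSmoothFamily.chartDeriv_eq {O : Set P} {R : P → M → F}
    (hR : IsSmoothFamily O R) {c : M} {s : P} (hs : s ∈ O) {y : E2}
    (hy : y ∈ (extChartAt I2 c).target) :
    chartDeriv c (R s) y =
      (fderivWithin ℝ (fun z : P × E2 => R z.1 ((extChartAt I2 c).symm z.2))
        (O ×ˢ (extChartAt I2 c).target) (s, y)).comp (ContinuousLinearMap.inr ℝ P E2) := by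
  have h := ((hR.contDiffOn_chart c).differentiableOn (by simp) (s, y) ⟨hs, hy⟩).hasFDerivWithinAt
  have h2 : HasFDerivWithinAt (fun a : E2 => (s, a)) (ContinuousLinearMap.inr ℝ P E2)
      (extChartAt I2 c).target y :=
    ((hasFDerivAt_const s y).prodMk (hasFDerivAt_id y)).hasFDerivWithinAt
  rw [chartDeriv_eq_target _ hy]
  exact (h.comp y h2 (fun a ha => mk_mem_prod hs ha)).fderivWithin
    (uniqueDiffOn_extChartAt_target c y hy)

theorem IsSmoothFamily.contDiffOn_chartDeriv {O : Set P} (hO : IsOpen O) {R : P → M → F}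
    (hR : IsSmoothFamily O R) (c : M) :
    ContDiffOn ℝ ∞ (fun z : P × E2 => chartDeriv c (R z.1) z.2)
      (O ×ˢ (extChartAt I2 c).target) :=
  (((hR.contDiffOn_chart c).fderivWithin (uniqueDiffOn_prod_target hO c)
    (m := ∞) (by simp)).clm_comp contDiffOn_const).congr fun _ hz => hR.chartDeriv_eq hz.1 hz.2

/-- Time and space derivatives of a smooth family commute. -/
theorem IsSmoothFamily.hasDerivAt_chartDeriv {O : Set ℝ} (hO : IsOpen O) {R : ℝ → M → F}
    (hR : IsSmoothFamily O R) {c : M} {s : ℝ} (hs : s ∈ O) {y : E2}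
    (hy : y ∈ (extChartAt I2 c).target) :
    HasDerivAt (fun a => chartDeriv c (R a) y)
      (chartDeriv c (fun p => _root_.deriv (fun a => R a p) s) y) s := by
  set S := O ×ˢ (extChartAt I2 c).target with hS
  set G := fun z : ℝ × E2 => R z.1 ((extChartAt I2 c).symm z.2) with hG
  have hu := uniqueDiffOn_prod_target hO c
  have hG2 : ContDiffOn ℝ ∞ (fderivWithin ℝ G S) S :=
    (hR.contDiffOn_chart c).fderivWithin hu (m := ∞) (by simp)
  have hz : ((s, y) : ℝ × E2) ∈ S := ⟨hs, hy⟩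
  have hd := (hG2.differentiableOn (by simp) (s, y) hz).hasFDerivWithinAt
  -- the time derivative of the spatial derivative
  have h2 : HasFDerivWithinAt (fun a : ℝ => (a, y)) (ContinuousLinearMap.inl ℝ ℝ E2) O s :=
    ((hasFDerivAt_id s).prodMk (hasFDerivAt_const y s)).hasFDerivWithinAt
  have h3 :=
    ((hd.comp s h2 (fun a ha => mk_mem_prod ha hy)).hasFDerivAt (hO.mem_nhds hs)).hasDerivAt
  have h4 : HasDerivAt (fun a => (fderivWithin ℝ G S (a, y)).comp
      (ContinuousLinearMap.inr ℝ ℝ E2))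
      ((fderivWithin ℝ (fderivWithin ℝ G S) S (s, y) (1, 0)).comp
        (ContinuousLinearMap.inr ℝ ℝ E2)) s := by
    have := h3.clm_comp (hasDerivAt_const s (ContinuousLinearMap.inr ℝ ℝ E2))
    simpa using this
  have h5 : (fun a => chartDeriv c (R a) y) =ᶠ[𝓝 s] fun a => (fderivWithin ℝ G S (a, y)).comp
      (ContinuousLinearMap.inr ℝ ℝ E2) := by
    filter_upwards [hO.mem_nhds hs] with a ha using hR.chartDeriv_eq ha hy
  refine (h4.congr_of_eventuallyEq h5).congr_deriv ?_
  -- the spatial derivative of the time derivative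
  have h6 : HasFDerivWithinAt (fun a : E2 => (s, a)) (ContinuousLinearMap.inr ℝ ℝ E2)
      (extChartAt I2 c).target y :=
    ((hasFDerivAt_const s y).prodMk (hasFDerivAt_id y)).hasFDerivWithinAt
  have h7 := (hd.comp y h6 (fun a ha => mk_mem_prod hs ha)).clm_apply
    (hasFDerivWithinAt_const ((1, 0) : ℝ × E2) y _)
  have h8 := h7.congr (f₁ := (fun p => _root_.deriv (fun a => R a p) s) ∘ (extChartAt I2 c).symm)
    (fun x hx => (hR.hasDerivAt_chart hO hs hx).deriv) (hR.hasDerivAt_chart hO hs hy).deriv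
  rw [chartDeriv_eq_target _ hy, h8.fderivWithin (uniqueDiffOn_extChartAt_target c y hy)]
  ext1 v
  have hcl : (s, y) ∈ closure (interior S) := by
    rw [hS, interior_prod_eq, closure_prod_eq]
    refine ⟨subset_closure (hO.interior_eq.symm ▸ hs), ?_⟩
    exact extChartAt_target_subset_closure_interior (I := I2) hy
  have hsymm := ((hR.contDiffOn_chart c) (s, y) hz).isSymmSndFDerivWithinAt
    (by simp only [minSmoothness_of_isRCLikeNormedField]; exact ENat.LEInfty.out) hu hcl hz
  simpa [-extChartAt] using! hsymm (1, 0) (0, v)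

end Families

/-! ### The area element of a linear map -/

section AreaElement

open ContinuousLinearMap (adjoint)

/-- The factor `√ det (Aᵀ A)` by which a linear map of the plane into space scales areas. -/
def areaFactor (A : E2 →L[ℝ] E3) : ℝ := Real.sqrt (gram A).det

/-- The `i`-th coordinate vector of the plane. -/
def e2 (i : Fin 2) : E2 := EuclideanSpace.single i 1

theorem eq_sum_e2 (v : E2) : v = v 0 • e2 0 + v 1 • e2 1 := by
  ext i; fin_cases i <;> simp [e2]

theorem clm_det_eq (L : E2 →L[ℝ] E2) :
    L.det = L (e2 0) 0 * L (e2 1) 1 - L (e2 1) 0 * L (e2 0) 1 := by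
  change LinearMap.det (L : E2 →ₗ[ℝ] E2) = _
  rw [← LinearMap.det_toMatrix (EuclideanSpace.basisFun (Fin 2) ℝ).toBasis,
    Matrix.det_fin_two]
  simp [LinearMap.toMatrix_apply, e2]

theorem trace_eq (L : E2 →L[ℝ] E2) :
    LinearMap.trace ℝ E2 (L : E2 →ₗ[ℝ] E2) = L (e2 0) 0 + L (e2 1) 1 := by
  rw [LinearMap.trace_eq_matrix_trace ℝ (EuclideanSpace.basisFun (Fin 2) ℝ).toBasis,
    Matrix.trace_fin_two]
  simp [LinearMap.toMatrix_apply, e2]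

theorem apply_eq_inner_e2 (v : E2) (i : Fin 2) : v i = inner ℝ (e2 i) v := by
  simp [e2, EuclideanSpace.inner_single_left]

theorem det_gram (A : E2 →L[ℝ] E3) :
    (gram A).det = inner ℝ (A (e2 0)) (A (e2 0)) * inner ℝ (A (e2 1)) (A (e2 1))
      - inner ℝ (A (e2 0)) (A (e2 1)) * inner ℝ (A (e2 0)) (A (e2 1)) := by
  rw [clm_det_eq]
  simp only [apply_eq_inner_e2, inner_gram]
  rw [real_inner_comm (A (e2 0)) (A (e2 1))]

theorem det_gram_pos {A : E2 →L[ℝ] E3} (hA : Injective A) : 0 < (gram A).det := by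
  have h0 : 0 ≤ (gram A).det := by
    rw [det_gram, sub_nonneg]
    exact real_inner_mul_inner_self_le _ _
  refine lt_of_le_of_ne h0 (Ne.symm ?_)
  have := (isUnit_gram hA).map (ContinuousLinearMap.toLinearMapRingHom : (E2 →L[ℝ] E2) →+* _)
  exact (LinearMap.isUnit_det _ this).ne_zero

theorem areaFactor_pos {A : E2 →L[ℝ] E3} (hA : Injective A) : 0 < areaFactor A :=
  Real.sqrt_pos.2 (det_gram_pos hA)

theorem areaFactor_nonneg (A : E2 →L[ℝ] E3) : 0 ≤ areaFactor A := Real.sqrt_nonneg _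

theorem areaFactor_comp (A : E2 →L[ℝ] E3) (L : E2 →L[ℝ] E2) :
    areaFactor (A.comp L) = areaFactor A * |L.det| := by
  have h : (gram (A.comp L)).det = (gram A).det * L.det ^ 2 := by
    simp only [det_gram, ContinuousLinearMap.comp_apply, clm_det_eq L]
    rw [eq_sum_e2 (L (e2 0)), eq_sum_e2 (L (e2 1))]
    simp only [map_add, map_smul, inner_add_left, inner_add_right, inner_smul_left,
      inner_smul_right, real_inner_comm (A (e2 0)) (A (e2 1))]
    simp [e2]
    ring
  rw [areaFactor, h, Real.sqrt_mul' _ (sq_nonneg _), Real.sqrt_sq_eq_abs]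
  rfl

/-- The linear functional `A' ↦ tr ((Aᵀ A)⁻¹ Aᵀ A')`, the logarithmic derivative of the area
element. -/
def logAreaDeriv (A : E2 →L[ℝ] E3) : (E2 →L[ℝ] E3) →L[ℝ] ℝ :=
  (LinearMap.toContinuousLinearMap ((LinearMap.trace ℝ E2).comp
    (ContinuousLinearMap.coeLM ℝ : (E2 →L[ℝ] E2) →ₗ[ℝ] (E2 →ₗ[ℝ] E2)))).comp
      (ContinuousLinearMap.compL ℝ E2 E3 E2 (pinv A))

theorem logAreaDeriv_apply (A B : E2 →L[ℝ] E3) :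
    logAreaDeriv A B = LinearMap.trace ℝ E2 ((pinv A).comp B : E2 →L[ℝ] E2) := rfl

/-- The derivative of the area element, which becomes the surface divergence. -/
theorem hasFDerivAt_areaFactor {A : E2 →L[ℝ] E3} (hA : Injective A) :
    HasFDerivAt areaFactor (areaFactor A • logAreaDeriv A) A := by
  have hev : ∀ i, HasFDerivAt (fun B : E2 →L[ℝ] E3 => B (e2 i))
      (ContinuousLinearMap.apply ℝ E3 (e2 i)) A := fun i =>
    (ContinuousLinearMap.apply ℝ E3 (e2 i)).hasFDerivAt
  have hin : ∀ i j, HasFDerivAt (fun B : E2 →L[ℝ] E3 => (inner ℝ (B (e2 i)) (B (e2 j)) : ℝ)) _ A :=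
    fun i j => (hev i).inner ℝ (hev j)
  have hdet := ((hin 0 0).mul (hin 1 1)).sub ((hin 0 1).mul (hin 0 1))
  have hdet' : HasFDerivAt (fun B : E2 →L[ℝ] E3 => (gram B).det) _ A :=
    hdet.congr_of_eventuallyEq (Filter.Eventually.of_forall fun B => by
      simp only [det_gram]; rfl)
  refine (hdet'.sqrt (det_gram_pos hA).ne').congr_fderiv ?_
  ext1 B
  -- With `K = (Aᵀ A)⁻¹ Aᵀ B` one has `⟨A u, B v⟩ = ⟨A u, A (K v)⟩`, and the claim is Jacobi's
  -- formula for the determinant of a two by two matrix.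
  have hK : ∀ i j, inner ℝ (A (e2 i)) (B (e2 j)) =
      inner ℝ (A (e2 i)) (A (pinv A (B (e2 j)))) := fun i j =>
    (inner_apply_pinv hA (e2 i) (B (e2 j))).symm
  have hpos := areaFactor_pos hA
  have hsq : areaFactor A * areaFactor A = (gram A).det :=
    Real.mul_self_sqrt (det_gram_pos hA).le
  simp only [smul_eq_mul, smul_apply, sub_apply,
    add_apply, ContinuousLinearMap.comp_apply, ContinuousLinearMap.prod_apply,
    fderivInnerCLM_apply, ContinuousLinearMap.apply_apply, logAreaDeriv_apply, trace_eq]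
  change 1 / (2 * areaFactor A) * _ = _
  rw [real_inner_comm (A (e2 0)) (B (e2 0)), real_inner_comm (A (e2 1)) (B (e2 1)),
    real_inner_comm (A (e2 1)) (B (e2 0))]
  simp only [hK]
  generalize pinv A (B (e2 0)) = k0
  generalize pinv A (B (e2 1)) = k1
  rw [eq_sum_e2 k0, eq_sum_e2 k1]
  simp only [map_add, map_smul, inner_add_right, inner_smul_right,
      real_inner_comm (A (e2 0)) (A (e2 1))]
  rw [det_gram] at hsq
  simp [e2] at hsq ⊢
  field_simp
  linear_combination (-2 * (k0 0 + k1 1)) * hsq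

theorem contDiffAt_areaFactor {A : E2 →L[ℝ] E3} (hA : Injective A) {n : ℕ∞} :
    ContDiffAt ℝ n areaFactor A := by
  have hev : ∀ i, ContDiff ℝ n (fun B : E2 →L[ℝ] E3 => B (e2 i)) := fun i =>
    (ContinuousLinearMap.apply ℝ E3 (e2 i)).contDiff
  have hin : ∀ i j, ContDiff ℝ n (fun B : E2 →L[ℝ] E3 => (inner ℝ (B (e2 i)) (B (e2 j)) : ℝ)) :=
    fun i j => (hev i).inner ℝ (hev j)
  have hdet : ContDiff ℝ n (fun B : E2 →L[ℝ] E3 => (gram B).det) := by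
    simp only [det_gram]
    exact ((hin 0 0).mul (hin 1 1)).sub ((hin 0 1).mul (hin 0 1))
  exact hdet.contDiffAt.sqrt (det_gram_pos hA).ne'

end AreaElement

/-! ### The area measure in charts -/

section AreaMeasure

open scoped ENNReal

variable {M : Type*} [TopologicalSpace M] [ChartedSpace (EuclideanHalfSpace 2) M]

theorem areaDensity_eq (X : M → E3) (c : M) (y : E2) :
    areaDensity X c y = areaFactor (chartDeriv c X y) := rfl

theorem image_chart_eq {c : M} {B : Set M} (hB : B ⊆ (extChartAt I2 c).source) :
    extChartAt I2 c '' B = (extChartAt I2 c).target ∩ (extChartAt I2 c).symm ⁻¹' B :=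
  (extChartAt I2 c).image_eq_target_inter_inv_preimage hB

theorem measurableSet_image_chart [MeasurableSpace M] [BorelSpace M] {c : M} {B : Set M}
    (hB : MeasurableSet B) (hBc : B ⊆ (extChartAt I2 c).source) :
    MeasurableSet (extChartAt I2 c '' B) := by
  rw [image_chart_eq hBc, ← Subtype.image_preimage_coe]
  refine (measurableSet_target c).subtype_image ?_
  exact (continuousOn_iff_continuous_domRestrict.1
    (continuousOn_extChartAt_symm (I := I2) c)).measurable hB

variable [IsManifold I2 ∞ M]

theorem mdifferentiableAt_chart {c p : M} (hp : p ∈ (extChartAt I2 c).source) :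
    MDifferentiableAt I2 𝓘(ℝ, E2) (extChartAt I2 c) p :=
  mdifferentiableAt_extChartAt ((extChartAt_source (I := I2) c) ▸ hp)

/-- The transformation of the coordinate differential under a change of charts. -/
theorem chartDeriv_change {F : Type*} [NormedAddCommGroup F] [NormedSpace ℝ F] {c d p : M}
    (hc : p ∈ (extChartAt I2 c).source) (hd : p ∈ (extChartAt I2 d).source)
    {R : M → F} (hR : MDifferentiableAt I2 𝓘(ℝ, F) R p) :
    chartDeriv c R (extChartAt I2 c p) = (chartDeriv d R (extChartAt I2 d p)).comp
      (chartDeriv c (extChartAt I2 d) (extChartAt I2 c p)) := by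
  have h1 := (differential_eq hc hR).symm.trans (differential_eq hd hR)
  have h2 : chartJac d p = (chartDeriv c (extChartAt I2 d) (extChartAt I2 c p)).comp
    (chartJac c p) := differential_eq hc (mdifferentiableAt_chart hd)
  rw [h2, ← ContinuousLinearMap.comp_assoc] at h1
  ext1 v
  obtain ⟨u, rfl⟩ := (LinearMap.injective_iff_surjective
    (f := (chartJac c p : E2 →ₗ[ℝ] E2))).1 (injective_chartJac hc) v
  exact congrArg (fun T : E2 →L[ℝ] F => T u) h1

theorem hasFDerivWithinAt_transition {c d p : M} (hc : p ∈ (extChartAt I2 c).source)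
    (hd : p ∈ (extChartAt I2 d).source) :
    HasFDerivWithinAt (extChartAt I2 d ∘ (extChartAt I2 c).symm)
      (chartDeriv c (extChartAt I2 d) (extChartAt I2 c p)) (range I2) (extChartAt I2 c p) :=
  (mdifferentiableWithinAt_chart hc (mdifferentiableAt_chart hd)).hasFDerivWithinAt

omit [IsManifold I2 ∞ M] in
theorem image_chart_subset_range {c : M} {B : Set M} (hB : B ⊆ (extChartAt I2 c).source) :
    extChartAt I2 c '' B ⊆ range I2 := by
  rintro _ ⟨p, hp, rfl⟩
  exact extChartAt_target_subset_range (I := I2) c ((extChartAt I2 c).map_source (hB hp))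

/-- The integral of `√ det g` over a piece of the surface does not depend on the chart. -/
theorem lintegral_areaDensity_change [MeasurableSpace M] [BorelSpace M] {X : M → E3}
    (hX : ContMDiff I2 𝓘(ℝ, E3) ∞ X) {c d : M} {B : Set M} (hB : MeasurableSet B)
    (hc : B ⊆ (extChartAt I2 c).source) (hd : B ⊆ (extChartAt I2 d).source) :
    ∫⁻ y in extChartAt I2 d '' B, ENNReal.ofReal (areaDensity X d y) =
      ∫⁻ y in extChartAt I2 c '' B, ENNReal.ofReal (areaDensity X c y) := by
  have himage : extChartAt I2 d '' B =
      (extChartAt I2 d ∘ (extChartAt I2 c).symm) '' (extChartAt I2 c '' B) := by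
    rw [← image_comp]
    exact image_congr fun p hp => by
      simp only [comp_apply, (extChartAt I2 c).left_inv (hc hp)]
  have hderiv : ∀ y ∈ extChartAt I2 c '' B,
      HasFDerivWithinAt (extChartAt I2 d ∘ (extChartAt I2 c).symm)
        (chartDeriv c (extChartAt I2 d) y) (extChartAt I2 c '' B) y := by
    rintro _ ⟨p, hp, rfl⟩
    exact (hasFDerivWithinAt_transition (hc hp) (hd hp)).mono (image_chart_subset_range hc)
  have hinj : InjOn (extChartAt I2 d ∘ (extChartAt I2 c).symm) (extChartAt I2 c '' B) := by
    rintro _ ⟨p, hp, rfl⟩ _ ⟨q, hq, rfl⟩ h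
    simp only [comp_apply, (extChartAt I2 c).left_inv (hc hp),
      (extChartAt I2 c).left_inv (hc hq)] at h
    rw [(extChartAt I2 d).injOn (hd hp) (hd hq) h]
  have hmeas := measurableSet_image_chart hB hc
  rw [himage, lintegral_image_eq_lintegral_abs_det_fderiv_mul volume hmeas hderiv hinj]
  refine setLIntegral_congr_fun hmeas ?_
  rintro _ ⟨p, hp, rfl⟩
  have h := chartDeriv_change (hc hp) (hd hp) (hX.mdifferentiable (by simp) p)
  simp only [areaDensity_eq, comp_apply, (extChartAt I2 c).left_inv (hc hp)]
  rw [h, areaFactor_comp, mul_comm, ENNReal.ofReal_mul (areaFactor_nonneg _)]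

variable [CompactSpace M] [MeasurableSpace M] [BorelSpace M]

omit [IsManifold I2 ∞ M] [MeasurableSpace M] [BorelSpace M] in
theorem chartCell_subset (i : Fin (chartCenters M).length) :
    chartCell i ⊆ (extChartAt I2 ((chartCenters M).get i)).source := sdiff_subset

omit [IsManifold I2 ∞ M] in
theorem measurableSet_chartCell (i : Fin (chartCenters M).length) :
    MeasurableSet (chartCell i : Set M) := by
  refine (isOpen_extChartAt_source _).measurableSet.diff ?_
  exact MeasurableSet.iUnion fun j => MeasurableSet.iUnion fun _ =>
    (isOpen_extChartAt_source _).measurableSet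

omit [IsManifold I2 ∞ M] [MeasurableSpace M] [BorelSpace M] in
theorem pairwise_disjoint_chartCell :
    Pairwise (Function.onFun Disjoint (chartCell : Fin (chartCenters M).length → Set M)) := by
  have key : ∀ i j : Fin (chartCenters M).length, i < j →
      Disjoint (chartCell i : Set M) (chartCell j) := fun i j hij => by
    refine Set.disjoint_left.2 fun p hi hj => hj.2 ?_
    exact mem_iUnion₂.2 ⟨i, hij, hi.1⟩
  intro i j hij
  rcases lt_or_gt_of_ne hij with h | h
  · exact key i j h
  · exact (key j i h).symm

omit [IsManifold I2 ∞ M] [MeasurableSpace M] [BorelSpace M] in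
theorem iUnion_chartCell :
    ⋃ i, (chartCell i : Set M) = univ := by
  refine eq_univ_of_forall fun p => ?_
  obtain ⟨c, hc, hp⟩ := (exists_chart_cover M).choose_spec p
  obtain ⟨k, hk⟩ := List.mem_iff_get.1 (show c ∈ chartCenters M from hc)
  have hne : {i : Fin (chartCenters M).length |
      p ∈ (extChartAt I2 ((chartCenters M).get i)).source}.Nonempty := ⟨k, by
    simpa only [mem_ofPred_eq, hk] using hp⟩
  obtain ⟨i, hi, hmin⟩ := WellFounded.has_min (wellFounded_lt (α := Fin _)) _ hne
  refine mem_iUnion.2 ⟨i, hi, fun hcon => ?_⟩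
  obtain ⟨j, hji, hj⟩ := mem_iUnion₂.1 hcon
  exact hmin j hj hji

/-- The area of a piece of the surface that lies in the domain of a chart. -/
theorem areaMeasure_apply {X : M → E3} (hX : ContMDiff I2 𝓘(ℝ, E3) ∞ X) (c : M) {B : Set M}
    (hB : MeasurableSet B) (hc : B ⊆ (extChartAt I2 c).source) :
    areaMeasure X B = ∫⁻ y in extChartAt I2 c '' B, ENNReal.ofReal (areaDensity X c y) := by
  have hunion : extChartAt I2 c '' B = ⋃ i, extChartAt I2 c '' (B ∩ chartCell i) := by
    rw [← image_iUnion, ← inter_iUnion, iUnion_chartCell, inter_univ]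
  rw [hunion, lintegral_iUnion]
  rotate_left
  · exact fun i => measurableSet_image_chart (hB.inter (measurableSet_chartCell i))
      (inter_subset_left.trans hc)
  · intro i j hij
    refine Set.disjoint_left.2 ?_
    rintro _ ⟨p, hp, rfl⟩ ⟨q, hq, hqp⟩
    rw [(extChartAt I2 c).injOn (hc hq.1) (hc hp.1) hqp] at hq
    exact Set.disjoint_left.1 (pairwise_disjoint_chartCell hij) hp.2 hq.2
  rw [tsum_fintype, areaMeasure, Measure.finsetSum_apply]
  refine Finset.sum_congr rfl fun i _ => ?_
  set e := extChartAt I2 ((chartCenters M).get i) with he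
  have hsub := chartCell_subset i
  have hmi := measurableSet_image_chart (measurableSet_chartCell i) hsub
  have hT : e '' chartCell i ⊆ e.target := by
    rintro _ ⟨p, hp, rfl⟩
    exact e.map_source (hsub hp)
  have hae : AEMeasurable e.symm ((volume.restrict (e '' chartCell i)).withDensity
      fun y => ENNReal.ofReal (areaDensity X ((chartCenters M).get i) y)) :=
    (((continuousOn_extChartAt_symm (I := I2) _).mono hT).aemeasurable hmi).mono_ac
      (withDensity_absolutelyContinuous _ _)
  have hset : e.symm ⁻¹' B ∩ e '' chartCell i = e '' (B ∩ chartCell i) := by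
    ext y
    constructor
    · rintro ⟨hy, p, hp, rfl⟩
      rw [mem_preimage, e.left_inv (hsub hp)] at hy
      exact ⟨p, ⟨hy, hp⟩, rfl⟩
    · rintro ⟨p, ⟨hpB, hp⟩, rfl⟩
      exact ⟨by rwa [mem_preimage, e.left_inv (hsub hp)], p, hp, rfl⟩
  rw [Measure.map_apply_of_aemeasurable hae hB, withDensity_apply', Measure.restrict_restrict' hmi,
    hset]
  exact lintegral_areaDensity_change hX (hB.inter (measurableSet_chartCell i))
    (inter_subset_left.trans hc) (inter_subset_right.trans hsub)

omit [CompactSpace M] [MeasurableSpace M] [BorelSpace M] in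
theorem contDiffOn_areaDensity {X : M → E3} (hX : IsSmoothImmersion X) (c : M) :
    ContDiffOn ℝ ∞ (areaDensity X c) (extChartAt I2 c).target := fun y hy =>
  (contDiffAt_areaFactor (injective_chartDeriv' hX hy)).comp_contDiffWithinAt y
    ((contDiffOn_chartDeriv (m := ⊤) (n := ⊤) le_top hX.1 c) y hy)

/-- The area measure on the domain of a chart, in the coordinates of the chart. -/
theorem areaMeasure_restrict {X : M → E3} (hX : ContMDiff I2 𝓘(ℝ, E3) ∞ X) (c : M) :
    (areaMeasure X).restrict (extChartAt I2 c).source =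
      Measure.map (extChartAt I2 c).symm ((volume.restrict (extChartAt I2 c).target).withDensity
        fun y => ENNReal.ofReal (areaDensity X c y)) := by
  set e := extChartAt I2 c with he
  have hae : AEMeasurable e.symm ((volume.restrict e.target).withDensity
      fun y => ENNReal.ofReal (areaDensity X c y)) :=
    ((continuousOn_extChartAt_symm (I := I2) _).aemeasurable (measurableSet_target c)).mono_ac
      (withDensity_absolutelyContinuous _ _)
  ext B hB
  have hos : MeasurableSet e.source := (isOpen_extChartAt_source c).measurableSet
  rw [Measure.restrict_apply hB, areaMeasure_apply hX c (hB.inter hos) inter_subset_right,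
    Measure.map_apply_of_aemeasurable hae hB, withDensity_apply',
    Measure.restrict_restrict' (measurableSet_target c)]
  congr 2
  rw [image_chart_eq inter_subset_right]
  ext y
  constructor
  · rintro ⟨hy, h, -⟩
    exact ⟨h, hy⟩
  · rintro ⟨h, hy⟩
    exact ⟨hy, h, e.map_target hy⟩

theorem integral_areaMeasure_chart {X : M → E3} (hX : IsSmoothImmersion X) (c : M) {f : M → ℝ}
    (hf : Continuous f) (hfc : support f ⊆ (extChartAt I2 c).source) :
    ∫ p, f p ∂(areaMeasure X) =
      ∫ y in (extChartAt I2 c).target, areaDensity X c y * f ((extChartAt I2 c).symm y) := by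
  set e := extChartAt I2 c with he
  have hcont := (contDiffOn_areaDensity hX c).continuousOn.aemeasurable (μ := volume)
    (measurableSet_target c)
  have hae : AEMeasurable e.symm ((volume.restrict e.target).withDensity
      fun y => ENNReal.ofReal (areaDensity X c y)) :=
    ((continuousOn_extChartAt_symm (I := I2) _).aemeasurable (measurableSet_target c)).mono_ac
      (withDensity_absolutelyContinuous _ _)
  rw [← setIntegral_eq_integral_of_forall_compl_eq_zero (s := e.source)
    (fun p hp => by_contra fun h => hp (hfc h)), areaMeasure_restrict hX.1,
    integral_map hae hf.aestronglyMeasurable]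
  rw [integral_withDensity_eq_integral_toReal_smul₀ hcont.ennreal_ofReal
    (Filter.Eventually.of_forall fun _ => ENNReal.ofReal_lt_top)]
  refine integral_congr_ae (Filter.Eventually.of_forall fun y => ?_)
  simp only [smul_eq_mul]
  rw [ENNReal.toReal_ofReal (areaDensity_eq X c y ▸ areaFactor_nonneg _)]

/-- Around each point, the area density and the chart image of a neighborhood are bounded; the
parameter surface is compact. -/
theorem isFiniteMeasure_areaMeasure {X : M → E3} (hX : IsSmoothImmersion X) :
    IsFiniteMeasure (areaMeasure X) := by
  have : IsLocallyFiniteMeasure (areaMeasure X) := by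
    refine ⟨fun p => ?_⟩
    set e := extChartAt I2 p with he
    have hc : ContinuousAt (fun q => areaDensity X p (e q)) p := by
      have h1 : ContinuousOn (fun q => areaDensity X p (e q)) e.source :=
        (contDiffOn_areaDensity hX p).continuousOn.comp (continuousOn_extChartAt p)
          (fun q hq => e.map_source hq)
      exact h1.continuousAt (extChartAt_source_mem_nhds p)
    have hU : ∀ᶠ q in 𝓝 p, q ∈ e.source ∧ areaDensity X p (e q) < areaDensity X p (e p) + 1 ∧
        e q ∈ Metric.ball (e p) 1 := by
      refine Filter.Eventually.and (extChartAt_source_mem_nhds (I := I2) p)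
        ((hc.eventually_lt_const (by simp)).and ?_)
      exact (continuousAt_extChartAt p).eventually (Metric.ball_mem_nhds _ one_pos)
    obtain ⟨U, hU, hUo, hpU⟩ := mem_nhds_iff.1 hU
    refine ⟨U, hUo.mem_nhds hpU, ?_⟩
    rw [areaMeasure_apply hX.1 p hUo.measurableSet fun q hq => (hU hq).1]
    have hm := measurableSet_image_chart hUo.measurableSet (c := p) fun q hq => (hU hq).1
    calc ∫⁻ y in e '' U, ENNReal.ofReal (areaDensity X p y)
        ≤ ∫⁻ _ in e '' U, ENNReal.ofReal (areaDensity X p (e p) + 1) := by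
          refine setLIntegral_mono' hm ?_
          rintro _ ⟨q, hq, rfl⟩
          exact ENNReal.ofReal_le_ofReal (hU hq).2.1.le
      _ = ENNReal.ofReal (areaDensity X p (e p) + 1) * volume (e '' U) := by
          rw [setLIntegral_const]
      _ < ⊤ := by
          refine ENNReal.mul_lt_top ENNReal.ofReal_lt_top (lt_of_le_of_lt (measure_mono ?_)
            (measure_ball_lt_top (x := e p) (r := 1)))
          rintro _ ⟨q, hq, rfl⟩
          exact (hU hq).2.2
  infer_instance

end AreaMeasure

/-! ### The divergence theorem -/

section HalfPlane

/-- The divergence theorem on the half plane, for the compactly supported field `(f 0, f 1)` that is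
tangent to the boundary line. -/
theorem integral_divergence_halfPlane (f : Fin 2 → E2 → ℝ) (f' : Fin 2 → E2 → E2 →L[ℝ] ℝ)
    (hf : ∀ i, ∀ y ∈ range I2, HasFDerivWithinAt (f i) (f' i y) (range I2) y)
    (hf' : ∀ i, ContinuousOn (f' i) (range I2)) {K : Set E2} (hK : IsCompact K)
    (h0 : ∀ i, ∀ y ∉ K, f i y = 0) (h0' : ∀ i, ∀ y ∉ K, f' i y = 0)
    (hbd : ∀ y : E2, y 0 = 0 → f 0 y = 0) :
    ∫ y in range I2, (f' 0 y (e2 0) + f' 1 y (e2 1)) = 0 := by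
  obtain ⟨r, hr⟩ := hK.isBounded.exists_norm_le
  set R : ℝ := max r 0 + 1 with hR
  have hRr : r < R := lt_of_le_of_lt (le_max_left r 0) (lt_add_one _)
  have hR0 : 0 < R := lt_of_le_of_lt (le_max_right r 0) (lt_add_one _)
  have hnotK : ∀ (y : E2) (i : Fin 2), R ≤ |y i| → y ∉ K := fun y i hy hyK => by
    have h1 := hr y hyK
    have h2 := PiLp.norm_apply_le y i
    rw [Real.norm_eq_abs] at h2
    linarith
  set D : E2 → ℝ := fun y => f' 0 y (e2 0) + f' 1 y (e2 1) with hD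
  set L : (Fin 2 → ℝ) → E2 := WithLp.toLp 2 with hL
  have hLc : Continuous L := PiLp.continuous_toLp 2 _
  have hLmp : MeasurePreserving L volume volume := PiLp.volume_preserving_toLp (Fin 2)
  set a : Fin 2 → ℝ := ![0, -R] with ha
  set b : Fin 2 → ℝ := ![R, R] with hb
  have hab : a ≤ b := by
    intro i; fin_cases i
    · exact hR0.le
    · change -R ≤ R; linarith
  have hmaps : MapsTo L (Icc a b) (range I2) := by
    intro x hx
    rw [range_I2]
    exact hx.1 0
  -- the integral over the half plane is an integral over a box
  have hbox : ∫ y in range I2, D y = ∫ x in Icc a b, D (L x) := by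
    have h1 : ∫ y in range I2, D y = ∫ x in L ⁻¹' range I2, D (L x) :=
      ((hLmp.setIntegral_preimage_emb (MeasurableEquiv.toLp 2 _).measurableEmbedding D _)).symm
    rw [h1]
    refine setIntegral_eq_of_subset_of_forall_sdiff_eq_zero
      (I2.isClosed_range.measurableSet.preimage hLc.measurable) hmaps ?_
    rintro x ⟨hx, hxn⟩
    have hx0 : 0 ≤ x 0 := by
      have : L x ∈ range I2 := hx
      rw [range_I2] at this
      exact this
    have : ∃ i, R ≤ |x i| := by
      by_contra! hcon
      refine hxn ⟨fun i => ?_, fun i => ?_⟩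
      · fin_cases i
        · exact hx0
        · exact (abs_lt.1 (hcon 1)).1.le
      · fin_cases i
        · exact (abs_lt.1 (hcon 0)).2.le
        · exact (abs_lt.1 (hcon 1)).2.le
    obtain ⟨i, hi⟩ := this
    have hz := hnotK (L x) i hi
    simp only [hD, h0' 0 _ hz, h0' 1 _ hz, zero_apply, add_zero]
  rw [hbox]
  have hLlin : ∀ x, HasFDerivAt L
      ((PiLp.continuousLinearEquiv 2 ℝ (fun _ : Fin 2 => ℝ)).symm : (Fin 2 → ℝ) →L[ℝ] E2) x :=
    fun x => ((PiLp.continuousLinearEquiv 2 ℝ (fun _ : Fin 2 => ℝ)).symm :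
      (Fin 2 → ℝ) →L[ℝ] E2).hasFDerivAt
  have hcont : ∀ i, ContinuousOn (fun x => f i (L x)) (Icc a b) := fun i =>
    ContinuousOn.comp (t := range I2) (fun y hy => (hf i y hy).continuousWithinAt)
      hLc.continuousOn hmaps
  have hmain := integral_divergence_of_hasFDerivAt_off_countable' (E := ℝ) a b hab
    (fun i x => f i (L x))
    (fun i x => (f' i (L x)).comp
      ((PiLp.continuousLinearEquiv 2 ℝ (fun _ : Fin 2 => ℝ)).symm : (Fin 2 → ℝ) →L[ℝ] E2))
    ∅ countable_empty hcont ?_ ?_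
  · have hLe : ∀ i : Fin 2, L (Pi.single i 1) = e2 i := fun i => by
      ext j; simp [hL, e2]
    have e : ∀ x, D (L x) = ∑ i : Fin 2, ((f' i (L x)).comp
        ((PiLp.continuousLinearEquiv 2 ℝ (fun _ : Fin 2 => ℝ)).symm : (Fin 2 → ℝ) →L[ℝ] E2))
          (Pi.single i 1) := fun x => by
      rw [Fin.sum_univ_two]
      change _ = f' 0 (L x) (L (Pi.single 0 1)) + f' 1 (L x) (L (Pi.single 1 1))
      rw [hLe, hLe]
    simp only [e]
    rw [hmain, Fin.sum_univ_two]
    have z : ∀ (i j : Fin 2) (x : Fin 2 → ℝ), R ≤ |x j| → f i (L x) = 0 := fun i j x hx =>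
      h0 i _ (hnotK (L x) j hx)
    have hRR : R ≤ |R| := le_abs_self R
    have hRR' : R ≤ |-R| := by rw [abs_neg]; exact hRR
    have z1 : ∀ x : Fin 1 → ℝ, f 0 (L (Fin.insertNth 0 (b 0) x)) = 0 := fun x =>
      z 0 0 _ (by simpa [hb] using hRR)
    have z2 : ∀ x : Fin 1 → ℝ, f 0 (L (Fin.insertNth 0 (a 0) x)) = 0 := fun x =>
      hbd _ (by simp [hL, ha])
    have z3 : ∀ x : Fin 1 → ℝ, f 1 (L (Fin.insertNth 1 (b 1) x)) = 0 := fun x =>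
      z 1 1 _ (by simpa [hb] using hRR)
    have z4 : ∀ x : Fin 1 → ℝ, f 1 (L (Fin.insertNth 1 (a 1) x)) = 0 := fun x =>
      z 1 1 _ (by simpa [ha] using hRR)
    simp only [z1, z2, z3, z4]
    simp
  · rintro x ⟨hx, -⟩ i
    have hx0 : 0 < x 0 := by
      exact (hx 0 (mem_univ _)).1
    have hn : range I2 ∈ 𝓝 (L x) := by
      rw [range_I2]
      have hc : Continuous fun y : E2 => y 0 := by fun_prop
      filter_upwards [(isOpen_Ioi.preimage hc).mem_nhds (show L x ∈ _ from hx0)] with y hy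
      exact (le_of_lt hy : (0:ℝ) ≤ y 0)
    exact ((hf i _ (mem_of_mem_nhds hn)).hasFDerivAt hn).comp x (hLlin x)
  · have : ContinuousOn (fun x => ∑ i : Fin 2, ((f' i (L x)).comp
        ((PiLp.continuousLinearEquiv 2 ℝ (fun _ : Fin 2 => ℝ)).symm : (Fin 2 → ℝ) →L[ℝ] E2))
          (Pi.single i 1)) (Icc a b) :=
      continuousOn_finsetSum _ fun i _ =>
        (((hf' i).comp hLc.continuousOn hmaps).clm_comp continuousOn_const).clm_apply
          continuousOn_const
    exact this.integrableOn_compact isCompact_Icc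

end HalfPlane

section ChartDivergence

variable {M : Type*} [TopologicalSpace M] [ChartedSpace (EuclideanHalfSpace 2) M]
variable {F : Type*} [NormedAddCommGroup F] [NormedSpace ℝ F]

/-- Extension by zero of a field in coordinates whose support is a compact part of the chart. -/
theorem contDiffOn_indicator_target {n : ℕ∞ω} (c : M) {g : E2 → F} {K : Set E2} (hK : IsCompact K)
    (hg : ContDiffOn ℝ n g (extChartAt I2 c).target)
    (h0 : ∀ y ∈ (extChartAt I2 c).target, y ∉ K → g y = 0) (hKt : K ⊆ (extChartAt I2 c).target) :
    ContDiffOn ℝ n ((extChartAt I2 c).target.indicator g) (range I2) := by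
  intro y hy
  by_cases hyK : y ∈ K
  · have hyt := hKt hyK
    have h1 : ContDiffWithinAt ℝ n ((extChartAt I2 c).target.indicator g)
        (extChartAt I2 c).target y :=
      (hg y hyt).congr (fun z hz => indicator_of_mem hz _) (indicator_of_mem hyt _)
    exact h1.mono_of_mem_nhdsWithin (extChartAt_target_mem_nhdsWithin_of_mem hyt)
  · have h1 : (extChartAt I2 c).target.indicator g =ᶠ[𝓝 y] fun _ => (0 : F) := by
      filter_upwards [hK.isClosed.isOpen_compl.mem_nhds hyK] with z hz
      by_cases hzt : z ∈ (extChartAt I2 c).target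
      · rw [indicator_of_mem hzt, h0 z hzt hz]
      · rw [indicator_of_notMem hzt]
    exact (contDiffAt_const.congr_of_eventuallyEq h1).contDiffWithinAt

theorem chart_coord_nonneg (c q : M) : 0 ≤ (extChartAt I2 c q) 0 := by
  have h : extChartAt I2 c q ∈ range I2 := by simp [extChartAt]
  rw [range_I2] at h
  exact h

variable [IsManifold I2 ∞ M]

theorem frontier_range_I2 : frontier (range I2) = {y : E2 | y 0 = 0} := by
  have h := frontier_range_modelWithCornersEuclideanHalfSpace 2
  rw [h]
  ext y; exact eq_comm

theorem mem_boundary_of_coord {c p : M} (hp : p ∈ (extChartAt I2 c).source)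
    (h0 : (extChartAt I2 c p) 0 = 0) : p ∈ I2.boundary M := by
  refine (I2.isBoundaryPoint_iff_of_mem_atlas (n := ∞) (by simp) (chart_mem_atlas _ c)
    ((extChartAt_source (I := I2) c) ▸ hp)).2 ?_
  rw [frontier, mem_sdiff]
  have hpt := (extChartAt I2 c).map_source hp
  refine ⟨subset_closure hpt, fun hcon => ?_⟩
  have h1 := interior_mono (extChartAt_target_subset_range (I := I2) c) hcon
  have h2 : extChartAt I2 c p ∈ frontier (range I2) := by
    rw [frontier_range_I2]; exact h0
  exact h2.2 h1

/-- Coordinate changes map the tangent vectors of the boundary to such vectors. -/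
theorem chartJac_coord {c p : M} (hp : p ∈ (extChartAt I2 c).source)
    (h0 : (extChartAt I2 c p) 0 = 0) {v : E2} (hv : v 0 = 0) : (chartJac c p v) 0 = 0 := by
  have hm := mdifferentiableAt_chart hp
  have hJ : chartJac c p = chartDeriv p (extChartAt I2 c) (extChartAt I2 p p) := by
    rw [chartJac, hm.mfderiv]
    rfl
  have hd : HasFDerivWithinAt (extChartAt I2 c ∘ (extChartAt I2 p).symm) (chartJac c p)
      (range I2) (extChartAt I2 p p) := by
    rw [hJ]
    exact hasFDerivWithinAt_transition (mem_extChartAt_source p) hp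
  set y := extChartAt I2 p p with hy
  have hline : HasDerivWithinAt (fun t : ℝ => y + t • v) v univ 0 := by
    have := ((hasDerivAt_id (0 : ℝ)).smul_const v).const_add y
    simpa using this
  have hmaps : MapsTo (fun t : ℝ => y + t • v) univ (range I2) := fun t _ => by
    rw [range_I2]
    have : 0 ≤ y 0 := chart_coord_nonneg p p
    simpa [hv] using this
  have hd' : HasFDerivWithinAt (extChartAt I2 c ∘ (extChartAt I2 p).symm) (chartJac c p)
      (range I2) (y + (0 : ℝ) • v) := by simpa using hd
  have h1 := hd'.comp_hasDerivWithinAt (0 : ℝ) hline hmaps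
  rw [hasDerivWithinAt_univ] at h1
  have h2 := ((EuclideanSpace.proj 0 : E2 →L[ℝ] ℝ).hasFDerivAt
    (x := ((extChartAt I2 c ∘ (extChartAt I2 p).symm) ∘ fun t : ℝ => y + t • v) 0)).comp_hasDerivAt
      (0 : ℝ) h1
  -- The zeroth coordinate is minimal at the boundary.
  have hmin : IsLocalMin ((EuclideanSpace.proj 0 : E2 →L[ℝ] ℝ) ∘
      ((extChartAt I2 c ∘ (extChartAt I2 p).symm) ∘ fun t : ℝ => y + t • v)) 0 := by
    refine Filter.Eventually.of_forall fun t => ?_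
    have e0 : (extChartAt I2 c) ((extChartAt I2 p).symm (y + (0 : ℝ) • v)) 0 = 0 := by
      rw [zero_smul, add_zero, hy, extChartAt_to_inv, h0]
    change (extChartAt I2 c) ((extChartAt I2 p).symm (y + (0 : ℝ) • v)) 0 ≤
      (extChartAt I2 c) ((extChartAt I2 p).symm (y + t • v)) 0
    rw [e0]
    exact chart_coord_nonneg c _
  exact hmin.hasDerivAt_eq_zero h2

/-- A tangential field without flux through the boundary is tangent to the boundary. -/
theorem coord_eq_zero_of_noBoundaryFlux {X : M → E3} (hX : IsSmoothImmersion X) {q : M → E3}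
    (hq : NoBoundaryFlux X q) {c p : M} (hp : p ∈ (extChartAt I2 c).source)
    (h0 : (extChartAt I2 c p) 0 = 0) {v : E2} (hv : chartDeriv c X (extChartAt I2 c p) v = q p) :
    v 0 = 0 := by
  obtain ⟨η, rfl⟩ := (LinearMap.injective_iff_surjective
    (f := (chartJac c p : E2 →ₗ[ℝ] E2))).1 (injective_chartJac hp) v
  refine chartJac_coord hp h0 ?_
  have hA := hX.2 p
  have hη : differential X p η = q p := by
    rw [differential_eq hp (hX.1.mdifferentiable (by simp) p)]; exact hv
  set A := differential X p with hAdef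
  -- The vector `A u` is a negative combination of `A (e2 0)` and orthogonal to `A (e2 1)`, i.e. a
  -- positive multiple of the outward co-normal.
  set l : ℝ := inner ℝ (A (e2 0)) (A (e2 1)) / inner ℝ (A (e2 1)) (A (e2 1)) with hl
  have hb : (inner ℝ (A (e2 1)) (A (e2 1)) : ℝ) ≠ 0 := by
    rw [inner_self_ne_zero]
    intro h
    have := congrArg (fun w : E2 => w 1) ((injective_iff_map_eq_zero A).1 hA _ h)
    simp [e2] at this
  set u : E2 := l • e2 1 - e2 0 with hu
  have hu0 : u 0 = -1 := by simp [hu, e2]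
  have hn0 : A u ≠ 0 := fun h => by
    have := congrArg (fun w : E2 => w 0) ((injective_iff_map_eq_zero A).1 hA _ h)
    simp [hu0] at this
  have horth : inner ℝ (A u) (A (e2 1)) = (0 : ℝ) := by
    rw [hu, map_sub, map_smul, inner_sub_left, inner_smul_left, hl]
    simp only [conj_trivial]
    rw [div_mul_cancel₀ _ hb, sub_self]
  have hn : 0 < ‖A u‖ := norm_pos_iff.2 hn0
  have hcon : IsConormal X p (‖A u‖⁻¹ • A u) := by
    refine ⟨by rw [norm_smul, norm_inv, norm_norm, inv_mul_cancel₀ hn.ne'],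
      ⟨‖A u‖⁻¹ • u, ?_, map_smul _ _ _⟩, fun w hw => ?_⟩
    · have : (‖A u‖⁻¹ • u) 0 = ‖A u‖⁻¹ * u 0 := rfl
      rw [this, hu0]
      have := inv_pos.2 hn
      linarith
    · have hw' := eq_sum_e2 w
      rw [hw, zero_smul, zero_add] at hw'
      rw [hw']
      change inner ℝ _ (A _) = _
      rw [map_smul, inner_smul_left, inner_smul_right, horth]; simp
  have h1 := hq p (mem_boundary_of_coord hp h0) _ hcon
  rw [← hη, inner_smul_right, mul_eq_zero] at h1
  have h2 : inner ℝ (A η) (A u) = (0 : ℝ) := h1.resolve_left (inv_pos.2 hn).ne'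
  have h3 : A η = (-η 0) • A u + (η 1 + η 0 * l) • A (e2 1) := by
    rw [← map_smul, ← map_smul, ← map_add]
    congr 1
    ext i; fin_cases i <;> simp [hu, e2]
  rw [h3, inner_add_left, inner_smul_left, inner_smul_left, real_inner_comm (A u) (A (e2 1)),
    horth] at h2
  simpa [hn0] using h2

/-- The trace-divergence is a trace in the coordinate plane. -/
theorem surfaceDiv_eq {X : M → E3} (hX : IsSmoothImmersion X) {c p : M}
    (hp : p ∈ (extChartAt I2 c).source) {W : M → E3} (hW : MDifferentiableAt I2 𝓘(ℝ, E3) W p) :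
    surfaceDiv X W p = logAreaDeriv (chartDeriv c X (extChartAt I2 c p))
      (chartDeriv c W (extChartAt I2 c p)) := by
  rw [surfaceDiv, surfaceDeriv_eq hX hp hW, logAreaDeriv_apply]
  exact LinearMap.trace_comp_comm' _ _

/-- The covariant divergence in coordinates: `√det g div q = ∑ᵢ ∂ᵢ (√det g qⁱ)`. -/
theorem areaDensity_mul_surfaceDiv {X : M → E3} (hX : IsSmoothImmersion X) {q : M → E3}
    (hq : ContMDiff I2 𝓘(ℝ, E3) 1 q) {c : M} {ζ : E2 → E2}
    (hζ : ContDiffOn ℝ 1 ζ (extChartAt I2 c).target)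
    (hqζ : ∀ y ∈ (extChartAt I2 c).target, q ((extChartAt I2 c).symm y) = chartDeriv c X y (ζ y))
    {y : E2} (hy : y ∈ (extChartAt I2 c).target) :
    areaDensity X c y * surfaceDiv X q ((extChartAt I2 c).symm y) =
      fderivWithin ℝ (fun z => areaDensity X c z * ζ z 0) (extChartAt I2 c).target y (e2 0) +
      fderivWithin ℝ (fun z => areaDensity X c z * ζ z 1) (extChartAt I2 c).target y (e2 1) := by
  set S := (extChartAt I2 c).target with hS
  have hu : UniqueDiffWithinAt ℝ S y := uniqueDiffOn_extChartAt_target c y hy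
  have hinj := injective_chartDeriv' hX hy
  have hA2 : ContDiffOn ℝ ∞ (chartDeriv c X) S :=
    contDiffOn_chartDeriv (m := ⊤) (n := ⊤) le_top hX.1 c
  have hA := (hA2.differentiableOn (by simp) y hy).hasFDerivWithinAt
  have hz := (hζ.differentiableOn (by simp) y hy).hasFDerivWithinAt
  set DA := fderivWithin ℝ (chartDeriv c X) S y with hDA
  set Dζ := fderivWithin ℝ ζ S y with hDζ
  -- the derivative of the field in coordinates
  have hB : chartDeriv c q y = (chartDeriv c X y).comp Dζ + DA.flip (ζ y) := by
    rw [chartDeriv_eq_target _ hy]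
    exact ((hA.clm_apply hz).congr hqζ (hqζ y hy)).fderivWithin hu
  -- the second derivatives of the immersion are symmetric
  have hsymm : DA.flip (ζ y) = DA (ζ y) := by
    ext1 v
    have hcl : y ∈ closure (interior S) := extChartAt_target_subset_closure_interior (I := I2) hy
    have h := ((contDiffOn_chart (n := ⊤) hX.1 c) y hy).isSymmSndFDerivWithinAt
      (by simp only [minSmoothness_of_isRCLikeNormedField]; exact ENat.LEInfty.out)
      (uniqueDiffOn_extChartAt_target c) hcl hy
    have e : DA = fderivWithin ℝ (fderivWithin ℝ (X ∘ (extChartAt I2 c).symm) S) S y :=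
      fderivWithin_congr (fun z hz => chartDeriv_eq_target X hz) (chartDeriv_eq_target X hy)
    rw [ContinuousLinearMap.flip_apply, e]
    exact h v (ζ y)
  have hdens : HasFDerivWithinAt (areaDensity X c)
      ((areaFactor (chartDeriv c X y) • logAreaDeriv (chartDeriv c X y)).comp DA) S y :=
    (hasFDerivAt_areaFactor hinj).comp_hasFDerivWithinAt y hA
  have hcoord : ∀ i : Fin 2, HasFDerivWithinAt (fun z => ζ z i)
      ((EuclideanSpace.proj i : E2 →L[ℝ] ℝ).comp Dζ) S y := fun i =>
    (EuclideanSpace.proj i : E2 →L[ℝ] ℝ).hasFDerivAt.comp_hasFDerivWithinAt y hz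
  have hfi : ∀ i : Fin 2, fderivWithin ℝ (fun z => areaDensity X c z * ζ z i) S y = _ := fun i =>
    (hdens.mul (hcoord i)).fderivWithin hu
  have hp := (extChartAt I2 c).map_target hy
  have hdiv := surfaceDiv_eq hX hp (hq.mdifferentiable (by simp) _)
  rw [(extChartAt I2 c).right_inv hy] at hdiv
  have hlin : logAreaDeriv (chartDeriv c X y) (DA (ζ y)) =
      ζ y 0 * logAreaDeriv (chartDeriv c X y) (DA (e2 0)) +
      ζ y 1 * logAreaDeriv (chartDeriv c X y) (DA (e2 1)) := by
    conv_lhs => rw [eq_sum_e2 (ζ y)]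
    simp only [map_add, map_smul, smul_eq_mul]
  have htr : logAreaDeriv (chartDeriv c X y) ((chartDeriv c X y).comp Dζ) =
      Dζ (e2 0) 0 + Dζ (e2 1) 1 := by
    rw [logAreaDeriv_apply, ← ContinuousLinearMap.comp_assoc, pinv_comp_self hinj,
      ContinuousLinearMap.id_comp, trace_eq]
  rw [hdiv, hB, hsymm, map_add, htr, hlin, hfi, hfi]
  have hproj : ∀ (i : Fin 2) (v : E2), (EuclideanSpace.proj i : E2 →L[ℝ] ℝ) v = v i :=
    fun _ _ => rfl
  simp only [areaDensity_eq, add_apply, smul_apply, ContinuousLinearMap.comp_apply, smul_eq_mul,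
    hproj]
  ring

omit [IsManifold I2 ∞ M] in
theorem surfaceDiv_eq_zero_of_notMem_tsupport {X q : M → E3} {p : M} (hp : p ∉ tsupport q) :
    surfaceDiv X q p = 0 := by
  have h1 : q =ᶠ[𝓝 p] fun _ => (0 : E3) := notMem_tsupport_iff_eventuallyEq.1 hp
  have h2 : differential q p = 0 := by
    rw [differential, h1.mfderiv_eq]
    exact mfderiv_const
  rw [surfaceDiv, surfaceDeriv, h2]
  simp

/-- The divergence theorem for a field that is supported in the domain of a chart. -/
theorem integral_surfaceDiv_of_chart [T2Space M] [CompactSpace M] [MeasurableSpace M]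
    [BorelSpace M] {X : M → E3} (hX : IsSmoothImmersion X) {q : M → E3}
    (hq : ContMDiff I2 𝓘(ℝ, E3) 1 q) (htan : ∀ p, ∃ v, differential X p v = q p)
    (hflux : NoBoundaryFlux X q) {c : M} (hc : tsupport q ⊆ (extChartAt I2 c).source) :
    ∫ p, surfaceDiv X q p ∂(areaMeasure X) = 0 := by
  set e := extChartAt I2 c with he
  set S := e.target with hS
  set K : Set E2 := e '' tsupport q with hKdef
  have hK : IsCompact K := (isClosed_tsupport q).isCompact.image_of_continuousOn
    ((continuousOn_extChartAt c).mono hc)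
  have hKS : K ⊆ S := by
    rintro _ ⟨p, hp, rfl⟩
    exact e.map_source (hc hp)
  have hoff : ∀ y ∈ S, y ∉ K → e.symm y ∉ tsupport q := fun y hy hyK hcon =>
    hyK ⟨_, hcon, e.right_inv hy⟩
  set ζ : E2 → E2 := fun y => pinv (chartDeriv c X y) (q (e.symm y)) with hζ
  have hζ1 : ContDiffOn ℝ 1 ζ S :=
    (contDiffOn_pinv_chartDeriv (m := 1) hX c).clm_apply (contDiffOn_chart (n := 1) hq c)
  have hζ0 : ∀ y ∈ S, y ∉ K → ζ y = 0 := fun y hy hyK => by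
    simp only [hζ, image_eq_zero_of_notMem_tsupport (hoff y hy hyK), map_zero]
  have hqζ : ∀ y ∈ S, q (e.symm y) = chartDeriv c X y (ζ y) := fun y hy => by
    have hps := e.map_target hy
    obtain ⟨v, hv⟩ := htan (e.symm y)
    rw [differential_eq hps (hX.1.mdifferentiable (by simp) _), e.right_inv hy] at hv
    simp only [hζ]
    rw [← hv, ContinuousLinearMap.comp_apply, pinv_apply_apply (injective_chartDeriv' hX hy)]
  have hζbd : ∀ y ∈ S, y 0 = 0 → ζ y 0 = 0 := fun y hy hy0 => by
    have hps := e.map_target hy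
    refine coord_eq_zero_of_noBoundaryFlux hX hflux hps ?_ (v := ζ y) ?_
    · rw [← he, e.right_inv hy]; exact hy0
    · rw [← he, e.right_inv hy]; exact (hqζ y hy).symm
  set g : Fin 2 → E2 → ℝ := fun i y => areaDensity X c y * ζ y i with hg
  have hg1 : ∀ i, ContDiffOn ℝ 1 (g i) S := fun i =>
    ((contDiffOn_areaDensity hX c).of_le (by simp)).mul
      ((EuclideanSpace.proj i : E2 →L[ℝ] ℝ).contDiff.comp_contDiffOn hζ1)
  set f : Fin 2 → E2 → ℝ := fun i => S.indicator (g i) with hf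
  have hf1 : ∀ i, ContDiffOn ℝ 1 (f i) (range I2) := fun i =>
    contDiffOn_indicator_target c hK (hg1 i)
      (fun y hy hyK => by simp [hg, hζ0 y hy hyK]) hKS
  have hf0 : ∀ i, ∀ y ∉ K, f i y = 0 := fun i y hyK => by
    by_cases hy : y ∈ S
    · simp [hf, indicator_of_mem hy, hg, hζ0 y hy hyK]
    · simp [hf, indicator_of_notMem hy]
  have hf0' : ∀ i, ∀ y ∉ K, fderivWithin ℝ (f i) (range I2) y = 0 := fun i y hyK => by
    have : f i =ᶠ[𝓝 y] fun _ => (0 : ℝ) := by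
      filter_upwards [hK.isClosed.isOpen_compl.mem_nhds hyK] with z hz using hf0 i z hz
    rw [Filter.EventuallyEq.fderivWithin_eq (this.filter_mono nhdsWithin_le_nhds) this.eq_of_nhds]
    simp
  have hmain := integral_divergence_halfPlane f (fun i => fderivWithin ℝ (f i) (range I2))
    (fun i y hy => ((hf1 i).differentiableOn (by simp) y hy).hasFDerivWithinAt)
    (fun i => (hf1 i).continuousOn_fderivWithin I2.uniqueDiffOn (by simp)) hK hf0 hf0'
    (fun y hy0 => by
      by_cases hy : y ∈ S
      · simp [hf, indicator_of_mem hy, hg, hζbd y hy hy0]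
      · simp [hf, indicator_of_notMem hy])
  have hcont : Continuous (surfaceDiv X q) :=
    (contMDiff_surfaceDiv (m := 0) (n := 1) (by simp) hX hq).continuous
  have hsupp : support (surfaceDiv X q) ⊆ e.source := fun p hp =>
    hc (by_contra fun h => hp (surfaceDiv_eq_zero_of_notMem_tsupport h))
  rw [integral_areaMeasure_chart hX c hcont hsupp, ← hmain, ← he, ← hS]
  have hSr : S ⊆ range I2 := extChartAt_target_subset_range c
  refine Eq.trans ?_ (setIntegral_eq_of_subset_of_forall_sdiff_eq_zero
    I2.isClosed_range.measurableSet hSr ?_).symm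
  · refine setIntegral_congr_fun (measurableSet_target c) fun y hy => ?_
    have hfd : ∀ i, fderivWithin ℝ (f i) (range I2) y = fderivWithin ℝ (g i) S y := fun i => by
      rw [← fderivWithin_congr_set (extChartAt_target_eventuallyEq_of_mem hy)]
      exact fderivWithin_congr (fun z hz => indicator_of_mem hz _) (indicator_of_mem hy _)
    simp only [hfd]
    exact areaDensity_mul_surfaceDiv hX hq hζ1 hqζ hy
  · rintro y ⟨-, hyS⟩
    have hyK : y ∉ K := fun h => hyS (hKS h)
    simp only [hf0' _ y hyK, zero_apply, add_zero]

end ChartDivergence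

/-! ### Product rules and the divergence theorem on the surface -/

section ProductRules

variable {M : Type*} [TopologicalSpace M] [ChartedSpace (EuclideanHalfSpace 2) M]
variable {F : Type*} [NormedAddCommGroup F] [NormedSpace ℝ F]

theorem differential_eq_chartDeriv {R : M → F} {p : M} (hR : MDifferentiableAt I2 𝓘(ℝ, F) R p) :
    differential R p = chartDeriv p R (extChartAt I2 p p) := hR.mfderiv

theorem differentiableWithinAt_preferred {R : M → F} {p : M}
    (hR : MDifferentiableAt I2 𝓘(ℝ, F) R p) :
    DifferentiableWithinAt ℝ (R ∘ (extChartAt I2 p).symm) (range I2) (extChartAt I2 p p) :=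
  hR.differentiableWithinAt_writtenInExtChartAt

theorem uniqueDiffWithinAt_preferred (p : M) :
    UniqueDiffWithinAt ℝ (range I2) (extChartAt I2 p p) :=
  I2.uniqueDiffWithinAt_image

theorem differential_smul {f : M → ℝ} {q : M → F} {p : M}
    (hf : MDifferentiableAt I2 𝓘(ℝ, ℝ) f p) (hq : MDifferentiableAt I2 𝓘(ℝ, F) q p) :
    differential (fun x => f x • q x) p =
      f p • differential q p + (differential f p).smulRight (q p) := by
  rw [differential_eq_chartDeriv (R := fun x => f x • q x) (hf.smul hq),
    differential_eq_chartDeriv hf, differential_eq_chartDeriv hq]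
  have h := fderivWithin_fun_smul (𝕜 := ℝ) (uniqueDiffWithinAt_preferred p)
    (differentiableWithinAt_preferred hf) (differentiableWithinAt_preferred hq)
  have e1 : (f ∘ (extChartAt I2 p).symm) (extChartAt I2 p p) = f p := by
    rw [comp_apply, extChartAt_to_inv]
  have e2 : (q ∘ (extChartAt I2 p).symm) (extChartAt I2 p p) = q p := by
    rw [comp_apply, extChartAt_to_inv]
  rw [← e1, ← e2]
  exact h

theorem differential_add {f q : M → F} {p : M}
    (hf : MDifferentiableAt I2 𝓘(ℝ, F) f p) (hq : MDifferentiableAt I2 𝓘(ℝ, F) q p) :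
    differential (fun x => f x + q x) p = differential f p + differential q p := by
  rw [differential_eq_chartDeriv (R := fun x => f x + q x) (hf.add hq),
    differential_eq_chartDeriv hf, differential_eq_chartDeriv hq]
  exact fderivWithin_fun_add (𝕜 := ℝ) (uniqueDiffWithinAt_preferred p)
    (differentiableWithinAt_preferred hf) (differentiableWithinAt_preferred hq)

theorem inner_surfaceGrad (X : M → E3) (f : M → ℝ) (p : M) (w : E3) :
    inner ℝ (surfaceGrad X f p) w = surfaceDeriv X f p w := by
  rw [surfaceGrad, InnerProductSpace.toDual_symm_apply]

theorem surfaceDiv_smul {X : M → E3} {f : M → ℝ} {q : M → E3} {p : M}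
    (hf : MDifferentiableAt I2 𝓘(ℝ, ℝ) f p) (hq : MDifferentiableAt I2 𝓘(ℝ, E3) q p) :
    surfaceDiv X (fun x => f x • q x) p =
      f p * surfaceDiv X q p + inner ℝ (surfaceGrad X f p) (q p) := by
  rw [inner_surfaceGrad]
  have h : surfaceDeriv X (fun x => f x • q x) p =
      f p • surfaceDeriv X q p + (surfaceDeriv X f p).smulRight (q p) := by
    rw [surfaceDeriv, differential_smul hf hq]
    ext1 v
    simp [surfaceDeriv]
  rw [surfaceDiv, h, surfaceDiv]
  have h2 : LinearMap.trace ℝ E3 ((surfaceDeriv X f p).smulRight (q p) : E3 →L[ℝ] E3) =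
      surfaceDeriv X f p (q p) :=
    LinearMap.trace_smulRight (surfaceDeriv X f p : E3 →ₗ[ℝ] ℝ) (q p)
  rw [ContinuousLinearMap.toLinearMap_add, ContinuousLinearMap.toLinearMap_smul, map_add, map_smul,
    h2, smul_eq_mul]

theorem surfaceDiv_add {X : M → E3} {f q : M → E3} {p : M}
    (hf : MDifferentiableAt I2 𝓘(ℝ, E3) f p) (hq : MDifferentiableAt I2 𝓘(ℝ, E3) q p) :
    surfaceDiv X (fun x => f x + q x) p = surfaceDiv X f p + surfaceDiv X q p := by
  have h : surfaceDeriv X (fun x => f x + q x) p = surfaceDeriv X f p + surfaceDeriv X q p := by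
    rw [surfaceDeriv, differential_add hf hq]
    ext1 v
    simp [surfaceDeriv]
  rw [surfaceDiv, h, surfaceDiv, surfaceDiv, ContinuousLinearMap.toLinearMap_add, map_add]

/-- The surface gradient is tangential. -/
theorem exists_differential_eq_surfaceGrad {X : M → E3} (hX : IsSmoothImmersion X) (f : M → ℝ)
    (p : M) : ∃ v, differential X p v = surfaceGrad X f p := by
  refine ⟨pinv (differential X p) (surfaceGrad X f p), ?_⟩
  refine ext_inner_right ℝ fun w => ?_
  have hA := hX.2 p
  -- the projection onto the tangent plane is symmetric
  have hsym : inner ℝ (differential X p (pinv (differential X p) (surfaceGrad X f p))) w =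
      inner ℝ (surfaceGrad X f p) (differential X p (pinv (differential X p) w)) := by
    rw [← inner_apply_pinv hA, real_inner_comm (differential X p (pinv (differential X p) w)),
      inner_apply_pinv hA, real_inner_comm]
  rw [hsym, inner_surfaceGrad, inner_surfaceGrad]
  change differential f p (pinv (differential X p) _) = differential f p (pinv (differential X p) w)
  rw [pinv_apply_apply hA]

theorem inner_surfaceGrad_normal {X ν : M → E3} (hν : IsUnitNormal X ν) (f : M → ℝ) (p : M) :
    inner ℝ (surfaceGrad X f p) (ν p) = 0 := by
  rw [inner_surfaceGrad]
  change differential f p (pinv (differential X p) (ν p)) = 0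
  rw [pinv_apply_normal (hν p).2, map_zero]

end ProductRules

section DivergenceTheorem

variable {M : Type*} [TopologicalSpace M] [ChartedSpace (EuclideanHalfSpace 2) M]
  [IsManifold I2 ∞ M] [T2Space M] [CompactSpace M]

variable (M) in
/-- A finite smooth partition of unity subordinate to the domains of charts. -/
theorem exists_chart_partition : ∃ (n : ℕ) (c : Fin n → M) (χ : Fin n → M → ℝ),
    (∀ i, ContMDiff I2 𝓘(ℝ, ℝ) ∞ (χ i)) ∧ (∀ i, tsupport (χ i) ⊆ (extChartAt I2 (c i)).source) ∧
      ∀ p, ∑ i, χ i p = 1 := by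
  obtain ⟨f, hf⟩ := SmoothPartitionOfUnity.exists_isSubordinate I2 (s := (univ : Set M))
    isClosed_univ (fun i : Fin (chartCenters M).length =>
      (extChartAt I2 ((chartCenters M).get i)).source) (fun i => isOpen_extChartAt_source _)
    (fun p _ => by
      obtain ⟨c, hc, hp⟩ := (exists_chart_cover M).choose_spec p
      obtain ⟨k, hk⟩ := List.mem_iff_get.1 (show c ∈ chartCenters M from hc)
      exact mem_iUnion.2 ⟨k, by simpa only [hk] using hp⟩)
  refine ⟨_, fun i => (chartCenters M).get i, fun i => f i, fun i => (f i).contMDiff, hf,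
    fun p => ?_⟩
  rw [← f.sum_eq_one (mem_univ p), finsum_eq_sum_of_fintype]

variable [MeasurableSpace M] [BorelSpace M]

omit [T2Space M] in
theorem integrable_areaMeasure {X : M → E3} (hX : IsSmoothImmersion X) {f : M → ℝ}
    (hf : Continuous f) : Integrable f (areaMeasure X) := by
  have := isFiniteMeasure_areaMeasure hX
  exact hf.integrable_of_hasCompactSupport (HasCompactSupport.of_compactSpace f)

/-- The divergence theorem for tangential fields without flux through the boundary. -/
theorem integral_surfaceDiv {X : M → E3} (hX : IsSmoothImmersion X) {q : M → E3}
    (hq : ContMDiff I2 𝓘(ℝ, E3) 1 q) (htan : ∀ p, ∃ v, differential X p v = q p)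
    (hflux : NoBoundaryFlux X q) : ∫ p, surfaceDiv X q p ∂(areaMeasure X) = 0 := by
  obtain ⟨n, c, χ, hχ, hχc, hsum⟩ := exists_chart_partition M
  have hχ1 : ∀ i, ContMDiff I2 𝓘(ℝ, ℝ) 1 (χ i) := fun i => (hχ i).of_le (by simp)
  have hpiece : ∀ i, ContMDiff I2 𝓘(ℝ, E3) 1 (fun x => χ i x • q x) := fun i => (hχ1 i).smul hq
  have hzero : ∀ i, ∫ p, surfaceDiv X (fun x => χ i x • q x) p ∂(areaMeasure X) = 0 := fun i => by
    refine integral_surfaceDiv_of_chart hX (hpiece i) (fun p => ?_) (fun p hp m hm => ?_)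
      (c := c i) ?_
    · obtain ⟨v, hv⟩ := htan p
      exact ⟨χ i p • v, by rw [map_smul, hv]⟩
    · rw [inner_smul_left, hflux p hp m hm, mul_zero]
    · exact (tsupport_smul_subset_left (χ i) q).trans (hχc i)
  -- the gradients of the functions of the partition add up to zero
  have hgrad : ∀ p, ∑ i, surfaceDeriv X (χ i) p = 0 := fun p => by
    have h1 : ∑ i, differential (χ i) p = 0 := by
      have h2 : ∀ i, differential (χ i) p = chartDeriv p (χ i) (extChartAt I2 p p) := fun i =>
        differential_eq_chartDeriv ((hχ i).mdifferentiable (by simp) p)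
      simp only [h2, chartDeriv]
      rw [← fderivWithin_fun_sum (uniqueDiffWithinAt_preferred p) fun i _ =>
        differentiableWithinAt_preferred
          ((hχ i).mdifferentiable (by simp) p)]
      have h3 : (fun y => ∑ i, (χ i ∘ (extChartAt I2 p).symm) y) = fun _ => (1 : ℝ) := by
        funext y; exact hsum _
      rw [h3]
      simp
    simp only [surfaceDeriv]
    rw [← ContinuousLinearMap.finsetSum_comp, ← ContinuousLinearMap.finsetSum_comp, h1]
    simp
  have hdiv : ∀ p, surfaceDiv X q p = ∑ i, surfaceDiv X (fun x => χ i x • q x) p := fun p => by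
    have h1 : ∀ i, surfaceDiv X (fun x => χ i x • q x) p =
        χ i p * surfaceDiv X q p + surfaceDeriv X (χ i) p (q p) := fun i => by
      rw [surfaceDiv_smul ((hχ i).mdifferentiable (by simp) p) (hq.mdifferentiable (by simp) p),
        inner_surfaceGrad]
    simp only [h1]
    rw [Finset.sum_add_distrib, ← Finset.sum_mul, hsum, one_mul]
    have h4 : ∑ i, surfaceDeriv X (χ i) p (q p) = (∑ i, surfaceDeriv X (χ i) p) (q p) := by
      simp
    rw [h4, hgrad]
    simp
  simp only [hdiv]
  rw [integral_finsetSum _ fun i _ => integrable_areaMeasure hX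
    (contMDiff_surfaceDiv (m := 0) (n := 1) (by simp) hX (hpiece i)).continuous]
  exact Finset.sum_eq_zero fun i _ => hzero i

/-- The Laplace-Beltrami operator of a function without boundary flux has mean zero. -/
theorem integral_laplaceBeltrami {X : M → E3} (hX : IsSmoothImmersion X) {f : M → ℝ}
    (hf : ContMDiff I2 𝓘(ℝ, ℝ) 2 f) (hflux : NoBoundaryFlux X (surfaceGrad X f)) :
    ∫ p, laplaceBeltrami X f p ∂(areaMeasure X) = 0 :=
  integral_surfaceDiv hX (contMDiff_surfaceGrad (m := 1) (n := 2) (by norm_num) hX hf)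
    (exists_differential_eq_surfaceGrad hX f) hflux

/-- Integration by parts on the surface. -/
theorem integral_mul_laplaceBeltrami {X : M → E3} (hX : IsSmoothImmersion X) {f : M → ℝ}
    (hf : ContMDiff I2 𝓘(ℝ, ℝ) 2 f) (hflux : NoBoundaryFlux X (surfaceGrad X f)) :
    ∫ p, f p * laplaceBeltrami X f p ∂(areaMeasure X) =
      - ∫ p, ‖surfaceGrad X f p‖ ^ 2 ∂(areaMeasure X) := by
  have hg := contMDiff_surfaceGrad (m := 1) (n := 2) (by norm_num) hX hf
  have hf1 : ContMDiff I2 𝓘(ℝ, ℝ) 1 f := hf.of_le (by norm_num)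
  have h0 := integral_surfaceDiv hX (q := fun p => f p • surfaceGrad X f p) (hf1.smul hg)
    (fun p => by
      obtain ⟨v, hv⟩ := exists_differential_eq_surfaceGrad hX f p
      exact ⟨f p • v, by rw [map_smul, hv]⟩)
    (fun p hp m hm => by rw [inner_smul_left, hflux p hp m hm, mul_zero])
  have h1 : ∀ p, surfaceDiv X (fun x => f x • surfaceGrad X f x) p =
      f p * laplaceBeltrami X f p + ‖surfaceGrad X f p‖ ^ 2 := fun p => by
    rw [surfaceDiv_smul (hf1.mdifferentiable (by simp) p) (hg.mdifferentiable (by simp) p),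
      real_inner_self_eq_norm_sq, laplaceBeltrami]
  simp only [h1] at h0
  have hΔ : Continuous (laplaceBeltrami X f) :=
    (contMDiff_surfaceDiv (m := 0) (n := 1) (by simp) hX hg).continuous
  rw [integral_add (f := fun p => f p * laplaceBeltrami X f p)
    (g := fun p => ‖surfaceGrad X f p‖ ^ 2)
    (integrable_areaMeasure hX (hf.continuous.mul hΔ))
    (integrable_areaMeasure hX (hg.continuous.norm.pow 2))] at h0
  linarith

end DivergenceTheorem

/-! ### Transport of integrals over a moving surface -/

section Transport

variable {M : Type*} [TopologicalSpace M] [ChartedSpace (EuclideanHalfSpace 2) M]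
  [IsManifold I2 ∞ M]

/-- The ratio of the area elements of two immersions of the same parameter surface. -/
def areaRatio (X Y : M → E3) (p : M) : ℝ :=
  areaFactor (differential Y p) / areaFactor (differential X p)

theorem areaRatio_eq {X Y : M → E3} (hX : IsSmoothImmersion X) (hY : IsSmoothImmersion Y)
    {c : M} {y : E2} (hy : y ∈ (extChartAt I2 c).target) :
    areaRatio X Y ((extChartAt I2 c).symm y) = areaDensity Y c y / areaDensity X c y := by
  have hp := (extChartAt I2 c).map_target hy
  have hJ : (chartJac c ((extChartAt I2 c).symm y)).det ≠ 0 := by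
    have := (isUnit_of_injective (injective_chartJac hp)).map
      (ContinuousLinearMap.toLinearMapRingHom : (E2 →L[ℝ] E2) →+* _)
    exact (LinearMap.isUnit_det _ this).ne_zero
  rw [areaRatio, differential_eq hp (hX.1.mdifferentiable (by simp) _),
    differential_eq hp (hY.1.mdifferentiable (by simp) _), areaFactor_comp, areaFactor_comp,
    (extChartAt I2 c).right_inv hy, areaDensity_eq, areaDensity_eq,
    mul_div_mul_right _ _ (abs_ne_zero.2 hJ)]

theorem isSmoothFamily_areaRatio {T : Set ℝ} (hT : IsOpen T) {X : ℝ → M → E3}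
    (hX : IsSmoothFamily T X) (himm : ∀ s ∈ T, IsSmoothImmersion (X s)) {t : ℝ} (ht : t ∈ T) :
    IsSmoothFamily T (fun s => areaRatio (X t) (X s)) := by
  refine isSmoothFamily_of_chart fun c => ?_
  have h1 : ContDiffOn ℝ ∞ (fun z : ℝ × E2 => areaFactor (chartDeriv c (X z.1) z.2))
      (T ×ˢ (extChartAt I2 c).target) := fun z hz =>
    ContDiffAt.comp_contDiffWithinAt (g := areaFactor) z
      (contDiffAt_areaFactor (injective_chartDeriv' (himm z.1 hz.1) hz.2))
      (hX.contDiffOn_chartDeriv hT c z hz)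
  have h2 : ContDiffOn ℝ ∞ (fun z : ℝ × E2 => areaDensity (X t) c z.2)
      (T ×ˢ (extChartAt I2 c).target) :=
    (contDiffOn_areaDensity (himm t ht) c).comp contDiffOn_snd fun z hz => hz.2
  refine (h1.div h2 fun z hz => ?_).congr fun z hz => areaRatio_eq (himm t ht) (himm _ hz.1) hz.2
  exact (areaFactor_pos (injective_chartDeriv' (himm t ht) hz.2)).ne'

/-- The relative rate of change of the area element is the divergence of the velocity. -/
theorem hasDerivAt_areaRatio {T : Set ℝ} (hT : IsOpen T) {X : ℝ → M → E3}
    (hX : IsSmoothFamily T X) (himm : ∀ s ∈ T, IsSmoothImmersion (X s)) {t : ℝ} (ht : t ∈ T)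
    (p : M) : HasDerivAt (fun s => areaRatio (X t) (X s) p)
      (surfaceDiv (X t) (observerVelocity X t) p) t := by
  have hp := mem_extChartAt_source (I := I2) p
  have hy := (extChartAt I2 p).map_source hp
  have hinj := injective_chartDeriv' (himm t ht) hy
  have h1 := (hasFDerivAt_areaFactor hinj).comp_hasDerivAt t (hX.hasDerivAt_chartDeriv hT ht hy)
  have h2 := h1.div_const (areaDensity (X t) p (extChartAt I2 p p))
  have h3 := surfaceDiv_eq (himm t ht) hp ((hX.deriv hT).contMDiff ht |>.mdifferentiable (by simp) p)
  refine (h2.congr_of_eventuallyEq ?_).congr_deriv ?_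
  · filter_upwards [hT.mem_nhds ht] with s hs
    have := areaRatio_eq (himm t ht) (himm s hs) hy
    rw [extChartAt_to_inv] at this
    rw [this]
    rfl
  · have hpos := areaFactor_pos hinj
    change _ = surfaceDiv (X t) (fun p => deriv (fun a => X a p) t) p
    rw [h3, areaDensity_eq]
    simp only [smul_apply, smul_eq_mul]
    field_simp

variable [CompactSpace M] [MeasurableSpace M] [BorelSpace M]

omit [IsManifold I2 ∞ M] in
/-- Differentiation of a smooth family under the integral over a compact surface. -/
theorem IsSmoothFamily.hasDerivAt_integral [IsManifold I2 ∞ M] {O : Set ℝ} (hO : IsOpen O)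
    {h : ℝ → M → ℝ} (hh : IsSmoothFamily O h) (μ : Measure M) [IsFiniteMeasure μ] {t : ℝ}
    (ht : t ∈ O) : HasDerivAt (fun s => ∫ p, h s p ∂μ)
      (∫ p, _root_.deriv (fun s => h s p) t ∂μ) t := by
  obtain ⟨ε, hε, hball⟩ := Metric.isOpen_iff.1 hO t ht
  have hsub : Metric.closedBall t (ε / 2) ⊆ O :=
    (Metric.closedBall_subset_ball (by linarith)).trans hball
  have hcont : ContinuousOn (fun q : ℝ × M => _root_.deriv (fun s => h s q.2) q.1)
      (Metric.closedBall t (ε / 2) ×ˢ univ) :=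
    (hh.deriv hO).continuousOn.mono (prod_mono hsub Subset.rfl)
  obtain ⟨C, hC⟩ :=
    ((isCompact_closedBall t (ε / 2)).prod isCompact_univ).exists_bound_of_continuousOn hcont
  have hcs : ∀ s ∈ O, Continuous (h s) := fun s hs => (hh.contMDiff hs).continuous
  refine (hasDerivAt_integral_of_dominated_loc_of_deriv_le (μ := μ) (F := h)
    (F' := fun s p => _root_.deriv (fun s => h s p) s) (bound := fun _ => C)
    (Metric.ball_mem_nhds t (half_pos hε)) ?_ ?_ ?_ ?_ (integrable_const C) ?_).2
  · filter_upwards [hO.mem_nhds ht] with s hs using (hcs s hs).aestronglyMeasurable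
  · exact (hcs t ht).integrable_of_hasCompactSupport (HasCompactSupport.of_compactSpace _)
  · exact ((hh.deriv hO).contMDiff ht).continuous.aestronglyMeasurable
  · exact Filter.Eventually.of_forall fun p s hs =>
      hC (s, p) ⟨Metric.ball_subset_closedBall hs, mem_univ _⟩
  · exact Filter.Eventually.of_forall fun p s hs =>
      hh.hasDerivAt hO (hsub (Metric.ball_subset_closedBall hs)) p

/-- The area measures of two immersions differ by the ratio of the area elements. -/
theorem integral_areaMeasure_ratio [T2Space M] {X Y : M → E3} (hX : IsSmoothImmersion X)
    (hY : IsSmoothImmersion Y) (hr : Continuous (areaRatio X Y)) {f : M → ℝ} (hf : Continuous f) :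
    ∫ p, f p ∂(areaMeasure Y) = ∫ p, f p * areaRatio X Y p ∂(areaMeasure X) := by
  obtain ⟨n, c, χ, hχ, hχc, hsum⟩ := exists_chart_partition M
  have hcf : ∀ i, Continuous fun p => χ i p * f p := fun i => (hχ i).continuous.mul hf
  have hsupp : ∀ i (g : M → ℝ), support (fun p => χ i p * g p) ⊆ (extChartAt I2 (c i)).source :=
    fun i g => (support_mul_subset_left _ _).trans ((subset_tsupport _).trans (hχc i))
  have hcr : ∀ i, Continuous fun p => χ i p * (f p * areaRatio X Y p) := fun i =>
    (hχ i).continuous.mul (hf.mul hr)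
  have h1 : ∀ p, f p = ∑ i, χ i p * f p := fun p => by rw [← Finset.sum_mul, hsum, one_mul]
  have h2 : ∀ p, f p * areaRatio X Y p = ∑ i, χ i p * (f p * areaRatio X Y p) := fun p => by
    rw [← Finset.sum_mul, hsum, one_mul]
  rw [integral_congr_ae (Filter.Eventually.of_forall h1),
    integral_congr_ae (Filter.Eventually.of_forall h2),
    integral_finsetSum _ fun i _ => integrable_areaMeasure hY (hcf i),
    integral_finsetSum _ fun i _ => integrable_areaMeasure hX (hcr i)]
  refine Finset.sum_congr rfl fun i _ => ?_
  rw [integral_areaMeasure_chart hY (c i) (hcf i) (hsupp i _),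
    integral_areaMeasure_chart hX (c i) (hcr i) (hsupp i _)]
  refine setIntegral_congr_fun (measurableSet_target _) fun y hy => ?_
  have hpos := areaFactor_pos (injective_chartDeriv' hX hy)
  rw [← areaDensity_eq] at hpos
  rw [areaRatio_eq hX hY hy]
  field_simp

/-- The transport theorem: the rate of change of the integral of a scalar field over a moving
surface. -/
theorem hasDerivAt_integral_areaMeasure [T2Space M] {T : Set ℝ} (hT : IsOpen T) {X : ℝ → M → E3}
    (hX : IsSmoothFamily T X) (himm : ∀ s ∈ T, IsSmoothImmersion (X s)) {ψ : ℝ → M → ℝ}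
    (hψ : IsSmoothFamily T ψ) {t : ℝ} (ht : t ∈ T) :
    HasDerivAt (fun s => ∫ p, ψ s p ∂(areaMeasure (X s)))
      (∫ p, (deriv (fun s => ψ s p) t + ψ t p * surfaceDiv (X t) (observerVelocity X t) p)
        ∂(areaMeasure (X t))) t := by
  have := isFiniteMeasure_areaMeasure (himm t ht)
  have hr := isSmoothFamily_areaRatio hT hX himm ht
  have hfam : IsSmoothFamily T (fun s p => ψ s p * areaRatio (X t) (X s) p) :=
    ContMDiffOn.mul hψ hr
  refine ((hfam.hasDerivAt_integral hT (areaMeasure (X t)) ht).congr_of_eventuallyEq ?_).congr_deriv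
    ?_
  · filter_upwards [hT.mem_nhds ht] with s hs
    exact integral_areaMeasure_ratio (himm t ht) (himm s hs) (hr.contMDiff hs).continuous
      (hψ.contMDiff hs).continuous
  · refine integral_congr_ae (Filter.Eventually.of_forall fun p => ?_)
    have h1 := (hψ.hasDerivAt hT ht p).mul (hasDerivAt_areaRatio hT hX himm ht p)
    have h2 : areaRatio (X t) (X t) p = 1 :=
      div_self (areaFactor_pos ((himm t ht).2 p)).ne'
    change deriv _ t = _
    refine h1.deriv.trans ?_
    rw [h2, mul_one]

end Transport

/-! ### Kinematics of a moving surface and conservation of mass -/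

section Conservation

variable {M : Type*} [TopologicalSpace M] [ChartedSpace (EuclideanHalfSpace 2) M]
  [IsManifold I2 ∞ M] {T : Set ℝ} {X ν : ℝ → M → E3}

namespace IsMovingSurface

theorem contMDiff_observerVelocity (h : IsMovingSurface T X ν) (hT : IsOpen T) {t : ℝ}
    (ht : t ∈ T) : ContMDiff I2 𝓘(ℝ, E3) ∞ (observerVelocity X t) :=
  (h.smooth.deriv hT).contMDiff ht

theorem contMDiff_normalVelocity (h : IsMovingSurface T X ν) (hT : IsOpen T) {t : ℝ}
    (ht : t ∈ T) : ContMDiff I2 𝓘(ℝ, ℝ) ∞ (normalVelocity X ν t) := by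
  have h1 := h.contMDiff_observerVelocity hT ht
  have h2 := h.smooth_normal.contMDiff ht
  exact (contDiff_inner (𝕜 := ℝ) (E := E3)).contMDiff.comp (h1.prodMk_space h2)

theorem contMDiff_tangentialObserverVelocity (h : IsMovingSurface T X ν) (hT : IsOpen T) {t : ℝ}
    (ht : t ∈ T) : ContMDiff I2 𝓘(ℝ, E3) ∞ (tangentialObserverVelocity X ν t) :=
  (h.contMDiff_observerVelocity hT ht).sub
    ((h.contMDiff_normalVelocity hT ht).smul (h.smooth_normal.contMDiff ht))

theorem contMDiff_meanCurvature (h : IsMovingSurface T X ν) {t : ℝ}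
    (ht : t ∈ T) : ContMDiff I2 𝓘(ℝ, ℝ) ∞ (meanCurvature (X t) (ν t)) :=
  (contMDiff_surfaceDiv (m := ⊤) (n := ⊤) le_top (h.immersion t ht)
    (h.smooth_normal.contMDiff ht)).neg

omit [IsManifold I2 ∞ M] in
/-- The tangential observer velocity is the image of a coordinate vector. -/
theorem exists_differential_eq (h : IsMovingSurface T X ν) {t : ℝ} (ht : t ∈ T) (p : M) :
    ∃ v, differential (X t) p v = tangentialObserverVelocity X ν t p := by
  have hν := h.normal t ht p
  refine exists_apply_eq_of_inner_normal ((h.immersion t ht).2 p) hν.1 hν.2 ?_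
  rw [tangentialObserverVelocity, inner_sub_right, inner_smul_right, real_inner_self_eq_norm_sq,
    hν.1, normalVelocity, real_inner_comm]
  ring

theorem contMDiff_normalTruesdellRate (h : IsMovingSurface T X ν) (hT : IsOpen T)
    {ψ : ℝ → M → ℝ} (hψ : IsSmoothFamily T ψ) {t : ℝ} (ht : t ∈ T) :
    ContMDiff I2 𝓘(ℝ, ℝ) ∞ (normalTruesdellRate X ν ψ t) := by
  have h1 := (hψ.deriv hT).contMDiff ht
  have h2 : ContMDiff I2 𝓘(ℝ, ℝ) ∞ fun p =>
      inner ℝ (tangentialObserverVelocity X ν t p) (surfaceGrad (X t) (ψ t) p) :=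
    (contDiff_inner (𝕜 := ℝ) (E := E3)).contMDiff.comp
      ((h.contMDiff_tangentialObserverVelocity hT ht).prodMk_space
        (contMDiff_surfaceGrad (m := ⊤) (n := ⊤) le_top (h.immersion t ht) (hψ.contMDiff ht)))
  exact h1.sub (h2.add (((hψ.contMDiff ht).mul (h.contMDiff_normalVelocity hT ht)).mul
    (h.contMDiff_meanCurvature ht)))

/-- The divergence of the observer velocity, split into tangential and normal part. -/
theorem surfaceDiv_observerVelocity (h : IsMovingSurface T X ν) (hT : IsOpen T) {t : ℝ}
    (ht : t ∈ T) (p : M) : surfaceDiv (X t) (observerVelocity X t) p =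
      surfaceDiv (X t) (tangentialObserverVelocity X ν t) p -
        normalVelocity X ν t p * meanCurvature (X t) (ν t) p := by
  have hv := (h.contMDiff_tangentialObserverVelocity hT ht).mdifferentiable (by simp) p
  have hw := (h.contMDiff_normalVelocity hT ht).mdifferentiable (by simp) p
  have hn := (h.smooth_normal.contMDiff ht).mdifferentiable (by simp) p
  have e : observerVelocity X t = fun x => tangentialObserverVelocity X ν t x +
      normalVelocity X ν t x • ν t x := by
    funext x; rw [tangentialObserverVelocity, sub_add_cancel]
  rw [e, surfaceDiv_add (q := fun x => normalVelocity X ν t x • ν t x) hv (hw.smul hn),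
    surfaceDiv_smul hw hn, inner_surfaceGrad_normal (h.normal t ht), meanCurvature]
  ring

/-- The rate of change of the integral of `ψ` is the integral of its normal Truesdell rate, because
the tangential part of the transport is a divergence. -/
theorem hasDerivAt_integral_normalTruesdellRate [CompactSpace M] [T2Space M] [MeasurableSpace M]
    [BorelSpace M] (h : IsMovingSurface T X ν) (hT : IsOpen T) {ψ : ℝ → M → ℝ}
    (hψ : IsSmoothFamily T ψ) {t : ℝ} (ht : t ∈ T) :
    HasDerivAt (fun s => ∫ p, ψ s p ∂(areaMeasure (X s)))
      (∫ p, normalTruesdellRate X ν ψ t p ∂(areaMeasure (X t))) t := by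
  have hX := h.immersion t ht
  refine (hasDerivAt_integral_areaMeasure hT h.smooth h.immersion hψ ht).congr_deriv ?_
  have hv := h.contMDiff_tangentialObserverVelocity hT ht
  have hψt := hψ.contMDiff ht
  have hq : ContMDiff I2 𝓘(ℝ, E3) 1 fun p => ψ t p • tangentialObserverVelocity X ν t p :=
    (hψt.smul hv).of_le (by simp)
  have hdiv := integral_surfaceDiv hX hq
    (fun p => by
      obtain ⟨v, hv⟩ := h.exists_differential_eq ht p
      exact ⟨ψ t p • v, by rw [map_smul, hv]⟩)
    (fun p hp m hm => by rw [inner_smul_left, h.boundary t ht p hp m hm, mul_zero])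
  have hpt : ∀ p, deriv (fun s => ψ s p) t + ψ t p * surfaceDiv (X t) (observerVelocity X t) p =
      normalTruesdellRate X ν ψ t p +
        surfaceDiv (X t) (fun p => ψ t p • tangentialObserverVelocity X ν t p) p := fun p => by
    rw [h.surfaceDiv_observerVelocity hT ht, surfaceDiv_smul (hψt.mdifferentiable (by simp) p)
      (hv.mdifferentiable (by simp) p), normalTruesdellRate, real_inner_comm]
    ring
  simp only [hpt]
  rw [integral_add
    (integrable_areaMeasure hX (h.contMDiff_normalTruesdellRate hT hψ ht).continuous)
    (integrable_areaMeasure hX (contMDiff_surfaceDiv (m := 0) (n := 1) (by simp) hX hq).continuous),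
    hdiv, add_zero]

end IsMovingSurface

end Conservation

/-! ### Smooth dependence of integrals on parameters and Hadamard's lemma -/

section ParametricIntegral

universe u v

variable {W : Type u} [NormedAddCommGroup W] [NormedSpace ℝ W]

/-- The integral over `[0, 1]` of a function that depends `n` times continuously differentiably on
a parameter in a convex set, which need not be open.  The induction on `n` passes from `F` to
`W →L[ℝ] F`, so the universe of `F` has to contain that of `W`. -/
theorem contDiffOn_integral_nat {D : Set W} (hD : Convex ℝ D) (hu : UniqueDiffOn ℝ D) (n : ℕ) :
    ∀ {F : Type (max u v)} [NormedAddCommGroup F] [NormedSpace ℝ F] {g : W → ℝ → F},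
      ContDiffOn ℝ n (uncurry g) (D ×ˢ Icc 0 1) →
        ContDiffOn ℝ n (fun z => ∫ σ in (0 : ℝ)..1, g z σ) D := by
  have hint : ∀ {F : Type (max u v)} [NormedAddCommGroup F] [NormedSpace ℝ F] {g : W → ℝ → F},
      ContinuousOn (uncurry g) (D ×ˢ Icc 0 1) → ∀ z ∈ D,
        IntervalIntegrable (g z) volume 0 1 := fun {F _ _ g} hg z hz => by
    refine ContinuousOn.intervalIntegrable ?_
    rw [uIcc_of_le zero_le_one]
    exact hg.comp (f := fun σ => (z, σ)) (by fun_prop) fun σ hσ => ⟨hz, hσ⟩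
  induction n with
  | zero =>
    intro F _ _ g hg
    have hg' := hg.continuousOn
    simp only [Nat.cast_zero, contDiffOn_zero]
    intro z hz
    rw [ContinuousWithinAt, Metric.tendsto_nhds]
    intro ε hε
    obtain ⟨V, hV, hVs⟩ := isCompact_Icc.mem_uniformity_of_prod hg' hz
      (Metric.dist_mem_uniformity (half_pos hε))
    filter_upwards [hV, self_mem_nhdsWithin] with x hx hxD
    rw [dist_eq_norm, ← intervalIntegral.integral_sub (hint hg' x hxD) (hint hg' z hz)]
    refine lt_of_le_of_lt (intervalIntegral.norm_integral_le_of_norm_le_const (C := ε / 2) ?_)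
      (by norm_num; linarith)
    intro σ hσ
    rw [uIoc_of_le zero_le_one] at hσ
    have h1 := hVs x hx σ ⟨hσ.1.le, hσ.2⟩
    rw [← dist_eq_norm]
    exact le_of_lt h1
  | succ n ih =>
    intro F _ _ g hg
    have hu2 : UniqueDiffOn ℝ (D ×ˢ Icc (0 : ℝ) 1) := hu.prod (uniqueDiffOn_Icc one_pos)
    set g' : W → ℝ → W →L[ℝ] F := fun z σ =>
      (fderivWithin ℝ (uncurry g) (D ×ˢ Icc 0 1) (z, σ)).comp (ContinuousLinearMap.inl ℝ W ℝ)
      with hg'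
    have hg'n : ContDiffOn ℝ n (uncurry g') (D ×ˢ Icc 0 1) :=
      (hg.fderivWithin hu2 (m := n) (by simp)).clm_comp contDiffOn_const
    have hg'd : ∀ σ ∈ Icc (0 : ℝ) 1, ∀ z ∈ D,
        HasFDerivWithinAt (fun x => g x σ) (g' z σ) D z := fun σ hσ z hz => by
      have h1 := (hg.differentiableOn (by simp) (z, σ) ⟨hz, hσ⟩).hasFDerivWithinAt
      have h2 : HasFDerivWithinAt (fun x : W => (x, σ)) (ContinuousLinearMap.inl ℝ W ℝ) D z :=
        ((hasFDerivAt_id z).prodMk (hasFDerivAt_const σ z)).hasFDerivWithinAt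
      exact h1.comp z h2 fun x hx => mk_mem_prod hx hσ
    have hcast : ((n + 1 : ℕ) : ℕ∞ω) = n + 1 := by push_cast; rfl
    rw [hcast, contDiffOn_succ_iff_hasFDerivWithinAt_of_uniqueDiffOn hu]
    refine ⟨fun h => by simp at h, fun z => ∫ σ in (0 : ℝ)..1, g' z σ, ih hg'n, fun z hz => ?_⟩
    rw [hasFDerivWithinAt_iff_isLittleO, Asymptotics.isLittleO_iff]
    intro ε hε
    obtain ⟨V, hV, hVs⟩ := isCompact_Icc.mem_uniformity_of_prod hg'n.continuousOn hz
      (Metric.dist_mem_uniformity hε)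
    obtain ⟨r, hr, hrV⟩ := Metric.mem_nhdsWithin_iff.1 hV
    filter_upwards [self_mem_nhdsWithin, mem_nhdsWithin_of_mem_nhds (Metric.ball_mem_nhds z hr)]
      with x hxD hxr
    have hi1 := hint hg.continuousOn x hxD
    have hi2 := hint hg.continuousOn z hz
    have hi3 := hint hg'n.continuousOn z hz
    have hi4 : IntervalIntegrable (fun σ => g' z σ (x - z)) volume 0 1 :=
      ⟨(ContinuousLinearMap.apply ℝ F (x - z)).integrable_comp hi3.1,
        (ContinuousLinearMap.apply ℝ F (x - z)).integrable_comp hi3.2⟩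
    rw [ContinuousLinearMap.intervalIntegral_apply hi3, ← intervalIntegral.integral_sub hi1 hi2,
      ← intervalIntegral.integral_sub (hi1.sub hi2) hi4]
    refine (intervalIntegral.norm_integral_le_of_norm_le_const (C := ε * ‖x - z‖) ?_).trans
      (by norm_num)
    intro σ hσ
    rw [uIoc_of_le zero_le_one] at hσ
    have hσ' : σ ∈ Icc (0 : ℝ) 1 := ⟨hσ.1.le, hσ.2⟩
    -- the mean value inequality on a small convex neighborhood, uniformly in `σ`
    exact Convex.norm_image_sub_le_of_norm_hasFDerivWithin_le' (s := Metric.ball z r ∩ D)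
      (fun y hy => (hg'd σ hσ' y hy.2).mono inter_subset_right)
      (fun y hy => by
        have h1 := hVs y (hrV hy) σ hσ'
        rw [← dist_eq_norm]
        exact le_of_lt h1)
      ((convex_ball z r).inter hD) ⟨Metric.mem_ball_self hr, hz⟩ ⟨hxr, hxD⟩

end ParametricIntegral

section Hadamard

variable {M : Type*} [TopologicalSpace M] [ChartedSpace (EuclideanHalfSpace 2) M]
  [IsManifold I2 ∞ M]

/-- Hadamard's lemma: a smooth curve of fields is `R 0 + a • Q a` with a smooth curve `Q`. -/
theorem IsSmoothFamily.exists_hadamard {F : Type} [NormedAddCommGroup F] [NormedSpace ℝ F]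
    [CompleteSpace F] {δ : ℝ} {R : ℝ → M → F}
    (hR : IsSmoothFamily (Metric.ball 0 δ) R) :
    ∃ Q : ℝ → M → F, IsSmoothFamily (Metric.ball 0 δ) Q ∧
      (∀ a ∈ Metric.ball (0 : ℝ) δ, ∀ p, R a p = R 0 p + a • Q a p) ∧
      ∀ p, Q 0 p = _root_.deriv (fun s => R s p) 0 := by
  have hO : IsOpen (Metric.ball (0 : ℝ) δ) := Metric.isOpen_ball
  have hR' := hR.deriv hO
  have hmul : ∀ a ∈ Metric.ball (0 : ℝ) δ, ∀ σ ∈ Icc (0 : ℝ) 1, σ * a ∈ Metric.ball (0 : ℝ) δ :=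
    fun a ha σ hσ => by
      rw [mem_ball_zero_iff] at ha ⊢
      rw [norm_mul, Real.norm_of_nonneg hσ.1]
      exact lt_of_le_of_lt (mul_le_of_le_one_left (norm_nonneg a) hσ.2) ha
  refine ⟨fun a p => ∫ σ in (0 : ℝ)..1, _root_.deriv (fun s => R s p) (σ * a),
    isSmoothFamily_of_chart fun c => ?_, fun a ha p => ?_, fun p => by simp⟩
  · rintro ⟨a, y⟩ ⟨ha, hy⟩
    obtain ⟨r, hr, hrt⟩ := Metric.mem_nhdsWithin_iff.1
      (extChartAt_target_mem_nhdsWithin_of_mem (I := I2) hy)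
    set D : Set (ℝ × E2) := Metric.ball 0 δ ×ˢ (Metric.ball y r ∩ range I2) with hD
    have hconv : Convex ℝ D :=
      (convex_ball _ _).prod ((convex_ball _ _).inter I2.convex_range)
    have hu : UniqueDiffOn ℝ D := hO.uniqueDiffOn.prod (by
      rw [inter_comm]; exact I2.uniqueDiffOn.inter Metric.isOpen_ball)
    have hy' : y ∈ Metric.ball y r ∩ range I2 :=
      ⟨Metric.mem_ball_self hr, extChartAt_target_subset_range c hy⟩
    have hg : ContDiffOn ℝ ∞ (uncurry fun (z : ℝ × E2) (σ : ℝ) =>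
        _root_.deriv (fun s => R s ((extChartAt I2 c).symm z.2)) (σ * z.1)) (D ×ˢ Icc 0 1) :=
      (hR'.contDiffOn_chart c).comp (f := fun w : (ℝ × E2) × ℝ => (w.2 * w.1.1, w.1.2))
        (ContDiff.contDiffOn (by fun_prop))
        fun w hw => ⟨hmul _ hw.1.1 _ hw.2, hrt hw.1.2⟩
    have hQ : ContDiffOn ℝ ∞ (fun z : ℝ × E2 => ∫ σ in (0 : ℝ)..1,
        _root_.deriv (fun s => R s ((extChartAt I2 c).symm z.2)) (σ * z.1)) D :=
      contDiffOn_infty.2 fun n => contDiffOn_integral_nat hconv hu n (contDiffOn_infty.1 hg n)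
    refine (hQ (a, y) ⟨ha, hy'⟩).mono_of_mem_nhdsWithin ?_
    rw [nhdsWithin_prod_eq]
    refine Filter.prod_mem_prod self_mem_nhdsWithin ?_
    filter_upwards [self_mem_nhdsWithin, mem_nhdsWithin_of_mem_nhds (Metric.ball_mem_nhds y hr)]
      with z hz hzr
    exact ⟨hzr, extChartAt_target_subset_range c hz⟩
  · have hd : ∀ σ ∈ uIcc (0 : ℝ) 1, HasDerivAt (fun σ => R (σ * a) p)
        (a • _root_.deriv (fun s => R s p) (σ * a)) σ := fun σ hσ => by
      rw [uIcc_of_le zero_le_one] at hσ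
      have h1 := hR.hasDerivAt hO (hmul a ha σ hσ) p
      have h2 : HasDerivAt (fun σ : ℝ => σ * a) a σ := by
        simpa using (hasDerivAt_id σ).mul_const a
      exact h1.scomp σ h2
    have hc : ContinuousOn (fun σ => a • _root_.deriv (fun s => R s p) (σ * a)) (uIcc 0 1) := by
      rw [uIcc_of_le zero_le_one]
      refine continuousOn_const.smul ?_
      have := hR'.continuousOn
      exact this.comp (f := fun σ : ℝ => (σ * a, p)) (by fun_prop)
        fun σ hσ => ⟨hmul a ha σ hσ, mem_univ _⟩
    have h := intervalIntegral.integral_eq_sub_of_hasDerivAt hd hc.intervalIntegrable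
    rw [intervalIntegral.integral_smul] at h
    simp only [h, one_mul, zero_mul]
    abel

end Hadamard

/-! ### The derivative of an energy along curves of surfaces -/

section EnergyDerivative

variable {M : Type*} [TopologicalSpace M] [ChartedSpace (EuclideanHalfSpace 2) M]

/-- The straight line of pairs through `(X, ψ)` with velocity `(x, φ)`. -/
def SurfaceEnergy.along (U : SurfaceEnergy M) (X : M → E3) (ψ : M → ℝ) (x : M → E3) (φ : M → ℝ)
    (a : ℝ) : ℝ :=
  U.toFun (fun p => X p + a • x p) (fun p => ψ p + a • φ p)

/-- The first variation of the energy at `(X, ψ)` in direction `(x, φ)`.  The derivative exists for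
smooth directions, because the line is a smooth family. -/
def SurfaceEnergy.variation (U : SurfaceEnergy M) (X : M → E3) (ψ : M → ℝ) (x : M → E3)
    (φ : M → ℝ) : ℝ :=
  deriv (U.along X ψ x φ) 0

variable (U : SurfaceEnergy M)

/-- Along a smooth two-parameter family, the energy is totally differentiable at the origin. -/
theorem SurfaceEnergy.differentiableAt_two_param {δ : ℝ} (hδ : 0 < δ) {X : ℝ × ℝ → M → E3}
    {ψ : ℝ × ℝ → M → ℝ} (hX : IsSmoothFamily (Metric.ball 0 δ) X)
    (hψ : IsSmoothFamily (Metric.ball 0 δ) ψ) (hdom : (X 0, ψ 0) ∈ U.dom) :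
    DifferentiableAt ℝ (fun s => U.toFun (X s) (ψ s)) 0 := by
  set L : EuclideanSpace ℝ (Fin 2) →L[ℝ] ℝ × ℝ :=
    (EuclideanSpace.proj 0 : E2 →L[ℝ] ℝ).prod (EuclideanSpace.proj 1) with hL
  set O : Set (EuclideanSpace ℝ (Fin 2)) := L ⁻¹' Metric.ball 0 δ with hO
  have hOo : IsOpen O := Metric.isOpen_ball.preimage L.continuous
  have hX' : IsSmoothFamily O (fun s => X (L s)) := hX.comp L.contDiff fun s hs => hs
  have hψ' : IsSmoothFamily O (fun s => ψ (L s)) := hψ.comp L.contDiff fun s hs => hs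
  set O' := {s ∈ O | (X (L s), ψ (L s)) ∈ U.dom} with hO'
  have hO'o : IsOpen O' := U.isOpen_dom 2 O _ _ hOo hX' hψ'
  have hsub : O' ⊆ O := fun s hs => hs.1
  have hC1 := U.contDiffOn_family 2 O' _ _ hO'o (hX'.mono hsub) (hψ'.mono hsub) fun s hs => hs.2
  have h0 : (0 : EuclideanSpace ℝ (Fin 2)) ∈ O' :=
    ⟨by simp [hO, hδ], by simpa using hdom⟩
  have hd : DifferentiableAt ℝ (fun s => U.toFun (X (L s)) (ψ (L s))) 0 :=
    (hC1.differentiableOn (by simp)).differentiableAt (hO'o.mem_nhds h0)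
  -- transport to `ℝ × ℝ`
  set J : ℝ × ℝ →L[ℝ] EuclideanSpace ℝ (Fin 2) :=
    (ContinuousLinearMap.fst ℝ ℝ ℝ).smulRight (e2 0) +
      (ContinuousLinearMap.snd ℝ ℝ ℝ).smulRight (e2 1) with hJ
  have hLJ : ∀ s, L (J s) = s := fun s => by
    ext <;> simp [hL, hJ, e2]
  have hd' : DifferentiableAt ℝ (fun s => U.toFun (X (L s)) (ψ (L s))) (J 0) := by
    rwa [map_zero]
  have h := hd'.comp (0 : ℝ × ℝ) J.differentiableAt
  refine h.congr_of_eventuallyEq (Filter.Eventually.of_forall fun s => ?_)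
  simp only [comp_apply, hLJ]

theorem isSmoothFamily_line {F : Type*} [NormedAddCommGroup F] [NormedSpace ℝ F] {R r : M → F}
    (hR : ContMDiff I2 𝓘(ℝ, F) ∞ R) (hr : ContMDiff I2 𝓘(ℝ, F) ∞ r) (O : Set (ℝ × ℝ))
    {l : ℝ × ℝ → ℝ} (hl : ContDiff ℝ ∞ l) :
    IsSmoothFamily O (fun s p => R p + l s • r p) :=
  (isSmoothFamily_const hR).add ((isSmoothFamily_const hr).smul hl)

variable {X : M → E3} {ψ : M → ℝ}

/-- The first variation is additive, because the energy is differentiable along the two-parameter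
family that is spanned by the two directions. -/
theorem SurfaceEnergy.variation_add (hdom : (X, ψ) ∈ U.dom) {x y : M → E3} {φ χ : M → ℝ}
    (hx : ContMDiff I2 𝓘(ℝ, E3) ∞ x) (hφ : ContMDiff I2 𝓘(ℝ, ℝ) ∞ φ)
    (hy : ContMDiff I2 𝓘(ℝ, E3) ∞ y) (hχ : ContMDiff I2 𝓘(ℝ, ℝ) ∞ χ) :
    U.variation X ψ (fun p => x p + y p) (fun p => φ p + χ p) =
      U.variation X ψ x φ + U.variation X ψ y χ := by
  have hs := U.smooth_of_mem X ψ hdom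
  have h := (U.differentiableAt_two_param one_pos
    (X := fun s p => X p + s.1 • x p + s.2 • y p) (ψ := fun s p => ψ p + s.1 • φ p + s.2 • χ p)
    ((isSmoothFamily_line hs.1.1 hx _ contDiff_fst).add
      ((isSmoothFamily_const hy).smul contDiff_snd))
    ((isSmoothFamily_line hs.2 hφ _ contDiff_fst).add
      ((isSmoothFamily_const hχ).smul contDiff_snd))
    (by simpa using hdom)).hasFDerivAt
  set D := fderiv ℝ (fun s : ℝ × ℝ => U.toFun (fun p => X p + s.1 • x p + s.2 • y p)
    (fun p => ψ p + s.1 • φ p + s.2 • χ p)) 0 with hD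
  have hcurve : ∀ v : ℝ × ℝ, HasDerivAt (fun a : ℝ => U.toFun
      (fun p => X p + (a * v.1) • x p + (a * v.2) • y p)
      (fun p => ψ p + (a * v.1) • φ p + (a * v.2) • χ p)) (D v) 0 := fun v => by
    have h1 : HasDerivAt (fun a : ℝ => a • v) v 0 := by
      simpa using (hasDerivAt_id (0 : ℝ)).smul_const v
    have h0 : HasFDerivAt (fun s : ℝ × ℝ => U.toFun (fun p => X p + s.1 • x p + s.2 • y p)
      (fun p => ψ p + s.1 • φ p + s.2 • χ p)) D ((0 : ℝ) • v) := by rwa [zero_smul]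
    exact h0.comp_hasDerivAt (0 : ℝ) h1
  have e1 : U.variation X ψ x φ = D (1, 0) := by
    have := (hcurve (1, 0)).deriv
    simp only [mul_one, mul_zero, zero_smul, add_zero] at this
    exact this
  have e2 : U.variation X ψ y χ = D (0, 1) := by
    have := (hcurve (0, 1)).deriv
    simp only [mul_one, mul_zero, zero_smul, add_zero] at this
    exact this
  have e3 : U.variation X ψ (fun p => x p + y p) (fun p => φ p + χ p) = D (1, 1) := by
    have := (hcurve (1, 1)).deriv
    simp only [mul_one, add_assoc, ← smul_add] at this
    exact this
  rw [e1, e2, e3, ← map_add]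
  simp

theorem SurfaceEnergy.variation_zero : U.variation X ψ (fun _ => 0) (fun _ => 0) = 0 := by
  have : U.along X ψ (fun _ => 0) (fun _ => 0) = fun _ => U.toFun X ψ := by
    funext a; simp [SurfaceEnergy.along]
  rw [SurfaceEnergy.variation, this, deriv_const]

theorem SurfaceEnergy.variation_sum (hdom : (X, ψ) ∈ U.dom) {ι : Type*} (s : Finset ι)
    {x : ι → M → E3} {φ : ι → M → ℝ}
    (hx : ∀ i, ContMDiff I2 𝓘(ℝ, E3) ∞ (x i)) (hφ : ∀ i, ContMDiff I2 𝓘(ℝ, ℝ) ∞ (φ i)) :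
    U.variation X ψ (fun p => ∑ i ∈ s, x i p) (fun p => ∑ i ∈ s, φ i p) =
      ∑ i ∈ s, U.variation X ψ (x i) (φ i) := by
  classical
  induction s using Finset.induction_on with
  | empty => simpa using U.variation_zero
  | insert i s hi ih =>
    simp only [Finset.sum_insert hi]
    rw [U.variation_add hdom (hx i) (hφ i) (contMDiff_finsetSum fun i _ => hx i)
      (contMDiff_finsetSum fun i _ => hφ i), ih]

variable [IsManifold I2 ∞ M]

/-- The rate of change of the energy along a smooth curve of surfaces and scalar fields is the first
variation in the direction of the velocity. -/
theorem SurfaceEnergy.hasDerivAt_curve {δ : ℝ} (hδ : 0 < δ) {X : ℝ → M → E3} {ψ : ℝ → M → ℝ}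
    (hX : IsSmoothFamily (Metric.ball 0 δ) X) (hψ : IsSmoothFamily (Metric.ball 0 δ) ψ)
    (hdom : (X 0, ψ 0) ∈ U.dom) :
    HasDerivAt (fun a => U.toFun (X a) (ψ a))
      (U.variation (X 0) (ψ 0) (fun p => deriv (fun s => X s p) 0)
        (fun p => deriv (fun s => ψ s p) 0)) 0 := by
  obtain ⟨Q, hQ, hXQ, hQ0⟩ := hX.exists_hadamard
  obtain ⟨q, hq, hψq, hq0⟩ := hψ.exists_hadamard
  have hs := U.smooth_of_mem _ _ hdom
  have hmaps : MapsTo (fun s : ℝ × ℝ => s.1) (Metric.ball 0 δ) (Metric.ball 0 δ) := fun s hs => by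
    rw [mem_ball_zero_iff] at hs ⊢
    exact (norm_fst_le s).trans_lt hs
  -- The family `R 0 + b • Q a` contains the curve as its diagonal and is constant for `b = 0`.
  have h := (U.differentiableAt_two_param hδ (X := fun s p => X 0 p + s.2 • Q s.1 p)
    (ψ := fun s p => ψ 0 p + s.2 • q s.1 p)
    ((isSmoothFamily_const hs.1.1).add ((hQ.comp contDiff_fst hmaps).smul contDiff_snd))
    ((isSmoothFamily_const hs.2).add ((hq.comp contDiff_fst hmaps).smul contDiff_snd))
    (by simpa using hdom)).hasFDerivAt
  set D := fderiv ℝ (fun s : ℝ × ℝ => U.toFun (fun p => X 0 p + s.2 • Q s.1 p)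
    (fun p => ψ 0 p + s.2 • q s.1 p)) 0 with hD
  have hcurve : ∀ v : ℝ × ℝ, HasDerivAt (fun a : ℝ => U.toFun
      (fun p => X 0 p + (a * v.2) • Q (a * v.1) p)
      (fun p => ψ 0 p + (a * v.2) • q (a * v.1) p)) (D v) 0 := fun v => by
    have h1 : HasDerivAt (fun a : ℝ => a • v) v 0 := by
      simpa using (hasDerivAt_id (0 : ℝ)).smul_const v
    have h0 : HasFDerivAt (fun s : ℝ × ℝ => U.toFun (fun p => X 0 p + s.2 • Q s.1 p)
      (fun p => ψ 0 p + s.2 • q s.1 p)) D ((0 : ℝ) • v) := by rwa [zero_smul]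
    exact h0.comp_hasDerivAt (0 : ℝ) h1
  have e1 : D (1, 0) = 0 := by
    have := (hcurve (1, 0)).deriv
    simp only [mul_one, mul_zero, zero_smul, add_zero, deriv_const] at this
    exact this.symm
  have e2 : D (0, 1) = U.variation (X 0) (ψ 0) (fun p => deriv (fun s => X s p) 0)
      (fun p => deriv (fun s => ψ s p) 0) := by
    have := (hcurve (0, 1)).deriv
    simp only [mul_one, mul_zero, hQ0, hq0] at this
    exact this.symm
  have e3 := hcurve (1, 1)
  rw [show ((1, 1) : ℝ × ℝ) = (1, 0) + (0, 1) by simp, map_add, e1, e2, zero_add] at e3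
  refine e3.congr_of_eventuallyEq ?_
  filter_upwards [Metric.ball_mem_nhds (0 : ℝ) hδ] with a ha
  have e4 : X a = fun p => X 0 p + a • Q a p := funext fun p => hXQ a ha p
  have e5 : ψ a = fun p => ψ 0 p + a • q a p := funext fun p => hψq a ha p
  simp only [Prod.fst_add, Prod.snd_add, add_zero, zero_add, mul_one]
  rw [← e4, ← e5]

end EnergyDerivative

/-! ### Diffeomorphisms of the half plane close to the identity -/

section HalfPlaneDiffeo

theorem uniqueDiffOn_halfPlane : UniqueDiffOn ℝ (range I2) := I2.uniqueDiffOn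

theorem mem_range_I2 {y : E2} : y ∈ range I2 ↔ 0 ≤ y 0 := by rw [range_I2]; rfl

/-- The retraction of the plane onto the half plane along the zeroth axis. -/
def halfPlaneRetract (y : E2) : E2 := !₂[max (y 0) 0, y 1]

theorem halfPlaneRetract_mem (y : E2) : halfPlaneRetract y ∈ range I2 := by
  rw [mem_range_I2]; simp [halfPlaneRetract]

theorem halfPlaneRetract_of_mem {y : E2} (hy : y ∈ range I2) : halfPlaneRetract y = y := by
  rw [mem_range_I2] at hy
  ext i; fin_cases i <;> simp [halfPlaneRetract, hy]

theorem norm_halfPlaneRetract_sub_le (y z : E2) :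
    ‖halfPlaneRetract y - halfPlaneRetract z‖ ≤ ‖y - z‖ := by
  rw [EuclideanSpace.norm_eq, EuclideanSpace.norm_eq]
  refine Real.sqrt_le_sqrt ?_
  simp only [Fin.sum_univ_two, halfPlaneRetract, PiLp.sub_apply, Real.norm_eq_abs]
  refine add_le_add (pow_le_pow_left₀ (abs_nonneg _) ?_ 2) (by simp)
  simpa using abs_max_sub_max_le_abs (y 0) (z 0) 0

/-- A field on the half plane that is tangent to the boundary and has Lipschitz constant `C`. -/
structure IsTangentLipschitz (C : ℝ) (ζ : E2 → E2) : Prop where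
  nonneg : 0 ≤ C
  lipschitz : ∀ y ∈ range I2, ∀ z ∈ range I2, ‖ζ y - ζ z‖ ≤ C * ‖y - z‖
  tangent : ∀ y : E2, y 0 = 0 → ζ y 0 = 0

variable {C s : ℝ} {ζ : E2 → E2}

theorem IsTangentLipschitz.mapsTo (h : IsTangentLipschitz C ζ) (hs : |s| * C ≤ 1 / 2) {y : E2}
    (hy : y ∈ range I2) : y + s • ζ y ∈ range I2 := by
  -- Compare with the boundary point below `y`, where the field has no normal component.
  have hy0 := mem_range_I2.1 hy
  set z : E2 := !₂[0, y 1] with hz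
  have hz0 : z 0 = 0 := by simp [hz]
  have hzr : z ∈ range I2 := mem_range_I2.2 hz0.ge
  have hyz : ‖y - z‖ = y 0 := by
    rw [EuclideanSpace.norm_eq]
    simp [hz, Fin.sum_univ_two, Real.sqrt_sq hy0]
  have h1 : |ζ y 0| ≤ C * y 0 := by
    have := (PiLp.norm_apply_le (ζ y - ζ z) 0).trans (h.lipschitz y hy z hzr)
    rw [hyz] at this
    simpa [h.tangent z hz0] using this
  rw [mem_range_I2]
  have h2 : |s * ζ y 0| ≤ 1 / 2 * y 0 := by
    rw [abs_mul]
    calc |s| * |ζ y 0| ≤ |s| * (C * y 0) := by gcongr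
      _ = |s| * C * y 0 := by ring
      _ ≤ 1 / 2 * y 0 := by gcongr
  have h3 := (abs_le.1 h2).1
  have : (y + s • ζ y) 0 = y 0 + s * ζ y 0 := rfl
  rw [this]
  linarith

theorem IsTangentLipschitz.norm_sub_le_two_mul (h : IsTangentLipschitz C ζ) (hs : |s| * C ≤ 1 / 2)
    {y z : E2} (hy : y ∈ range I2) (hz : z ∈ range I2) :
    ‖y - z‖ ≤ 2 * ‖(y + s • ζ y) - (z + s • ζ z)‖ := by
  have h1 : ‖s • (ζ y - ζ z)‖ ≤ 1 / 2 * ‖y - z‖ := by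
    rw [norm_smul, Real.norm_eq_abs]
    calc |s| * ‖ζ y - ζ z‖ ≤ |s| * (C * ‖y - z‖) := by gcongr; exact h.lipschitz y hy z hz
      _ = |s| * C * ‖y - z‖ := by ring
      _ ≤ 1 / 2 * ‖y - z‖ := by gcongr
  have h2 : y - z = ((y + s • ζ y) - (z + s • ζ z)) - s • (ζ y - ζ z) := by
    rw [smul_sub]; abel
  have h3 := norm_sub_le ((y + s • ζ y) - (z + s • ζ z)) (s • (ζ y - ζ z))
  rw [← h2] at h3
  linarith

theorem IsTangentLipschitz.injOn (h : IsTangentLipschitz C ζ) (hs : |s| * C ≤ 1 / 2) :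
    InjOn (fun y => y + s • ζ y) (range I2) := fun y hy z hz hyz => by
  have h1 := h.norm_sub_le_two_mul hs hy hz
  simp only at hyz
  rw [hyz, sub_self, norm_zero, mul_zero] at h1
  exact sub_eq_zero.1 (norm_le_zero_iff.1 h1)

/-- Preimages are fixed points of the contraction `y ↦ z - s • ζ (r y)`, with `r` the retraction onto
the half plane; tangency of `ζ` forces the fixed points into the half plane. -/
theorem IsTangentLipschitz.surjOn (h : IsTangentLipschitz C ζ) (hs : |s| * C ≤ 1 / 2) {z : E2}
    (hz : z ∈ range I2) : ∃ y ∈ range I2, y + s • ζ y = z := by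
  have hcontr : ContractingWith (1 / 2 : NNReal) fun y => z - s • ζ (halfPlaneRetract y) := by
    refine ⟨by norm_num [← NNReal.coe_lt_coe], LipschitzWith.of_dist_le_mul fun x y => ?_⟩
    rw [dist_eq_norm, dist_eq_norm]
    have e : (z - s • ζ (halfPlaneRetract x)) - (z - s • ζ (halfPlaneRetract y)) =
        s • (ζ (halfPlaneRetract y) - ζ (halfPlaneRetract x)) := by rw [smul_sub]; abel
    rw [e, norm_smul, Real.norm_eq_abs]
    have hC := h.nonneg
    calc |s| * ‖ζ (halfPlaneRetract y) - ζ (halfPlaneRetract x)‖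
        ≤ |s| * (C * ‖halfPlaneRetract y - halfPlaneRetract x‖) := by
          gcongr
          exact h.lipschitz _ (halfPlaneRetract_mem y) _ (halfPlaneRetract_mem x)
      _ ≤ |s| * (C * ‖y - x‖) := by gcongr; exact norm_halfPlaneRetract_sub_le y x
      _ = |s| * C * ‖x - y‖ := by rw [norm_sub_rev]; ring
      _ ≤ 1 / 2 * ‖x - y‖ := by gcongr
      _ = _ := by norm_num
  set y := hcontr.fixedPoint with hy
  have hfix : z - s • ζ (halfPlaneRetract y) = y := hcontr.fixedPoint_isFixedPt
  have hyr : y ∈ range I2 := by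
    by_contra hcon
    rw [mem_range_I2, not_le] at hcon
    have h1 : halfPlaneRetract y 0 = 0 := by simp [halfPlaneRetract, hcon.le]
    have h2 := congrArg (fun w : E2 => w 0) hfix
    simp only [PiLp.sub_apply, PiLp.smul_apply, h.tangent _ h1, smul_zero, sub_zero] at h2
    rw [mem_range_I2, h2] at hz
    exact absurd hz (not_le.2 hcon)
  refine ⟨y, hyr, ?_⟩
  rw [halfPlaneRetract_of_mem hyr] at hfix
  exact (sub_eq_iff_eq_add.1 hfix).symm

/-- The inverse of a smooth map of the half plane that is close to the identity is smooth, up to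
the boundary. -/
theorem IsTangentLipschitz.contDiffOn_inverse (h : IsTangentLipschitz C ζ) (hs : |s| * C ≤ 1 / 2)
    (hζ : ContDiffOn ℝ ∞ ζ (range I2)) (hC : ∀ y ∈ range I2, ‖fderivWithin ℝ ζ (range I2) y‖ ≤ C)
    {g : E2 → E2} (hg : MapsTo g (range I2) (range I2))
    (hgl : ∀ z ∈ range I2, g z + s • ζ (g z) = z) : ContDiffOn ℝ ∞ g (range I2) := by
  set D : E2 → E2 →L[ℝ] E2 := fun y => ContinuousLinearMap.id ℝ E2 +
    s • fderivWithin ℝ ζ (range I2) y with hD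
  have hDc : ContDiffOn ℝ ∞ D (range I2) :=
    contDiffOn_const.add
      ((hζ.fderivWithin uniqueDiffOn_halfPlane (m := ∞) (by simp)).const_smul s)
  have hDu : ∀ y ∈ range I2, IsUnit (D y) := fun y hy => by
    refine isUnit_of_injective ((injective_iff_map_eq_zero _).2 fun v hv => ?_)
    have h1 : v = -(s • fderivWithin ℝ ζ (range I2) y v) := eq_neg_of_add_eq_zero_left hv
    have h2 : ‖v‖ ≤ 1 / 2 * ‖v‖ := by
      calc ‖v‖ = |s| * ‖fderivWithin ℝ ζ (range I2) y v‖ := by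
            conv_lhs => rw [h1]
            rw [norm_neg, norm_smul, Real.norm_eq_abs]
        _ ≤ |s| * (C * ‖v‖) := by
            gcongr
            exact (ContinuousLinearMap.le_opNorm _ _).trans (by gcongr; exact hC y hy)
        _ = |s| * C * ‖v‖ := by ring
        _ ≤ 1 / 2 * ‖v‖ := by gcongr
    exact norm_le_zero_iff.1 (by linarith)
  have hφ : ∀ y ∈ range I2, HasFDerivWithinAt (fun y => y + s • ζ y) (D y) (range I2) y :=
    fun y hy => (hasFDerivWithinAt_id _ _).add
      ((hζ.differentiableOn (by simp) y hy).hasFDerivWithinAt.const_smul s)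
  have hgc : ContinuousOn g (range I2) := by
    refine LipschitzOnWith.continuousOn (K := 2) (LipschitzOnWith.of_dist_le_mul fun x hx y hy => ?_)
    have h1 := h.norm_sub_le_two_mul hs (hg hx) (hg hy)
    rw [hgl x hx, hgl y hy] at h1
    rw [dist_eq_norm, dist_eq_norm]
    exact h1
  have hgd : ∀ z ∈ range I2, HasFDerivWithinAt g (Ring.inverse (D (g z))) (range I2) z :=
    fun z hz => by
      obtain ⟨u, hu⟩ := hDu (g z) (hg hz)
      set L : E2 ≃L[ℝ] E2 := ContinuousLinearEquiv.unitsEquiv ℝ E2 u with hL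
      have hLD : (L : E2 →L[ℝ] E2) = D (g z) := by rw [← hu]; rfl
      have h1 := hφ (g z) (hg hz)
      rw [← hLD] at h1
      have h2 := h1.of_local_left_inverse
        (tendsto_nhdsWithin_iff.2 ⟨hgc z hz, by
          filter_upwards [self_mem_nhdsWithin] with x hx using hg hx⟩) hz (by
          filter_upwards [self_mem_nhdsWithin] with x hx using hgl x hx)
      have h3 : Ring.inverse (D (g z)) = (L.symm : E2 →L[ℝ] E2) := by
        rw [← hu, Ring.inverse_unit]; rfl
      rwa [h3]
  refine contDiffOn_infty.2 fun n => ?_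
  induction n with
  | zero => exact contDiffOn_zero.2 hgc
  | succ n ih =>
    have hcast : ((n + 1 : ℕ) : ℕ∞ω) = n + 1 := by push_cast; rfl
    rw [hcast, contDiffOn_succ_iff_hasFDerivWithinAt_of_uniqueDiffOn uniqueDiffOn_halfPlane]
    refine ⟨fun h => by simp at h, _, fun z hz => ?_, hgd⟩
    obtain ⟨u, hu⟩ := hDu (g z) (hg hz)
    have h1 : ContDiffAt ℝ n (Ring.inverse : (E2 →L[ℝ] E2) → _) (D (g z)) := by
      rw [← hu]; exact contDiffAt_ringInverse ℝ u
    exact h1.comp_contDiffWithinAt z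
      ((((contDiffOn_infty.1 hDc n).comp ih hg) z hz))

/-- A smooth compactly supported field that is tangent to the boundary is Lipschitz. -/
theorem exists_isTangentLipschitz (hζ : ContDiffOn ℝ ∞ ζ (range I2)) {K : Set E2}
    (hK : IsCompact K) (hKr : K ⊆ range I2) (h0 : ∀ y ∉ K, ζ y = 0)
    (htan : ∀ y : E2, y 0 = 0 → ζ y 0 = 0) :
    ∃ C, IsTangentLipschitz C ζ ∧ ∀ y ∈ range I2, ‖fderivWithin ℝ ζ (range I2) y‖ ≤ C := by
  have hc : ContinuousOn (fderivWithin ℝ ζ (range I2)) (range I2) :=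
    hζ.continuousOn_fderivWithin uniqueDiffOn_halfPlane (by simp)
  obtain ⟨C, hC⟩ := hK.exists_bound_of_continuousOn (hc.mono hKr)
  have hbound : ∀ y ∈ range I2, ‖fderivWithin ℝ ζ (range I2) y‖ ≤ max C 0 := fun y _ => by
    by_cases hyK : y ∈ K
    · exact (hC y hyK).trans (le_max_left _ _)
    · have : ζ =ᶠ[𝓝 y] fun _ => (0 : E2) := by
        filter_upwards [hK.isClosed.isOpen_compl.mem_nhds hyK] with z hz using h0 z hz
      rw [Filter.EventuallyEq.fderivWithin_eq (this.filter_mono nhdsWithin_le_nhds) this.eq_of_nhds]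
      simp
  exact ⟨max C 0, ⟨le_max_right _ _, fun y hy z hz =>
    I2.convex_range.norm_image_sub_le_of_norm_fderivWithin_le
      (hζ.differentiableOn (by simp)) hbound hz hy, htan⟩, hbound⟩

end HalfPlaneDiffeo

/-! ### Diffeomorphisms of the surface supported in a chart -/

section ChartDiffeo

variable {M : Type*} [TopologicalSpace M] [ChartedSpace (EuclideanHalfSpace 2) M]

open Classical in
/-- The map of the surface that is `G` in the chart around `c`, and the identity outside. -/
def chartMap (c : M) (G : E2 → E2) (p : M) : M :=
  if p ∈ (extChartAt I2 c).source then (extChartAt I2 c).symm (G (extChartAt I2 c p)) else p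

theorem chartMap_of_mem {c p : M} (G : E2 → E2) (hp : p ∈ (extChartAt I2 c).source) :
    chartMap c G p = (extChartAt I2 c).symm (G (extChartAt I2 c p)) := if_pos hp

theorem chartMap_of_notMem {c p : M} (G : E2 → E2) (hp : p ∉ (extChartAt I2 c).source) :
    chartMap c G p = p := if_neg hp

theorem chartMap_chartMap {c : M} {G G' : E2 → E2}
    (hG : MapsTo G (extChartAt I2 c).target (extChartAt I2 c).target)
    (h : ∀ y ∈ (extChartAt I2 c).target, G' (G y) = y) (p : M) :
    chartMap c G' (chartMap c G p) = p := by
  set e := extChartAt I2 c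
  by_cases hp : p ∈ e.source
  · have hy := e.map_source hp
    rw [chartMap_of_mem G hp, chartMap_of_mem G' (e.map_target (hG hy)), e.right_inv (hG hy),
      h _ hy, e.left_inv hp]
  · rw [chartMap_of_notMem G hp, chartMap_of_notMem G' hp]

variable [IsManifold I2 ∞ M] [T2Space M]

/-- Maps that are the identity outside a compact part of a chart extend smoothly to the surface. -/
theorem contMDiff_chartMap {P : Type*} [NormedAddCommGroup P] [NormedSpace ℝ P] {c : M}
    {G : P → E2 → E2}
    (hG : ContDiffOn ℝ ∞ (fun z : P × E2 => G z.1 z.2) (univ ×ˢ (extChartAt I2 c).target))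
    (hmaps : ∀ s, MapsTo (G s) (extChartAt I2 c).target (extChartAt I2 c).target)
    {K : Set E2} (hK : IsCompact K) (hKt : K ⊆ (extChartAt I2 c).target)
    (hid : ∀ s, ∀ y ∈ (extChartAt I2 c).target, y ∉ K → G s y = y) :
    ContMDiff (𝓘(ℝ, P).prod I2) I2 ∞ (fun q : P × M => chartMap c (G q.1) q.2) := by
  set e := extChartAt I2 c with he
  rintro ⟨s, p⟩
  by_cases hp : p ∈ e.source
  · rw [← contMDiffOn_prod_self_iff] at hG
    have hsrc : e.source = (chartAt (EuclideanHalfSpace 2) c).source := extChartAt_source (I := I2) c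
    have h1 : ContMDiffOn (𝓘(ℝ, P).prod I2) (𝓘(ℝ, P).prod 𝓘(ℝ, E2)) ∞
        (fun q : P × M => (q.1, e q.2)) (univ ×ˢ e.source) :=
      contMDiffOn_fst.prodMk ((contMDiffOn_extChartAt (I := I2)).comp contMDiffOn_snd
        fun z hz => hsrc ▸ hz.2)
    have h2 := hG.comp h1 fun q hq => ⟨mem_univ _, e.map_source hq.2⟩
    have h3 := (contMDiffOn_extChartAt_symm (I := I2) (n := ∞) c).comp h2
      fun q hq => hmaps q.1 (e.map_source hq.2)
    have hopen : IsOpen ((univ : Set P) ×ˢ e.source) :=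
      isOpen_univ.prod (isOpen_extChartAt_source c)
    refine ((h3 (s, p) ⟨mem_univ _, hp⟩).contMDiffAt
      (hopen.mem_nhds ⟨mem_univ _, hp⟩)).congr_of_eventuallyEq ?_
    filter_upwards [hopen.mem_nhds (show (s, p) ∈ _ from ⟨mem_univ _, hp⟩)] with q hq
    exact chartMap_of_mem _ hq.2
  · have hKc : IsClosed (e.symm '' K) :=
      (hK.image_of_continuousOn ((continuousOn_extChartAt_symm c).mono hKt)).isClosed
    have hpK : p ∉ e.symm '' K := by
      rintro ⟨y, hy, rfl⟩
      exact hp (e.map_target (hKt hy))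
    have hopen : IsOpen ((univ : Set P) ×ˢ (e.symm '' K)ᶜ) := isOpen_univ.prod hKc.isOpen_compl
    refine (contMDiffAt_snd (I := 𝓘(ℝ, P)) (J := I2)).congr_of_eventuallyEq ?_
    filter_upwards [hopen.mem_nhds (show (s, p) ∈ _ from ⟨mem_univ _, hpK⟩)] with q hq
    by_cases hqs : q.2 ∈ e.source
    · rw [chartMap_of_mem _ hqs, hid q.1 _ (e.map_source hqs), e.left_inv hqs]
      exact fun hcon => hq.2 ⟨_, hcon, e.left_inv hqs⟩
    · exact chartMap_of_notMem _ hqs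

/-- A smooth field in coordinates, compactly supported in a chart and tangent to the boundary, is
the velocity of a smooth curve of diffeomorphisms of the surface isotopic to the identity. -/
theorem exists_diffeomorph_curve {c : M} {ζ : E2 → E2} (hζ : ContDiffOn ℝ ∞ ζ (range I2))
    {K : Set E2} (hK : IsCompact K) (hKt : K ⊆ (extChartAt I2 c).target) (h0 : ∀ y ∉ K, ζ y = 0)
    (htan : ∀ y : E2, y 0 = 0 → ζ y 0 = 0) :
    ∃ (κ : ℝ → ℝ) (Φ : ℝ → (M ≃ₘ^∞⟮I2, I2⟯ M)), κ 0 = 0 ∧ HasDerivAt κ 1 0 ∧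
      ContMDiff (𝓘(ℝ, ℝ).prod I2) I2 ∞ (fun q : ℝ × M => Φ q.1 q.2) ∧
      (∀ τ, IsIsotopicToId (Φ τ)) ∧ (∀ τ, MapsTo (fun y => y + κ τ • ζ y) (range I2) (range I2)) ∧
      ∀ τ p, Φ τ p = chartMap c (fun y => y + κ τ • ζ y) p := by
  set e := extChartAt I2 c with he
  have htr : e.target ⊆ range I2 := extChartAt_target_subset_range c
  obtain ⟨C, hL, hC⟩ := exists_isTangentLipschitz hζ hK (hKt.trans htr) h0 htan
  have hC1 : 0 < C + 1 := by linarith [hL.nonneg]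
  -- The bounded amplitude makes the maps close to the identity for all parameters.
  set δ : ℝ := 1 / (2 * (C + 1)) with hδ
  have hδ0 : 0 < δ := by positivity
  set κ : ℝ → ℝ := fun τ => δ * Real.sin (τ / δ) with hκ
  have hκs : ContDiff ℝ ∞ κ := contDiff_const.mul (Real.contDiff_sin.comp (contDiff_id.div_const δ))
  have hκ0 : κ 0 = 0 := by simp [hκ]
  have hκb : ∀ τ, |κ τ| * C ≤ 1 / 2 := fun τ => by
    have h1 : |κ τ| ≤ δ := by
      rw [hκ, abs_mul, abs_of_pos hδ0]
      exact mul_le_of_le_one_right hδ0.le (Real.abs_sin_le_one _)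
    calc |κ τ| * C ≤ δ * (C + 1) := by
          gcongr
          · exact hL.nonneg
          · linarith
      _ = 1 / 2 := by rw [hδ]; field_simp
  have hκd : HasDerivAt κ 1 0 := by
    have h1 : HasDerivAt (fun τ : ℝ => τ / δ) (1 / δ) 0 := (hasDerivAt_id 0).div_const δ
    have h2 := ((Real.hasDerivAt_sin _).comp (0 : ℝ) h1).const_mul δ
    refine h2.congr_deriv ?_
    simp [hδ0.ne']
  set G : ℝ → E2 → E2 := fun τ y => y + κ τ • ζ y with hG
  have hsurj := fun τ z (hz : z ∈ range I2) => hL.surjOn (hκb τ) hz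
  have hchoice : ∀ τ, ∃ g : E2 → E2, ∀ z ∈ range I2, g z ∈ range I2 ∧ g z + κ τ • ζ (g z) = z :=
    fun τ => by
      classical
      refine ⟨fun z => if hz : z ∈ range I2 then (hsurj τ z hz).choose else 0, fun z hz => ?_⟩
      simp only [dif_pos hz]
      exact (hsurj τ z hz).choose_spec
  choose g hg using hchoice
  have hGinj := fun τ => hL.injOn (hκb τ)
  have hGid : ∀ τ, ∀ y ∈ e.target, y ∉ K → G τ y = y := fun τ y _ hyK => by
    simp [hG, h0 y hyK]
  have hGmaps : ∀ τ, MapsTo (G τ) e.target e.target := fun τ y hy => by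
    by_cases hyK : y ∈ K
    · refine hKt (by_contra fun hcon => hcon ?_)
      have h1 : G τ (G τ y) = G τ y := by
        change G τ y + κ τ • ζ (G τ y) = _
        rw [h0 _ hcon, smul_zero, add_zero]
      have h2 : G τ y = y := hGinj τ (hL.mapsTo (hκb τ) (htr hy)) (htr hy) h1
      rwa [h2]
    · rwa [hGid τ y hy hyK]
  have hgid : ∀ τ, ∀ z ∈ e.target, z ∉ K → g τ z = z := fun τ z hz hzK => by
    refine hGinj τ (hg τ z (htr hz)).1 (htr hz) ?_
    simp only [(hg τ z (htr hz)).2, h0 z hzK, smul_zero, add_zero]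
  have hgmaps : ∀ τ, MapsTo (g τ) e.target e.target := fun τ z hz => by
    by_cases hzK : z ∈ K
    · refine hKt (by_contra fun hcon => hcon ?_)
      have h1 := (hg τ z (htr hz)).2
      rw [h0 _ hcon, smul_zero, add_zero] at h1
      rwa [h1]
    · rwa [hgid τ z hz hzK]
  have hgG : ∀ τ, ∀ y ∈ e.target, g τ (G τ y) = y := fun τ y hy =>
    hGinj τ (hg τ _ (htr (hGmaps τ hy))).1 (htr hy) (hg τ _ (htr (hGmaps τ hy))).2
  have hGg : ∀ τ, ∀ z ∈ e.target, G τ (g τ z) = z := fun τ z hz => (hg τ z (htr hz)).2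
  have hGsmooth : ContDiffOn ℝ ∞ (fun z : ℝ × E2 => G z.1 z.2) (univ ×ˢ e.target) :=
    contDiffOn_snd.add ((hκs.comp contDiff_fst).contDiffOn.smul
      (hζ.comp contDiffOn_snd fun z hz => htr hz.2))
  have hgsmooth : ∀ τ, ContDiffOn ℝ ∞ (fun z : ℝ × E2 => g τ z.2) (univ ×ˢ e.target) := fun τ =>
    (hL.contDiffOn_inverse (hκb τ) hζ hC (fun z hz => (hg τ z hz).1) fun z hz =>
      (hg τ z hz).2).comp contDiffOn_snd fun z hz => htr hz.2
  have hjoint := contMDiff_chartMap hGsmooth hGmaps hK hKt hGid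
  have hinv : ∀ τ, ContMDiff I2 I2 ∞ (chartMap c (g τ)) := fun τ =>
    (contMDiff_chartMap (P := ℝ) (G := fun _ => g τ) (hgsmooth τ) (fun _ => hgmaps τ) hK hKt
      (fun _ => hgid τ)).comp (contMDiff_const.prodMk contMDiff_id : ContMDiff I2
        (𝓘(ℝ, ℝ).prod I2) ∞ fun p : M => ((0 : ℝ), p))
  have hfun : ∀ τ, ContMDiff I2 I2 ∞ (chartMap c (G τ)) := fun τ =>
    hjoint.comp (contMDiff_const.prodMk contMDiff_id : ContMDiff I2
        (𝓘(ℝ, ℝ).prod I2) ∞ fun p : M => (τ, p))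
  let Φ : ℝ → (M ≃ₘ^∞⟮I2, I2⟯ M) := fun τ =>
    { toFun := chartMap c (G τ)
      invFun := chartMap c (g τ)
      left_inv := chartMap_chartMap (hGmaps τ) (hgG τ)
      right_inv := chartMap_chartMap (hgmaps τ) (hGg τ)
      contMDiff_toFun := hfun τ
      contMDiff_invFun := hinv τ }
  have hΦ : ∀ τ p, Φ τ p = chartMap c (G τ) p := fun _ _ => rfl
  refine ⟨κ, Φ, hκ0, hκd, hjoint, fun τ => ⟨fun a => Φ (τ * a), ?_, fun p => ?_, fun p => ?_⟩,
    fun τ y hy => hL.mapsTo (hκb τ) hy, hΦ⟩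
  · exact hjoint.comp (f := fun q : ℝ × M => (τ * q.1, q.2))
      (((contDiff_const.mul contDiff_id : ContDiff ℝ ∞ fun a : ℝ => τ * a).contMDiff.comp
        contMDiff_fst).prodMk contMDiff_snd)
  · rw [hΦ, mul_zero]
    by_cases hp : p ∈ e.source
    · rw [chartMap_of_mem _ hp]
      simp only [hG, hκ0, zero_smul, add_zero]
      exact e.left_inv hp
    · exact chartMap_of_notMem _ hp
  · change Φ (τ * 1) p = Φ τ p
    rw [mul_one]

end ChartDiffeo

/-! ### Invariance of the energy under tangential variations -/

section TangentialVariation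

variable {M : Type*} [TopologicalSpace M] [ChartedSpace (EuclideanHalfSpace 2) M]
  [IsManifold I2 ∞ M] [T2Space M] [CompactSpace M]

/-- A tangential variation supported in a chart is the velocity of a reparameterization, so it does
not change the energy. -/
theorem SurfaceEnergy.variation_tangential_of_chart (U : SurfaceEnergy M) {X : M → E3} {ψ : M → ℝ}
    (hdom : (X, ψ) ∈ U.dom) {w : M → E3} (hw : ContMDiff I2 𝓘(ℝ, E3) ∞ w)
    (htan : ∀ p, ∃ v, differential X p v = w p) (hflux : NoBoundaryFlux X w) {c : M}
    (hc : tsupport w ⊆ (extChartAt I2 c).source) :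
    U.variation X ψ w (fun p => inner ℝ (surfaceGrad X ψ p) (w p)) = 0 := by
  have hX := (U.smooth_of_mem X ψ hdom).1
  have hψ := (U.smooth_of_mem X ψ hdom).2
  set e := extChartAt I2 c with he
  set S := e.target with hS
  have htr : S ⊆ range I2 := extChartAt_target_subset_range c
  set K : Set E2 := e '' tsupport w with hKdef
  have hK : IsCompact K := (isClosed_tsupport w).isCompact.image_of_continuousOn
    ((continuousOn_extChartAt c).mono hc)
  have hKS : K ⊆ S := by
    rintro _ ⟨p, hp, rfl⟩
    exact e.map_source (hc hp)
  have hoff : ∀ y ∈ S, y ∉ K → w (e.symm y) = 0 := fun y hy hyK =>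
    image_eq_zero_of_notMem_tsupport fun hcon => hyK ⟨_, hcon, e.right_inv hy⟩
  set ζ₀ : E2 → E2 := fun y => pinv (chartDeriv c X y) (w (e.symm y)) with hζ₀
  have hζ₀s : ContDiffOn ℝ ∞ ζ₀ S :=
    (contDiffOn_pinv_chartDeriv (m := ⊤) hX c).clm_apply (contDiffOn_chart (n := ⊤) hw c)
  have hζ₀0 : ∀ y ∈ S, y ∉ K → ζ₀ y = 0 := fun y hy hyK => by
    simp only [hζ₀, hoff y hy hyK, map_zero]
  have hwζ : ∀ y ∈ S, chartDeriv c X y (ζ₀ y) = w (e.symm y) := fun y hy => by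
    have hps := e.map_target hy
    obtain ⟨v, hv⟩ := htan (e.symm y)
    rw [differential_eq hps (hX.1.mdifferentiable (by simp) _), e.right_inv hy] at hv
    simp only [hζ₀]
    rw [← hv, ContinuousLinearMap.comp_apply, pinv_apply_apply (injective_chartDeriv' hX hy)]
  set ζ : E2 → E2 := S.indicator ζ₀ with hζ
  have hζs : ContDiffOn ℝ ∞ ζ (range I2) := contDiffOn_indicator_target c hK hζ₀s hζ₀0 hKS
  have hζ0 : ∀ y ∉ K, ζ y = 0 := fun y hyK => by
    by_cases hy : y ∈ S
    · rw [hζ, indicator_of_mem hy, hζ₀0 y hy hyK]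
    · rw [hζ, indicator_of_notMem hy]
  have hζt : ∀ y : E2, y 0 = 0 → ζ y 0 = 0 := fun y hy0 => by
    by_cases hy : y ∈ S
    · rw [hζ, indicator_of_mem hy]
      refine coord_eq_zero_of_noBoundaryFlux hX hflux (e.map_target hy) ?_ (v := ζ₀ y) ?_
      · rw [← he, e.right_inv hy]; exact hy0
      · rw [← he, e.right_inv hy]; exact hwζ y hy
    · rw [hζ, indicator_of_notMem hy]; rfl
  obtain ⟨κ, Φ, hκ0, hκd, hΦs, hΦi, hΦr, hΦ⟩ := exists_diffeomorph_curve hζs hK hKS hζ0 hζt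
  have hΦ0 : ∀ p, Φ 0 p = p := fun p => by
    rw [hΦ, hκ0]
    by_cases hp : p ∈ e.source
    · rw [chartMap_of_mem _ hp]
      simp only [zero_smul, add_zero]
      exact e.left_inv hp
    · exact chartMap_of_notMem _ hp
  -- the velocity of a field that is carried along with the diffeomorphisms
  have hvel : ∀ {F : Type} [NormedAddCommGroup F] [NormedSpace ℝ F] {R : M → F},
      ContMDiff I2 𝓘(ℝ, F) ∞ R → ∀ p, HasDerivAt (fun τ => R (Φ τ p))
        (surfaceDeriv X R p (w p)) 0 := fun {F _ _ R} hR p => by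
    simp only [hΦ]
    by_cases hp : p ∈ e.source
    · have hy := e.map_source hp
      simp only [chartMap_of_mem _ hp]
      rw [surfaceDeriv_eq hX hp (hR.mdifferentiable (by simp) p)]
      have h1 := (mdifferentiableWithinAt_chart hp
        (hR.mdifferentiable (by simp) p)).hasFDerivWithinAt
      have h2 : HasDerivWithinAt (fun τ : ℝ => e p + κ τ • ζ (e p)) (ζ (e p)) univ 0 := by
        have := (hκd.smul_const (ζ (e p))).const_add (e p)
        rw [one_smul] at this
        exact this.hasDerivWithinAt
      have h1' : HasFDerivWithinAt (R ∘ e.symm) (chartDeriv c R (e p)) (range I2)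
          (e p + κ 0 • ζ (e p)) := by
        rw [hκ0, zero_smul, add_zero]; exact h1
      have h3 := h1'.comp_hasDerivWithinAt (0 : ℝ) h2 fun τ _ => hΦr τ (htr hy)
      rw [hasDerivWithinAt_univ] at h3
      refine h3.congr_deriv ?_
      rw [hζ, indicator_of_mem hy]
      simp only [hζ₀, e.left_inv hp]
      rfl
    · simp only [chartMap_of_notMem _ hp]
      have : w p = 0 := image_eq_zero_of_notMem_tsupport fun h => hp (hc h)
      rw [this, map_zero]
      exact hasDerivAt_const _ _
  have hfam : ∀ {F : Type} [NormedAddCommGroup F] [NormedSpace ℝ F] {R : M → F},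
      ContMDiff I2 𝓘(ℝ, F) ∞ R → IsSmoothFamily (Metric.ball (0 : ℝ) 1) fun τ p => R (Φ τ p) :=
    fun {F _ _ R} hR => (hR.comp hΦs).contMDiffOn
  have hX0 : (fun p => X (Φ 0 p)) = X := funext fun p => by rw [hΦ0]
  have hψ0 : (fun p => ψ (Φ 0 p)) = ψ := funext fun p => by rw [hΦ0]
  have hmain := U.hasDerivAt_curve one_pos (hfam hX.1) (hfam hψ) (by rw [hX0, hψ0]; exact hdom)
  rw [hX0, hψ0] at hmain
  have hXd : (fun p => deriv (fun τ => X (Φ τ p)) 0) = w := funext fun p => by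
    rw [(hvel hX.1 p).deriv]
    obtain ⟨v, hv⟩ := htan p
    change differential X p (pinv (differential X p) (w p)) = w p
    rw [← hv, pinv_apply_apply (hX.2 p)]
  have hψd : (fun p => deriv (fun τ => ψ (Φ τ p)) 0) =
      fun p => inner ℝ (surfaceGrad X ψ p) (w p) := funext fun p => by
    rw [(hvel hψ p).deriv, inner_surfaceGrad]
  rw [hXd, hψd] at hmain
  -- the energy is constant along the curve
  have hconst : (fun τ => U.toFun (fun p => X (Φ τ p)) (fun p => ψ (Φ τ p))) =
      fun _ => U.toFun X ψ := funext fun τ => (U.reparam (Φ τ) (hΦi τ) X ψ hdom).2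
  rw [hconst] at hmain
  exact hmain.unique (hasDerivAt_const _ _)

/-- Tangential variations that preserve the boundary do not change the energy. -/
theorem SurfaceEnergy.variation_tangential (U : SurfaceEnergy M) {X : M → E3} {ψ : M → ℝ}
    (hdom : (X, ψ) ∈ U.dom) {w : M → E3} (hw : ContMDiff I2 𝓘(ℝ, E3) ∞ w)
    (htan : ∀ p, ∃ v, differential X p v = w p) (hflux : NoBoundaryFlux X w) :
    U.variation X ψ w (fun p => inner ℝ (surfaceGrad X ψ p) (w p)) = 0 := by
  obtain ⟨n, c, χ, hχ, hχc, hsum⟩ := exists_chart_partition M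
  have hX := (U.smooth_of_mem X ψ hdom).1
  have hψ := (U.smooth_of_mem X ψ hdom).2
  have hpiece : ∀ i, ContMDiff I2 𝓘(ℝ, E3) ∞ (fun p => χ i p • w p) := fun i => (hχ i).smul hw
  have hpieceψ : ∀ i, ContMDiff I2 𝓘(ℝ, ℝ) ∞
      (fun p => inner ℝ (surfaceGrad X ψ p) (χ i p • w p)) := fun i =>
    (contDiff_inner (𝕜 := ℝ) (E := E3)).contMDiff.comp
      ((contMDiff_surfaceGrad (m := ⊤) (n := ⊤) le_top hX hψ).prodMk_space (hpiece i))
  have e1 : w = fun p => ∑ i, χ i p • w p := funext fun p => by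
    rw [← Finset.sum_smul, hsum, one_smul]
  have e2 : (fun p => inner ℝ (surfaceGrad X ψ p) (w p)) =
      fun p => ∑ i, inner ℝ (surfaceGrad X ψ p) (χ i p • w p) := funext fun p => by
    rw [← inner_sum, ← Finset.sum_smul, hsum, one_smul]
  have e3 := U.variation_sum hdom Finset.univ hpiece hpieceψ
  rw [← e1, ← e2] at e3
  rw [e3]
  refine Finset.sum_eq_zero fun i _ => U.variation_tangential_of_chart hdom (hpiece i)
    (fun p => ?_) (fun p hp m hm => ?_) (c := c i) ?_
  · obtain ⟨v, hv⟩ := htan p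
    exact ⟨χ i p • v, by rw [map_smul, hv]⟩
  · rw [inner_smul_left, hflux p hp m hm, mul_zero]
  · exact (tsupport_smul_subset_left (χ i) w).trans (hχc i)

end TangentialVariation

/-! ### Energy dissipation -/

section Dissipation

variable {M : Type*} [TopologicalSpace M] [ChartedSpace (EuclideanHalfSpace 2) M]

/-- The rate of the energy along a smooth evolution is the first variation in the direction of the
velocity. -/
theorem SurfaceEnergy.hasDerivAt_evolution [IsManifold I2 ∞ M] [CompactSpace M]
    (U : SurfaceEnergy M) {T : Set ℝ} (hT : IsOpen T)
    {X : ℝ → M → E3} {ψ : ℝ → M → ℝ} (hX : IsSmoothFamily T X) (hψ : IsSmoothFamily T ψ) {t : ℝ}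
    (ht : t ∈ T) (hdom : (X t, ψ t) ∈ U.dom) :
    HasDerivAt (fun s => U.toFun (X s) (ψ s))
      (U.variation (X t) (ψ t) (observerVelocity X t) (fun p => deriv (fun s => ψ s p) t)) t := by
  obtain ⟨δ, hδ, hball⟩ := Metric.isOpen_iff.1 hT t ht
  have hmaps : MapsTo (fun a : ℝ => t + a) (Metric.ball 0 δ) T := fun a ha =>
    hball (by simpa using ha)
  have hg : ContDiff ℝ ∞ fun a : ℝ => t + a := contDiff_const.add contDiff_id
  have h := U.hasDerivAt_curve hδ (hX.comp hg hmaps) (hψ.comp hg hmaps)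
    (by simpa only [add_zero] using hdom)
  have e1 : (fun p => deriv (fun a => X (t + a) p) 0) = observerVelocity X t := funext fun p => by
    rw [deriv_comp_const_add (fun s => X s p), add_zero, observerVelocity]
  have e2 : (fun p => deriv (fun a => ψ (t + a) p) 0) = fun p => deriv (fun s => ψ s p) t :=
    funext fun p => by rw [deriv_comp_const_add (fun s => ψ s p), add_zero]
  rw [e1, e2] at h
  simp only [add_zero] at h
  have h' := HasDerivAt.comp_sub_const (f := fun a => U.toFun (X (t + a)) (ψ (t + a))) t t
    (by rwa [sub_self])
  simpa only [add_sub_cancel] using h'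

variable [CompactSpace M] [MeasurableSpace M]

theorem IsScalarFunctionalDeriv.variation_eq {U : SurfaceEnergy M} {X : M → E3} {ψ G : M → ℝ}
    (hG : IsScalarFunctionalDeriv U X ψ G) {φ : M → ℝ} (hφ : ContMDiff I2 𝓘(ℝ, ℝ) ∞ φ) :
    U.variation X ψ (fun _ => 0) φ = ∫ p, G p * φ p ∂(areaMeasure X) := by
  rw [← (hG.2 φ hφ).deriv, SurfaceEnergy.variation]
  congr 1
  funext ε
  simp only [SurfaceEnergy.along, smul_zero, add_zero, smul_eq_mul]

theorem IsSpatialFunctionalDeriv.variation_eq {U : SurfaceEnergy M} {X ν : M → E3} {ψ : M → ℝ}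
    {D : M → E3} (hD : IsSpatialFunctionalDeriv U X ν ψ D) {w : M → ℝ}
    (hw : ContMDiff I2 𝓘(ℝ, ℝ) ∞ w) :
    U.variation X ψ (fun p => w p • ν p) (normalTruesdellGauge X ν ψ w) =
      ∫ p, inner ℝ (ν p) (D p) * w p ∂(areaMeasure X) := by
  rw [← (hD.2 w hw).deriv, SurfaceEnergy.variation]
  congr 1
  funext ε
  simp only [SurfaceEnergy.along, mul_smul, smul_eq_mul]

/-- The rate of the energy of a moving surface is the sum of the work of the normal motion and of
the change of the scalar.  The tangential part of the observer velocity only relabels the points of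
the surface and does not contribute. -/
theorem IsMovingSurface.hasDerivAt_energy [IsManifold I2 ∞ M] [T2Space M]
    {T : Set ℝ} {X ν : ℝ → M → E3} (h : IsMovingSurface T X ν) (hT : IsOpen T)
    (U : SurfaceEnergy M) {ψ : ℝ → M → ℝ} (hψ : IsSmoothFamily T ψ) {t : ℝ} (ht : t ∈ T)
    (hdom : (X t, ψ t) ∈ U.dom) {D : M → E3} {G : M → ℝ}
    (hD : IsSpatialFunctionalDeriv U (X t) (ν t) (ψ t) D)
    (hG : IsScalarFunctionalDeriv U (X t) (ψ t) G) :
    HasDerivAt (fun s => U.toFun (X s) (ψ s))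
      ((∫ p, inner ℝ (ν t p) (D p) * normalVelocity X ν t p ∂(areaMeasure (X t))) +
        ∫ p, G p * normalTruesdellRate X ν ψ t p ∂(areaMeasure (X t))) t := by
  refine (U.hasDerivAt_evolution hT h.smooth hψ ht hdom).congr_deriv ?_
  have hψt := hψ.contMDiff ht
  have hv := h.contMDiff_tangentialObserverVelocity hT ht
  have hw := h.contMDiff_normalVelocity hT ht
  have hn := h.smooth_normal.contMDiff ht
  have hr := h.contMDiff_normalTruesdellRate hT hψ ht
  have hvψ : ContMDiff I2 𝓘(ℝ, ℝ) ∞ fun p =>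
      inner ℝ (surfaceGrad (X t) (ψ t) p) (tangentialObserverVelocity X ν t p) :=
    (contDiff_inner (𝕜 := ℝ) (E := E3)).contMDiff.comp
      ((contMDiff_surfaceGrad (m := ⊤) (n := ⊤) le_top (h.immersion t ht) hψt).prodMk_space hv)
  have hgauge : ContMDiff I2 𝓘(ℝ, ℝ) ∞
      (normalTruesdellGauge (X t) (ν t) (ψ t) (normalVelocity X ν t)) :=
    (hψt.mul hw).mul (h.contMDiff_meanCurvature ht)
  have hwn : ContMDiff I2 𝓘(ℝ, E3) ∞ fun p => normalVelocity X ν t p • ν t p := hw.smul hn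
  have e1 : observerVelocity X t = fun p => tangentialObserverVelocity X ν t p +
      (normalVelocity X ν t p • ν t p + 0) := by
    funext p; rw [tangentialObserverVelocity, add_zero, sub_add_cancel]
  have e2 : (fun p => deriv (fun s => ψ s p) t) = fun p =>
      inner ℝ (surfaceGrad (X t) (ψ t) p) (tangentialObserverVelocity X ν t p) +
        (normalTruesdellGauge (X t) (ν t) (ψ t) (normalVelocity X ν t) p +
          normalTruesdellRate X ν ψ t p) := by
    funext p
    rw [normalTruesdellRate, normalTruesdellGauge, real_inner_comm]
    ring
  rw [e2]
  refine (congrArg (fun x => U.variation (X t) (ψ t) x _) e1).trans ?_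
  have h0 : ContMDiff I2 𝓘(ℝ, E3) ∞ fun _ : M => (0 : E3) := contMDiff_const
  refine (U.variation_add hdom hv hvψ (hwn.add h0) (hgauge.add hr)).trans ?_
  refine (congrArg _ (U.variation_add hdom hwn hgauge h0 hr)).trans ?_
  rw [U.variation_tangential hdom hv (h.exists_differential_eq ht) (h.boundary t ht),
    hD.variation_eq hw, hG.variation_eq hr, zero_add]

end Dissipation

end

theorem proposition4
    {M : Type*} [TopologicalSpace M] [T2Space M] [CompactSpace M]
    [ChartedSpace (EuclideanHalfSpace 2) M] [IsManifold I2 ∞ M]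
    [MeasurableSpace M] [BorelSpace M]
    (U : SurfaceEnergy M) (MX Mψ : ℝ) (hMX : 0 < MX) (hMψ : 0 < Mψ)
    (T : Set ℝ) (hT : IsOpen T)
    (X ν : ℝ → M → E3) (ψ : ℝ → M → ℝ) (DX : ℝ → M → E3) (Dψ : ℝ → M → ℝ)
    (hflow : IsNormalGradientFlow U MX Mψ T X ν ψ DX Dψ) :
    ∀ t ∈ T,
      HasDerivAt (fun s => ∫ p, ψ s p ∂(areaMeasure (X s))) 0 t ∧
      HasDerivAt (fun s => U.toFun (X s) (ψ s))
        (-(MX⁻¹ * (∫ p, (inner ℝ (ν t p) (DX t p)) ^ 2 ∂(areaMeasure (X t))) +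
            Mψ⁻¹ * (∫ p, ‖surfaceGrad (X t) (Dψ t) p‖ ^ 2 ∂(areaMeasure (X t))))) t ∧
      -(MX⁻¹ * (∫ p, (inner ℝ (ν t p) (DX t p)) ^ 2 ∂(areaMeasure (X t))) +
            Mψ⁻¹ * (∫ p, ‖surfaceGrad (X t) (Dψ t) p‖ ^ 2 ∂(areaMeasure (X t)))) ≤ 0 := by
  intro t ht
  have hX := hflow.surface.immersion t ht
  have hreg := hflow.scalar_deriv_regular t ht
  have hflux := hflow.no_flux t ht
  have hrate : ∀ p, normalTruesdellRate X ν ψ t p = Mψ⁻¹ * laplaceBeltrami (X t) (Dψ t) p :=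
    fun p => by rw [← hflow.scalar_eq t ht p, inv_mul_cancel_left₀ hMψ.ne']
  have hvel : ∀ p, normalVelocity X ν t p = -(MX⁻¹ * inner ℝ (ν t p) (DX t p)) := fun p => by
    rw [← mul_neg, ← hflow.spatial_eq t ht p, inv_mul_cancel_left₀ hMX.ne']
  refine ⟨?_, ?_, ?_⟩
  · refine (hflow.surface.hasDerivAt_integral_normalTruesdellRate hT hflow.smooth_scalar
      ht).congr_deriv ?_
    simp only [hrate]
    rw [integral_const_mul, integral_laplaceBeltrami hX hreg hflux, mul_zero]
  · refine (hflow.surface.hasDerivAt_energy hT U hflow.smooth_scalar ht (hflow.mem_dom t ht)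
      (hflow.spatial_deriv t ht) (hflow.scalar_deriv t ht)).congr_deriv ?_
    have h1 : ∀ p, inner ℝ (ν t p) (DX t p) * normalVelocity X ν t p =
        -MX⁻¹ * inner ℝ (ν t p) (DX t p) ^ 2 := fun p => by rw [hvel]; ring
    have h2 : ∀ p, Dψ t p * normalTruesdellRate X ν ψ t p =
        Mψ⁻¹ * (Dψ t p * laplaceBeltrami (X t) (Dψ t) p) := fun p => by rw [hrate]; ring
    simp only [h1, h2]
    rw [integral_const_mul, integral_const_mul, integral_mul_laplaceBeltrami hX hreg hflux]
    ring
  · have h1 : 0 ≤ ∫ p, (inner ℝ (ν t p) (DX t p)) ^ 2 ∂(areaMeasure (X t)) :=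
      integral_nonneg fun p => sq_nonneg _
    have h2 : 0 ≤ ∫ p, ‖surfaceGrad (X t) (Dψ t) p‖ ^ 2 ∂(areaMeasure (X t)) :=
      integral_nonneg fun p => sq_nonneg _
    have := mul_nonneg (inv_nonneg.2 hMX.le) h1
    have := mul_nonneg (inv_nonneg.2 hMψ.le) h2
    linarith
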